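/- Let $\mathbb T=\mathbb R/\mathbb Z$ with Lebesgue measure and the quotient (Euclidean) distance $|x-y|$. Let $f\in C^3(\mathbb T,\mathbb T)$ be uniformly expanding, i.e. there is $\sigma>1$ with $|f'(x)|>\sigma$ for all $x$, and let $H\in C^3(\mathbb T\times\mathbb T,\mathbb R)$. For $\delta\in\mathbb R$ and a positive continuous density $\varphi$ on $\mathbb T$ put $$g_\varphi(x)=x+\delta\int_{\mathbb T}H(x,y)\frac{\varphi(y)}{\int\varphi}\,dy \mod 1,$$ and let $\mathcal T\varphi$ be the (continuous) density of the push-forward $f_*(g_\varphi)_*(\varphi\,dx)$; that is, $\mathcal T\varphi=PL_\varphi\varphi$, where $P$ and $L_\varphi$ are the transfer operators of $f$ and $g_\varphi$. For $a,\alpha>0$ let $$\mathcal V_a=\Big\{\varphi\in C^1(\mathbb T,(0,\infty)):\ \tfrac{\varphi(x)}{\varphi(y)}\le e^{a|x-y|}\ \ \forall x,y\in\mathbb T\Big\},\qquad \mathcal C_\alpha=\Big\{\varphi\in C^2(\mathbb T,(0,\infty)):\ \Big|\tfrac{\varphi''(x)}{\varphi(x)}\Big|\le\alpha\ \ \forall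 x\in\mathbb T\Big\},$$ $U_{a,\alpha}=\mathcal V_a\cap\mathcal C_\alpha$, and let $d_{\mathcal V_a}$ be the Hilbert projective metric of $\mathcal V_a$, $$d_{\mathcal V_a}(\varphi,\psi)=\log\frac{\inf\{\beta>0:\ \beta\psi-\varphi\in\mathcal V_a\}}{\sup\{\beta>0:\ \varphi-\beta\psi\in\mathcal V_a\}}\in[0,\infty]$$ (with $\inf\emptyset=\infty$, $\sup\emptyset=0$). Then there is $\tilde\delta>0$ such that for every $\delta$ with $|\delta|\le\tilde\delta$ there are $a,\alpha>0$ for which $\mathcal T$ has an attracting fixed point in $U_{a,\alpha}$, in the following sense: 1. $\mathcal T(U_{a,\alpha})\subset U_{a,\alpha}$; 2. $\mathcal T$ is a strict contraction of $U_{a,\alpha}$ in the Hilbert metric: there is $r\in(0,1)$ with $d_{\mathcal V_a}(\mathcal T\varphi,\mathcal T\psi)\le r\,d_{\mathcal V_a}(\varphi,\psi)$ for all $\varphi,\psi\in U_{a,\alpha}$; 3. there is $\varphi_0\in U_{a,\alpha}$ with $\int\varphi_0=1$ and $\mathcal T\varphi_0=\varphi_0$, and $d_{\mathcal V_a}(\mathcal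 T^n\varphi,\varphi_0)\to0$ as $n\to\infty$ for every $\varphi\in U_{a,\alpha}$. -/

import Mathlib

open MeasureTheory Filter Topology
open scoped ENNReal

noncomputable section

/-! ### Hilbert projective metric of a cone -/

/-- The relation `φ ≤_V ψ` iff `ψ - φ ∈ V`. -/
def ConeLE {E : Type*} [AddCommGroup E] (V : Set E) (φ ψ : E) : Prop :=
  ψ - φ ∈ V

/-- `M_V(φ, ψ) = inf {β > 0 : φ ≤_V β ψ}`, with value `∞` if there is no such `β`. -/
def coneM {E : Type*} [AddCommGroup E] [Module ℝ E] (V : Set E) (φ ψ : E) : ℝ≥0∞ :=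
  sInf {b | ∃ β : ℝ, 0 < β ∧ ConeLE V φ (β • ψ) ∧ b = ENNReal.ofReal β}

/-- `m_V(φ, ψ) = sup {β > 0 : β ψ ≤_V φ}`, with value `0` if there is no such `β`. -/
def conem {E : Type*} [AddCommGroup E] [Module ℝ E] (V : Set E) (φ ψ : E) : ℝ≥0∞ :=
  sSup {b | ∃ β : ℝ, 0 < β ∧ ConeLE V (β • ψ) φ ∧ b = ENNReal.ofReal β}

/-- The Hilbert projective (pseudo)metric `d_V = log (M_V / m_V)` of a cone `V`; it may be `∞`. -/
def hilbertDist {E : Type*} [AddCommGroup E] [Module ℝ E] (V : Set E) (φ ψ : E) : EReal :=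
  ENNReal.log (coneM V φ ψ / conem V φ ψ)

/-! ### Differentiability on the circle `𝕋 = ℝ / ℤ` -/

/-- A map of the circle is of class `C^n` if it has a lift `ℝ → ℝ` of class `C^n`. -/
def CircleMapContDiff (n : ℕ) (f : UnitAddCircle → UnitAddCircle) : Prop :=
  ∃ F : ℝ → ℝ, ContDiff ℝ n F ∧ ∀ x : ℝ, f (x : UnitAddCircle) = (F x : UnitAddCircle)

/-- `f` is differentiable and `|f'| > σ` everywhere for some `σ > 1`; the derivative of `f` is
that of a differentiable lift (two such lifts differ by a constant). -/
def UniformlyExpanding (f : UnitAddCircle → UnitAddCircle) : Prop :=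
  ∃ F : ℝ → ℝ, Differentiable ℝ F ∧ (∀ x : ℝ, f (x : UnitAddCircle) = (F x : UnitAddCircle)) ∧
    ∃ σ : ℝ, 1 < σ ∧ ∀ x : ℝ, σ < |deriv F x|

/-- The `1`-periodic function on `ℝ` corresponding to a function on the circle. -/
def periodize (φ : UnitAddCircle → ℝ) : ℝ → ℝ := fun x => φ (x : UnitAddCircle)

/-- A real function on `𝕋 × 𝕋` is of class `C^n` if it is so as a doubly periodic function. -/
def TorusContDiff (n : ℕ) (H : UnitAddCircle × UnitAddCircle → ℝ) : Prop :=
  ContDiff ℝ n (fun p : ℝ × ℝ => H ((p.1 : UnitAddCircle), (p.2 : UnitAddCircle)))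

/-! ### The cones -/

/-- The cone `V_a` of positive `C^1` functions that are `a`-log-Lipschitz. -/
def logLipCone (a : ℝ) : Set (UnitAddCircle → ℝ) :=
  {φ | ContDiff ℝ 1 (periodize φ) ∧ (∀ x, 0 < φ x) ∧
    ∀ x y, φ x / φ y ≤ Real.exp (a * dist x y)}

/-- The cone `C_α` of positive `C^2` functions with `|φ'' / φ| ≤ α`. -/
def secondDerivCone (α : ℝ) : Set (UnitAddCircle → ℝ) :=
  {φ | ContDiff ℝ 2 (periodize φ) ∧ (∀ x, 0 < φ x) ∧
    ∀ x : ℝ, |iteratedDeriv 2 (periodize φ) x / periodize φ x| ≤ α}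

/-- `U_{a,α} = V_a ∩ C_α`. -/
def regCone (a α : ℝ) : Set (UnitAddCircle → ℝ) :=
  logLipCone a ∩ secondDerivCone α

/-! ### The self-consistent transfer operator -/

/-- The mean-field coupling map `g_μ(x) = x + δ ∫ H(x, y) dμ(y) mod 1`, where the integral is
normalised by the total mass of `μ`. -/
def couplingMap (H : UnitAddCircle × UnitAddCircle → ℝ) (δ : ℝ) (μ : Measure UnitAddCircle)
    (x : UnitAddCircle) : UnitAddCircle :=
  x + ((δ * ⨍ y, H (x, y) ∂μ : ℝ) : UnitAddCircle)

/-- `𝓛 μ = L_μ μ`: the push-forward of `μ` under its own coupling map `g_μ`. -/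
def couplingSTO (H : UnitAddCircle × UnitAddCircle → ℝ) (δ : ℝ) (μ : Measure UnitAddCircle) :
    Measure UnitAddCircle :=
  μ.map (couplingMap H δ μ)

/-- The self-consistent transfer operator `𝓣 = P 𝓛` on measures, where `P` is the push-forward
under `f`. -/
def measureSTO (f : UnitAddCircle → UnitAddCircle) (H : UnitAddCircle × UnitAddCircle → ℝ)
    (δ : ℝ) (μ : Measure UnitAddCircle) : Measure UnitAddCircle :=
  (couplingSTO H δ μ).map f

/-- The measure with density `φ` with respect to Lebesgue measure. -/
def densityMeasure (φ : UnitAddCircle → ℝ) : Measure UnitAddCircle :=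
  volume.withDensity (fun x => ENNReal.ofReal (φ x))

/-- `φ` is a continuous density of `μ` with respect to Lebesgue measure. -/
def IsContDensity (μ : Measure UnitAddCircle) (φ : UnitAddCircle → ℝ) : Prop :=
  Continuous φ ∧ (∀ x, 0 ≤ φ x) ∧ μ = densityMeasure φ

theorem IsContDensity.unique {μ : Measure UnitAddCircle} {φ ψ : UnitAddCircle → ℝ}
    (hφ : IsContDensity μ φ) (hψ : IsContDensity μ ψ) : φ = ψ := by
  obtain ⟨cφ, pφ, rfl⟩ := hφ
  obtain ⟨cψ, pψ, h⟩ := hψ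
  have h1 := (withDensity_eq_iff_of_sigmaFinite
    (ENNReal.measurable_ofReal.comp cφ.measurable).aemeasurable
    (ENNReal.measurable_ofReal.comp cψ.measurable).aemeasurable).1 h
  refine (Continuous.ae_eq_iff_eq volume cφ cψ).1 ?_
  filter_upwards [h1] with x hx
  exact (ENNReal.ofReal_eq_ofReal_iff (pφ x) (pψ x)).1 hx

open Classical in
/-- The continuous density of `μ` (which is unique), and `0` if there is none. -/
def contDensity (μ : Measure UnitAddCircle) : UnitAddCircle → ℝ :=
  if h : ∃ φ, IsContDensity μ φ then h.choose else 0

theorem IsContDensity.contDensity_eq {μ : Measure UnitAddCircle} {φ : UnitAddCircle → ℝ}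
    (hφ : IsContDensity μ φ) : contDensity μ = φ := by
  have h : ∃ φ, IsContDensity μ φ := ⟨φ, hφ⟩
  rw [contDensity, dif_pos h]
  exact h.choose_spec.unique hφ

theorem isContDensity_of_pos {μ : Measure UnitAddCircle}
    (hμ : ∀ x, 0 < contDensity μ x) : IsContDensity μ (contDensity μ) := by
  by_cases h : ∃ φ, IsContDensity μ φ
  · rw [contDensity, dif_pos h]
    exact h.choose_spec
  · have := hμ 0
    rw [contDensity, dif_neg h] at this
    exact absurd this (lt_irrefl _)

/-- The self-consistent transfer operator `𝓣` acting on densities: `𝓣 φ` is the continuous density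
of the image under `𝓣` of the measure with density `φ`. -/
def densitySTO (f : UnitAddCircle → UnitAddCircle) (H : UnitAddCircle × UnitAddCircle → ℝ)
    (δ : ℝ) (φ : UnitAddCircle → ℝ) : UnitAddCircle → ℝ :=
  contDensity (measureSTO f H δ (densityMeasure φ))

end

/-! Freeze the mean field `h`, the average of `H(x, ·)` against the normalised density. The
self-consistent operator then becomes the linear operator `stepOp`, the transfer operator of `f`
after that of `x ↦ x + δ h(x)`, and `Model.periodize_densitySTO` says that it acts on `φ` as the
frozen operator for the field of `φ` itself. The argument combines a contraction for each frozen
operator with a perturbation estimate in the field.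

Linear part. Inverse branches of `f` contract by `θ < 1`. For small `δ` the inverse displacement
expands by at most `dispRate θ`, and `θ * dispRate θ < 1`. Differentiating weighted compositions
once and twice (`Branch.c1Cone`, `Branch.c2Cone`) therefore gives Lasota–Yorke inequalities: for
suitable `a` and `α` the conditions `|u'| ≤ a u`, `|u''| ≤ α u` reappear with strictly smaller
constants. The smaller cone has finite projective diameter in the larger one, so Birkhoff's argument
(`exists_contracted_bounds`, `IsMarkov.contraction`) yields a rate `r < 1` that depends neither on
`δ` nor on the field.

Nonlinear part. If `φ` and `ψ` are at Hilbert distance `d`, their normalised averages, hence their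
fields, differ by `O(d)` (`KernelBound.abs_meanField_sub_le`). Changing the field by `τ` in `C^2`
moves the image of one density by `O(|δ| τ)` in the Hilbert metric (`Model.coneBounds_stepOp`).
Comparing derivatives of `u` at two nearby points costs a second derivative, which is why the cone
of `|u''| ≤ α u` is needed. In total the distance becomes at most `(r + O(|δ|)) d`, and small `δ`
gives the rate `(1 + r) / 2` (`Model.hilbertDist_densitySTO_le`).

Fixed point. No completeness of the cones in the Hilbert metric is used. Each frozen operator has an
invariant density, obtained by iterating the constant `1` with `C^2` convergence
(`IsMarkov.exists_invariant`). It depends on the field with Lipschitz constant `O(|δ|)`, so sending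
a density to the invariant density of its frozen operator is a sup-norm contraction of a closed set
of continuous functions (`Model.exists_fixed`). Its fixed point is invariant under the
self-consistent operator, and the nonlinear contraction makes it attracting. -/

namespace SelfConsistent

/-! ### Cones of functions on the line -/

/-- Nonnegative `C^1` functions on `ℝ` with `|u'| ≤ a u`. -/
structure C1Cone (a : ℝ) (u : ℝ → ℝ) : Prop where
  contDiff : ContDiff ℝ 1 u
  nonneg : ∀ x, 0 ≤ u x
  deriv_le : ∀ x, |deriv u x| ≤ a * u x

/-- Nonnegative `C^2` functions on `ℝ` with `|u'| ≤ a u` and `|u''| ≤ α u`. -/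
structure C2Cone (a α : ℝ) (u : ℝ → ℝ) : Prop where
  contDiff : ContDiff ℝ 2 u
  nonneg : ∀ x, 0 ≤ u x
  deriv_le : ∀ x, |deriv u x| ≤ a * u x
  deriv2_le : ∀ x, |deriv (deriv u) x| ≤ α * u x

theorem C2Cone.c1 {a α : ℝ} {u : ℝ → ℝ} (h : C2Cone a α u) : C1Cone a u :=
  ⟨h.contDiff.of_le (by norm_num), h.nonneg, h.deriv_le⟩

theorem hasDerivAt_of_contDiff_one {u : ℝ → ℝ} (h : ContDiff ℝ 1 u) (x : ℝ) :
    HasDerivAt u (deriv u x) x :=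
  (h.differentiable (by norm_num) x).hasDerivAt

theorem hasDerivAt_of_contDiff_two {u : ℝ → ℝ} (h : ContDiff ℝ 2 u) (x : ℝ) :
    HasDerivAt u (deriv u x) x :=
  (h.differentiable (by norm_num) x).hasDerivAt

theorem contDiff_deriv_of_two {u : ℝ → ℝ} (h : ContDiff ℝ 2 u) : ContDiff ℝ 1 (deriv u) :=
  ((contDiff_succ_iff_deriv (n := 1)).1 h).2.2

theorem hasDerivAt_deriv_of_contDiff_two {u : ℝ → ℝ} (h : ContDiff ℝ 2 u) (x : ℝ) :
    HasDerivAt (deriv u) (deriv (deriv u) x) x :=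
  hasDerivAt_of_contDiff_one (contDiff_deriv_of_two h) x

/-- Gronwall: `exp (-a t) u(± t)` is nonincreasing. The two signs treat the two orders of `x` and
`y`, and no logarithm is taken because `u` may vanish. -/
theorem C1Cone.le_exp_mul {a : ℝ} {u : ℝ → ℝ} (h : C1Cone a u) (x y : ℝ) :
    u x ≤ Real.exp (a * |x - y|) * u y := by
  have key : ∀ s : ℝ, (s = 1 ∨ s = -1) → Antitone (fun t => Real.exp (-(a * t)) * u (s * t)) := by
    intro s hs
    have hd : ∀ t, HasDerivAt (fun t => Real.exp (-(a * t)) * u (s * t))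
        (Real.exp (-(a * t)) * (-a) * u (s * t) + Real.exp (-(a * t)) * (deriv u (s * t) * s)) t := by
      intro t
      have h1 : HasDerivAt (fun t : ℝ => -(a * t)) (-a) t := by
        simpa using ((hasDerivAt_id t).const_mul a).fun_neg
      have h2 : HasDerivAt (fun t : ℝ => s * t) s t := by
        simpa using (hasDerivAt_id t).const_mul s
      exact h1.exp.mul ((hasDerivAt_of_contDiff_one h.contDiff (s * t)).comp t h2)
    refine antitone_of_deriv_nonpos (fun t => (hd t).differentiableAt) fun t => ?_
    rw [(hd t).deriv]
    have h3 := abs_le.1 (h.deriv_le (s * t))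
    have h4 : deriv u (s * t) * s ≤ a * u (s * t) := by
      rcases hs with rfl | rfl <;> linarith
    nlinarith [Real.exp_pos (-(a * t)), mul_le_mul_of_nonneg_left h4 (Real.exp_pos (-(a * t))).le]
  have fin : ∀ p q r : ℝ, Real.exp (-(a * p)) * r ≤ Real.exp (-(a * q)) * u y → p - q = |x - y| →
      r ≤ Real.exp (a * |x - y|) * u y := by
    intro p q r h1 h2
    have h3 := mul_le_mul_of_nonneg_left h1 (Real.exp_pos (a * p)).le
    rw [← mul_assoc, ← mul_assoc, ← Real.exp_add, ← Real.exp_add] at h3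
    have e1 : a * p + -(a * p) = 0 := by ring
    have e2 : a * p + -(a * q) = a * |x - y| := by rw [← h2]; ring
    rwa [e1, e2, Real.exp_zero, one_mul] at h3
  rcases le_total y x with hyx | hyx
  · have h1 := key 1 (Or.inl rfl) hyx
    simp only [one_mul] at h1
    exact fin x y _ h1 (abs_of_nonneg (sub_nonneg.2 hyx)).symm
  · have h1 := key (-1) (Or.inr rfl) (neg_le_neg hyx)
    simp only [neg_mul, one_mul, neg_neg] at h1
    refine fin (-x) (-y) _ (by simpa using h1) ?_
    rw [abs_of_nonpos (sub_nonpos.2 hyx)]; ring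

/-- A Harnack inequality: some integer translate of `y` lies within distance `1` of `x`. It is the
source of every finite-diameter estimate below. -/
theorem C1Cone.le_exp_mul_of_periodic {a : ℝ} {u : ℝ → ℝ} (h : C1Cone a u) (ha : 0 ≤ a)
    (hp : Function.Periodic u 1) (x y : ℝ) : u x ≤ Real.exp a * u y := by
  have h1 := h.le_exp_mul x (y + (⌊x - y⌋ : ℝ))
  have h2 : u (y + (⌊x - y⌋ : ℝ)) = u y := by simpa using hp.int_mul ⌊x - y⌋ y
  rw [h2] at h1
  refine h1.trans (mul_le_mul_of_nonneg_right (Real.exp_le_exp.2 ?_) (h.nonneg y))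
  have h3 : |x - (y + (⌊x - y⌋ : ℝ))| ≤ 1 := by
    rw [abs_le]; constructor <;> linarith [Int.floor_le (x - y), Int.lt_floor_add_one (x - y)]
  nlinarith

theorem C1Cone.mono {a b : ℝ} {u : ℝ → ℝ} (h : C1Cone a u) (hab : a ≤ b) : C1Cone b u :=
  ⟨h.contDiff, h.nonneg, fun x => (h.deriv_le x).trans
    (mul_le_mul_of_nonneg_right hab (h.nonneg x))⟩

theorem C2Cone.mono {a b α β : ℝ} {u : ℝ → ℝ} (h : C2Cone a α u) (hab : a ≤ b) (hαβ : α ≤ β) :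
    C2Cone b β u :=
  ⟨h.contDiff, h.nonneg, (h.c1.mono hab).deriv_le, fun x => (h.deriv2_le x).trans
    (mul_le_mul_of_nonneg_right hαβ (h.nonneg x))⟩

theorem C1Cone.sum {ι : Type*} (s : Finset ι) {a : ℝ} {u : ι → ℝ → ℝ}
    (h : ∀ i ∈ s, C1Cone a (u i)) : C1Cone a (fun x => ∑ i ∈ s, u i x) := by
  have hd : ∀ x, HasDerivAt (fun x => ∑ i ∈ s, u i x) (∑ i ∈ s, deriv (u i) x) x := fun x =>
    HasDerivAt.fun_sum fun i hi => hasDerivAt_of_contDiff_one (h i hi).contDiff x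
  refine ⟨ContDiff.sum fun i hi => (h i hi).contDiff,
    fun x => Finset.sum_nonneg fun i hi => (h i hi).nonneg x, fun x => ?_⟩
  rw [(hd x).deriv, Finset.mul_sum]
  exact (Finset.abs_sum_le_sum_abs _ _).trans
    (Finset.sum_le_sum fun i hi => (h i hi).deriv_le x)

theorem C2Cone.sum {ι : Type*} (s : Finset ι) {a α : ℝ} {u : ι → ℝ → ℝ}
    (h : ∀ i ∈ s, C2Cone a α (u i)) : C2Cone a α (fun x => ∑ i ∈ s, u i x) := by
  have hd : deriv (fun x => ∑ i ∈ s, u i x) = fun x => ∑ i ∈ s, deriv (u i) x := funext fun x =>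
    (HasDerivAt.fun_sum fun i hi => hasDerivAt_of_contDiff_two (h i hi).contDiff x).deriv
  have hd2 : ∀ x, HasDerivAt (fun x => ∑ i ∈ s, deriv (u i) x)
      (∑ i ∈ s, deriv (deriv (u i)) x) x := fun x =>
    HasDerivAt.fun_sum fun i hi => hasDerivAt_deriv_of_contDiff_two (h i hi).contDiff x
  have h1 := C1Cone.sum s fun i hi => (h i hi).c1
  refine ⟨ContDiff.sum fun i hi => (h i hi).contDiff, h1.nonneg, h1.deriv_le, fun x => ?_⟩
  rw [hd, (hd2 x).deriv, Finset.mul_sum]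
  exact (Finset.abs_sum_le_sum_abs _ _).trans
    (Finset.sum_le_sum fun i hi => (h i hi).deriv2_le x)

/-! ### Weighted composition -/

/-- Bounds for a weight `w` and a branch `y`, which pass to the operator `u ↦ w * u ∘ y`. -/
structure Branch (w y : ℝ → ℝ) (θ c : ℝ) : Prop where
  cw : ContDiff ℝ 2 w
  cy : ContDiff ℝ 2 y
  pos : ∀ x, 0 < w x
  dy : ∀ x, |deriv y x| ≤ θ
  ddy : ∀ x, |deriv (deriv y) x| ≤ c
  dw : ∀ x, |deriv w x| ≤ c * w x
  ddw : ∀ x, |deriv (deriv w) x| ≤ c * w x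

theorem Branch.c_nonneg {w y : ℝ → ℝ} {θ c : ℝ} (h : Branch w y θ c) : 0 ≤ c :=
  (abs_nonneg _).trans (h.ddy 0)

theorem Branch.θ_nonneg {w y : ℝ → ℝ} {θ c : ℝ} (h : Branch w y θ c) : 0 ≤ θ :=
  (abs_nonneg _).trans (h.dy 0)

theorem Branch.hasDerivAt {w y : ℝ → ℝ} {θ c : ℝ} (h : Branch w y θ c) {u : ℝ → ℝ}
    (hu : ContDiff ℝ 1 u) (x : ℝ) : HasDerivAt (fun x => w x * u (y x))
      (deriv w x * u (y x) + w x * (deriv u (y x) * deriv y x)) x :=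
  (hasDerivAt_of_contDiff_two h.cw x).mul
    ((hasDerivAt_of_contDiff_one hu (y x)).comp x (hasDerivAt_of_contDiff_two h.cy x))

/-- First-order Lasota–Yorke inequality: distortion of the weight costs `c`, and the chain rule
multiplies the old constant by `θ`. -/
theorem Branch.c1Cone {w y : ℝ → ℝ} {θ c : ℝ} (h : Branch w y θ c) {a : ℝ} {u : ℝ → ℝ}
    (hu : C1Cone a u) : C1Cone (c + θ * a) (fun x => w x * u (y x)) := by
  refine ⟨(h.cw.of_le (by norm_num)).mul (hu.contDiff.comp (h.cy.of_le (by norm_num))),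
    fun x => mul_nonneg (h.pos x).le (hu.nonneg _), fun x => ?_⟩
  rw [(h.hasDerivAt hu.contDiff x).deriv]
  have h1 : |deriv w x * u (y x)| ≤ c * w x * u (y x) := by
    rw [abs_mul, abs_of_nonneg (hu.nonneg (y x))]
    exact mul_le_mul_of_nonneg_right (h.dw x) (hu.nonneg _)
  have h2 : |w x * (deriv u (y x) * deriv y x)| ≤ w x * (a * u (y x) * θ) := by
    rw [abs_mul, abs_mul, abs_of_pos (h.pos x)]
    refine mul_le_mul_of_nonneg_left (mul_le_mul (hu.deriv_le _) (h.dy x) (abs_nonneg _) ?_)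
      (h.pos x).le
    exact (abs_nonneg _).trans (hu.deriv_le _)
  refine (abs_add_le _ _).trans ((add_le_add h1 h2).trans (le_of_eq ?_))
  ring

/-- In the second derivative of `w * u ∘ y` only the term `w u''(y) y'^2` involves `α`, hence the
factor `θ ^ 2`; all other terms are controlled by `c` and `a`. -/
theorem Branch.c2Cone {w y : ℝ → ℝ} {θ c : ℝ} (h : Branch w y θ c) {a α : ℝ} {u : ℝ → ℝ}
    (hu : C2Cone a α u) : C2Cone (c + θ * a) (c + (2 * c * θ + c) * a + θ ^ 2 * α)
      (fun x => w x * u (y x)) := by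
  have h1 := h.c1Cone hu.c1
  refine ⟨h.cw.mul (hu.contDiff.comp h.cy), h1.nonneg, h1.deriv_le, fun x => ?_⟩
  have hd : deriv (fun x => w x * u (y x)) =
      fun x => deriv w x * u (y x) + w x * (deriv u (y x) * deriv y x) :=
    funext fun x => (h.hasDerivAt hu.c1.contDiff x).deriv
  have hyx := hasDerivAt_of_contDiff_two h.cy x
  have hd2 : HasDerivAt (fun x => deriv w x * u (y x) + w x * (deriv u (y x) * deriv y x))
      (deriv (deriv w) x * u (y x) + deriv w x * (deriv u (y x) * deriv y x)
        + (deriv w x * (deriv u (y x) * deriv y x) + w x *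
          (deriv (deriv u) (y x) * deriv y x * deriv y x + deriv u (y x) * deriv (deriv y) x))) x :=
    ((hasDerivAt_deriv_of_contDiff_two h.cw x).mul
      ((hasDerivAt_of_contDiff_two hu.contDiff (y x)).comp x hyx)).add
    ((hasDerivAt_of_contDiff_two h.cw x).mul
      (((hasDerivAt_deriv_of_contDiff_two hu.contDiff (y x)).comp x hyx).mul
        (hasDerivAt_deriv_of_contDiff_two h.cy x)))
  rw [hd, hd2.deriv]
  have u0 := hu.nonneg (y x)
  have w0 := (h.pos x).le
  have c0 := h.c_nonneg
  have t0 := h.θ_nonneg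
  have A0 : 0 ≤ a * u (y x) := (abs_nonneg _).trans (hu.deriv_le _)
  have B0 : 0 ≤ α * u (y x) := (abs_nonneg _).trans (hu.deriv2_le _)
  have e1 : |deriv (deriv w) x * u (y x)| ≤ c * w x * u (y x) := by
    rw [abs_mul, abs_of_nonneg u0]; exact mul_le_mul_of_nonneg_right (h.ddw x) u0
  have e2 : |deriv w x * (deriv u (y x) * deriv y x)| ≤ c * w x * (a * u (y x) * θ) := by
    rw [abs_mul, abs_mul]
    exact mul_le_mul (h.dw x) (mul_le_mul (hu.deriv_le _) (h.dy x) (abs_nonneg _) A0)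
      (by positivity) (by positivity)
  have e3 : |w x * (deriv (deriv u) (y x) * deriv y x * deriv y x + deriv u (y x) *
      deriv (deriv y) x)| ≤ w x * (α * u (y x) * θ * θ + a * u (y x) * c) := by
    rw [abs_mul, abs_of_nonneg w0]
    refine mul_le_mul_of_nonneg_left ((abs_add_le _ _).trans (add_le_add ?_ ?_)) w0
    · rw [abs_mul, abs_mul]
      exact mul_le_mul (mul_le_mul (hu.deriv2_le _) (h.dy x) (abs_nonneg _) B0) (h.dy x)
        (abs_nonneg _) (by positivity)
    · rw [abs_mul]
      exact mul_le_mul (hu.deriv_le _) (h.ddy x) (abs_nonneg _) A0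
  refine (abs_add_le _ _).trans ((add_le_add ((abs_add_le _ _).trans (add_le_add e1 e2))
    ((abs_add_le _ _).trans (add_le_add e2 e3))).trans (le_of_eq ?_))
  ring

/-! ### Birkhoff contraction for comparable families -/

/-- Both sides vanish at `M = m`, so it is enough that right minus left is monotone in `M`. The two
quotients are the contracted bounds in Birkhoff's argument. -/
theorem log_moebius_le {m M s κ : ℝ} (hm : 0 < m) (hmM : m ≤ M) (hs : 0 < s) (hκ : 1 ≤ κ) :
    Real.log ((M * (κ * s) + m) / (κ * s + 1)) - Real.log ((M * s + m) / (s + 1)) ≤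
      (1 - 1 / κ) * (Real.log M - Real.log m) := by
  have hκ0 : 0 < κ := by linarith
  -- Right side minus left side as a function of the upper bound `t`, up to terms independent of
  -- `t`.
  let F : ℝ → ℝ := fun t => (1 - 1 / κ) * Real.log t - Real.log (t * (κ * s) + m)
    + Real.log (t * s + m)
  have hF : ∀ t ∈ Set.Ici m, HasDerivAt F ((1 - 1 / κ) * t⁻¹ - (κ * s) / (t * (κ * s) + m)
      + s / (t * s + m)) t := by
    intro t ht
    have t0 : 0 < t := hm.trans_le ht
    have d : ∀ c : ℝ, HasDerivAt (fun t : ℝ => t * c + m) c t := fun c => by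
      simpa using ((hasDerivAt_id t).mul_const c).add_const m
    exact (((Real.hasDerivAt_log t0.ne').const_mul _).sub
      ((d (κ * s)).log (by positivity))).add ((d s).log (by positivity))
  have hmono : MonotoneOn F (Set.Ici m) := by
    refine monotoneOn_of_deriv_nonneg (convex_Ici m)
      (fun t ht => (hF t ht).continuousAt.continuousWithinAt)
      (fun t ht => (hF t (interior_subset ht)).differentiableAt.differentiableWithinAt)
      fun t ht => ?_
    have ht' := interior_subset ht
    have t0 : 0 < t := hm.trans_le ht'
    rw [(hF t ht').deriv]
    have e : (1 - 1 / κ) * t⁻¹ - (κ * s) / (t * (κ * s) + m) + s / (t * s + m) =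
        (κ - 1) * (κ * t ^ 2 * s ^ 2 + t * s * m + m ^ 2) /
          (κ * t * (t * (κ * s) + m) * (t * s + m)) := by
      field_simp
      ring
    rw [e]
    have : 0 ≤ κ - 1 := by linarith
    positivity
  have h := hmono (Set.self_mem_Ici) (show M ∈ Set.Ici m from hmM) hmM
  have hM : 0 < M := hm.trans_le hmM
  simp only [F] at h
  rw [show m * (κ * s) + m = m * (κ * s + 1) by ring, show m * s + m = m * (s + 1) by ring,
    Real.log_mul hm.ne' (by positivity), Real.log_mul hm.ne' (by positivity)] at h
  rw [Real.log_div (by positivity) (by positivity), Real.log_div (by positivity) (by positivity)]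
  linarith

/-- Birkhoff's contraction argument for families of linear functionals: if the values of
`X - m Y` and of `M Y - X` under any two functionals are comparable up to the factor `κ`,
then `X` and `Y` are closer than `(m, M)` by a definite factor. -/
theorem exists_contracted_bounds {ι : Type*} [Nonempty ι] {X Y : ι → ℝ} {m M κ : ℝ} (hm : 0 < m)
    (hmM : m ≤ M) (hκ : 1 ≤ κ) (hP0 : ∀ i, m * Y i ≤ X i) (hQ0 : ∀ i, X i ≤ M * Y i)
    (hP : ∀ i j, X i - m * Y i ≤ κ * (X j - m * Y j))
    (hQ : ∀ i j, M * Y i - X i ≤ κ * (M * Y j - X j)) :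
    ∃ m' M' : ℝ, m ≤ m' ∧ m' ≤ M' ∧ M' ≤ M ∧
      Real.log M' - Real.log m' ≤ (1 - 1 / κ ^ 4) * (Real.log M - Real.log m) ∧
      ∀ i, m' * Y i ≤ X i ∧ X i ≤ M' * Y i := by
  have hM : 0 < M := hm.trans_le hmM
  have hr : 0 ≤ (1 - 1 / κ ^ 4) * (Real.log M - Real.log m) := by
    refine mul_nonneg ?_ (sub_nonneg.2 (Real.log_le_log hm hmM))
    have : 1 / κ ^ 4 ≤ 1 := by
      rw [div_le_one (by positivity)]; exact one_le_pow₀ hκ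
    linarith
  obtain ⟨i0⟩ := ‹Nonempty ι›
  -- If `X - m Y` vanishes at one index, comparability makes it vanish at all of them, so the
  -- interval collapses to `m`; likewise for `M Y - X` below.
  rcases (sub_nonneg.2 (hP0 i0)).eq_or_lt with hp | hp
  · refine ⟨m, m, le_rfl, le_rfl, hmM, by simpa using hr, fun i => ⟨hP0 i, ?_⟩⟩
    have := hP i i0
    rw [← hp, mul_zero] at this
    linarith
  rcases (sub_nonneg.2 (hQ0 i0)).eq_or_lt with hq | hq
  · refine ⟨M, M, hmM, le_rfl, le_rfl, by simpa using hr, fun i => ⟨?_, hQ0 i⟩⟩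
    have := hQ i i0
    rw [← hq, mul_zero] at this
    linarith
  set p := X i0 - m * Y i0
  set q := M * Y i0 - X i0
  have hκ0 : 0 < κ := by linarith
  -- The quotients `(X i - m Y i) / (M Y i - X i)` lie between `s = p / (κ² q)` and `κ² p / q = κ⁴
  -- s`. Solving for `X i / Y i` turns these limits into the two Möbius values used as witnesses.
  set s := p / (q * κ ^ 2) with hs
  have s0 : 0 < s := by positivity
  have hκ4 : 1 ≤ κ ^ 4 := one_le_pow₀ hκ
  have e2 : κ ^ 4 * s = κ ^ 2 * p / q := by rw [hs]; field_simp
  refine ⟨(M * s + m) / (s + 1), (M * (κ ^ 4 * s) + m) / (κ ^ 4 * s + 1), ?_, ?_, ?_,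
    log_moebius_le hm hmM s0 hκ4, fun i => ⟨?_, ?_⟩⟩
  · rw [le_div_iff₀ (by positivity)]; nlinarith
  · rw [div_le_div_iff₀ (by positivity) (by positivity)]
    nlinarith [mul_nonneg (sub_nonneg.2 hmM) (mul_nonneg (sub_nonneg.2 hκ4) s0.le)]
  · rw [div_le_iff₀ (by positivity)]; nlinarith
  · have h1 : s * (M * Y i - X i) ≤ X i - m * Y i := by
      have h2 : M * Y i - X i ≤ κ * q := hQ i i0
      have h3 : p ≤ κ * (X i - m * Y i) := hP i0 i
      calc s * (M * Y i - X i) ≤ s * (κ * q) := mul_le_mul_of_nonneg_left h2 s0.le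
        _ = p / κ := by rw [hs]; field_simp
        _ ≤ _ := by rw [div_le_iff₀ hκ0]; linarith
    rw [div_mul_eq_mul_div, div_le_iff₀ (by positivity)]
    linarith
  · have h1 : X i - m * Y i ≤ (κ ^ 4 * s) * (M * Y i - X i) := by
      have h2 : X i - m * Y i ≤ κ * p := hP i i0
      have h3 : q ≤ κ * (M * Y i - X i) := hQ i0 i
      have h4 : q / κ ≤ M * Y i - X i := by rw [div_le_iff₀ hκ0]; linarith
      calc X i - m * Y i ≤ κ * p := h2
        _ = (κ ^ 4 * s) * (q / κ) := by rw [hs]; field_simp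
        _ ≤ _ := mul_le_mul_of_nonneg_left h4 (by positivity)
    rw [div_mul_eq_mul_div, le_div_iff₀ (by positivity)]
    linarith

/-- Positive families that are comparable to their values at one index are at bounded distance. -/
theorem exists_bounds_of_comparable {ι : Type*} [Nonempty ι] {X Y : ι → ℝ} {κ : ℝ} (hκ1 : 1 ≤ κ)
    (hX0 : ∀ i, 0 < X i) (hY0 : ∀ i, 0 < Y i) (hX : ∀ i j, X i ≤ κ * X j)
    (hY : ∀ i j, Y i ≤ κ * Y j) :
    ∃ m M : ℝ, 0 < m ∧ m ≤ M ∧ (∀ i, m * Y i ≤ X i ∧ X i ≤ M * Y i) ∧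
      Real.log M - Real.log m = 4 * Real.log κ := by
  obtain ⟨i0⟩ := ‹Nonempty ι›
  have hp := hX0 i0
  have hq := hY0 i0
  have hκ : 0 < κ := by linarith
  refine ⟨X i0 / (κ ^ 2 * Y i0), κ ^ 2 * X i0 / Y i0, by positivity, ?_, fun i => ⟨?_, ?_⟩, ?_⟩
  · rw [div_le_div_iff₀ (by positivity) hq]
    have : 1 ≤ κ ^ 4 := one_le_pow₀ hκ1
    nlinarith [mul_pos hp hq]
  · calc X i0 / (κ ^ 2 * Y i0) * Y i ≤ X i0 / (κ ^ 2 * Y i0) * (κ * Y i0) :=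
          mul_le_mul_of_nonneg_left (hY i i0) (by positivity)
      _ = X i0 / κ := by field_simp
      _ ≤ _ := by rw [div_le_iff₀ hκ, mul_comm]; exact hX i0 i
  · calc X i ≤ κ * X i0 := hX i i0
      _ = κ ^ 2 * X i0 / Y i0 * (Y i0 / κ) := by field_simp
      _ ≤ _ := by
        refine mul_le_mul_of_nonneg_left ?_ (by positivity)
        rw [div_le_iff₀ hκ, mul_comm]; exact hY i0 i
  · rw [← Real.log_div (by positivity) (by positivity), ← Nat.cast_ofNat (n := 4), ← Real.log_pow]
    congr 1
    field_simp

/-! ### The functionals defining the cones -/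

/-- The sign `±1` of a Boolean. -/
noncomputable def sgn (b : Bool) : ℝ := if b then 1 else -1

/-- The functionals `a u(x) ± u'(x)` whose nonnegativity defines the cone `|u'| ≤ a u`. -/
noncomputable def coneFun (a : ℝ) (u : ℝ → ℝ) (i : Bool × ℝ) : ℝ := a * u i.2 + sgn i.1 * deriv u i.2

/-- Two-sided comparison of `u` and `v` in the order of the cone `|u'| ≤ a u`. -/
def ConeBounds (a : ℝ) (u v : ℝ → ℝ) (m M : ℝ) : Prop :=
  ∀ i, m * coneFun a v i ≤ coneFun a u i ∧ coneFun a u i ≤ M * coneFun a v i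

theorem abs_sgn_mul (b : Bool) (t : ℝ) : |sgn b * t| = |t| := by
  cases b <;> simp [sgn]

theorem sgn_mul_le (b : Bool) (t : ℝ) : sgn b * t ≤ |t| := by
  rw [← abs_sgn_mul b t]; exact le_abs_self _

theorem neg_abs_le_sgn_mul (b : Bool) (t : ℝ) : -|t| ≤ sgn b * t := by
  rw [← abs_sgn_mul b t]; exact neg_abs_le _

theorem coneFun_add_coneFun (a : ℝ) (u : ℝ → ℝ) (x : ℝ) :
    coneFun a u (true, x) + coneFun a u (false, x) = 2 * a * u x := by
  simp only [coneFun, sgn]; norm_num; ring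

theorem abs_deriv_le_of_coneFun_nonneg {a : ℝ} {u : ℝ → ℝ} (h : ∀ i, 0 ≤ coneFun a u i) (x : ℝ) :
    |deriv u x| ≤ a * u x := by
  have h1 := h (true, x)
  have h2 := h (false, x)
  simp only [coneFun, sgn] at h1 h2
  norm_num at h1 h2
  rw [abs_le]; constructor <;> linarith

theorem C1Cone.coneFun_nonneg {a : ℝ} {u : ℝ → ℝ} (h : C1Cone a u) (i : Bool × ℝ) :
    0 ≤ coneFun a u i := by
  have h1 := neg_abs_le_sgn_mul i.1 (deriv u i.2)
  have h2 := h.deriv_le i.2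
  simp only [coneFun]; linarith

theorem C1Cone.of_coneFun_nonneg {a : ℝ} (ha : 0 < a) {u : ℝ → ℝ} (hu : ContDiff ℝ 1 u)
    (h : ∀ i, 0 ≤ coneFun a u i) : C1Cone a u := by
  refine ⟨hu, fun x => ?_, abs_deriv_le_of_coneFun_nonneg h⟩
  have h1 := coneFun_add_coneFun a u x
  have h2 := add_nonneg (h (true, x)) (h (false, x))
  rw [h1] at h2
  nlinarith

theorem coneFun_sub_mul {a c : ℝ} {u v : ℝ → ℝ} (hu : ContDiff ℝ 1 u) (hv : ContDiff ℝ 1 v)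
    (i : Bool × ℝ) : coneFun a (fun x => u x - c * v x) i = coneFun a u i - c * coneFun a v i := by
  have := ((hasDerivAt_of_contDiff_one hu i.2).sub
    ((hasDerivAt_of_contDiff_one hv i.2).const_mul c)).deriv
  simp only [coneFun]
  erw [this]; ring

theorem coneFun_mul_sub {a c : ℝ} {u v : ℝ → ℝ} (hu : ContDiff ℝ 1 u) (hv : ContDiff ℝ 1 v)
    (i : Bool × ℝ) : coneFun a (fun x => c * v x - u x) i = c * coneFun a v i - coneFun a u i := by
  have := (((hasDerivAt_of_contDiff_one hv i.2).const_mul c).sub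
    (hasDerivAt_of_contDiff_one hu i.2)).deriv
  simp only [coneFun]
  erw [this]; ring

namespace ConeBounds

variable {a m M : ℝ} {u v : ℝ → ℝ}

theorem c1Cone_lower (h : ConeBounds a u v m M) (ha : 0 < a) (hu : ContDiff ℝ 1 u)
    (hv : ContDiff ℝ 1 v) : C1Cone a (fun x => u x - m * v x) :=
  C1Cone.of_coneFun_nonneg ha (hu.sub (contDiff_const.mul hv)) fun i => by
    rw [coneFun_sub_mul hu hv]; exact sub_nonneg.2 (h i).1

theorem c1Cone_upper (h : ConeBounds a u v m M) (ha : 0 < a) (hu : ContDiff ℝ 1 u)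
    (hv : ContDiff ℝ 1 v) : C1Cone a (fun x => M * v x - u x) :=
  C1Cone.of_coneFun_nonneg ha ((contDiff_const.mul hv).sub hu) fun i => by
    rw [coneFun_mul_sub hu hv]; exact sub_nonneg.2 (h i).2

/-- Adding the functionals of both signs at one point cancels the derivatives. -/
theorem lower (h : ConeBounds a u v m M) (ha : 0 < a) (x : ℝ) : m * v x ≤ u x := by
  have h1 := add_le_add (h (true, x)).1 (h (false, x)).1
  rw [← mul_add, coneFun_add_coneFun, coneFun_add_coneFun] at h1
  nlinarith

theorem upper (h : ConeBounds a u v m M) (ha : 0 < a) (x : ℝ) : u x ≤ M * v x := by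
  have h1 := add_le_add (h (true, x)).2 (h (false, x)).2
  rw [← mul_add, coneFun_add_coneFun, coneFun_add_coneFun] at h1
  nlinarith

/-- The triangle inequality of the Hilbert metric in multiplicative form. -/
theorem trans {w : ℝ → ℝ} {m' M' : ℝ} (h : ConeBounds a u v m M) (h' : ConeBounds a v w m' M')
    (hm : 0 ≤ m) (hM : 0 ≤ M) : ConeBounds a u w (m * m') (M * M') := fun i =>
  ⟨by rw [mul_assoc]; exact (mul_le_mul_of_nonneg_left (h' i).1 hm).trans (h i).1,
   by rw [mul_assoc]; exact (h i).2.trans (mul_le_mul_of_nonneg_left (h' i).2 hM)⟩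

end ConeBounds

theorem coneBounds_of_coneFun_sub_le {a η : ℝ} {u v : ℝ → ℝ}
    (h : ∀ i, |coneFun a u i - coneFun a v i| ≤ η * coneFun a v i) :
    ConeBounds a u v (1 - η) (1 + η) := fun i => by
  have := abs_le.1 (h i)
  constructor <;> linarith

theorem abs_coneFun_sub_le {a : ℝ} (ha : 0 ≤ a) (u v : ℝ → ℝ) (i : Bool × ℝ) :
    |coneFun a u i - coneFun a v i| ≤ a * |u i.2 - v i.2| + |deriv u i.2 - deriv v i.2| := by
  have e : coneFun a u i - coneFun a v i =
      a * (u i.2 - v i.2) + sgn i.1 * (deriv u i.2 - deriv v i.2) := by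
    simp only [coneFun]; ring
  rw [e]
  refine (abs_add_le _ _).trans ?_
  rw [abs_sgn_mul, abs_mul, abs_of_nonneg ha]

/-- The constant of comparability of the functionals `coneFun a` on the cone with parameter `b`. -/
noncomputable def coneRatio (a b : ℝ) : ℝ := (a + b) / (a - b) * Real.exp b

theorem one_le_coneRatio {a b : ℝ} (hb : 0 ≤ b) (hab : b < a) : 1 ≤ coneRatio a b := by
  refine one_le_mul_of_one_le_of_one_le ?_ (Real.one_le_exp hb)
  rw [one_le_div (by linarith)]; linarith

/-- On the smaller cone each functional lies between `a - b` and `a + b` times the value of `u` at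
its base point, and values at different points compare by Harnack. This is the finite diameter
required by Birkhoff's argument. -/
theorem C1Cone.coneFun_le_mul {a b : ℝ} (hb : 0 ≤ b) (hab : b < a) {u : ℝ → ℝ} (h : C1Cone b u)
    (hp : Function.Periodic u 1) (i j : Bool × ℝ) :
    coneFun a u i ≤ coneRatio a b * coneFun a u j := by
  have h1 : coneFun a u i ≤ (a + b) * u i.2 := by
    have := sgn_mul_le i.1 (deriv u i.2)
    have := h.deriv_le i.2
    simp only [coneFun]; linarith
  have h2 : (a - b) * u j.2 ≤ coneFun a u j := by
    have := neg_abs_le_sgn_mul j.1 (deriv u j.2)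
    have := h.deriv_le j.2
    simp only [coneFun]; linarith
  have h3 := h.le_exp_mul_of_periodic hb hp i.2 j.2
  have hg : 0 < a - b := by linarith
  calc coneFun a u i ≤ (a + b) * u i.2 := h1
    _ ≤ (a + b) * (Real.exp b * u j.2) := mul_le_mul_of_nonneg_left h3 (by linarith)
    _ = coneRatio a b * ((a - b) * u j.2) := by rw [coneRatio]; field_simp
    _ ≤ _ := mul_le_mul_of_nonneg_left h2 (by have := one_le_coneRatio hb hab; linarith)

theorem C1Cone.coneFun_pos {a b : ℝ} (hab : b < a) {u : ℝ → ℝ} (h : C1Cone b u)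
    (hpos : ∀ x, 0 < u x) (i : Bool × ℝ) : 0 < coneFun a u i := by
  have := neg_abs_le_sgn_mul i.1 (deriv u i.2)
  have := h.deriv_le i.2
  have := hpos i.2
  simp only [coneFun]; nlinarith

/-- Positive functions in a smaller cone are at bounded distance. -/
theorem exists_coneBounds {a b : ℝ} (hb : 0 ≤ b) (hab : b < a) {u v : ℝ → ℝ} (hu : C1Cone b u)
    (hv : C1Cone b v) (hpu : Function.Periodic u 1) (hpv : Function.Periodic v 1)
    (hu0 : ∀ x, 0 < u x) (hv0 : ∀ x, 0 < v x) :
    ∃ m M : ℝ, 0 < m ∧ m ≤ M ∧ ConeBounds a u v m M ∧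
      Real.log M - Real.log m = 4 * Real.log (coneRatio a b) := by
  exact exists_bounds_of_comparable (one_le_coneRatio hb hab) (hu.coneFun_pos hab hu0)
    (hv.coneFun_pos hab hv0) (hu.coneFun_le_mul hb hab hpu) (hv.coneFun_le_mul hb hab hpv)

/-! ### The cone of log-Lipschitz functions on the circle -/

theorem periodize_periodic (φ : UnitAddCircle → ℝ) : Function.Periodic (periodize φ) 1 := fun x => by
  simp [periodize]

theorem forall_periodize {φ : UnitAddCircle → ℝ} {p : ℝ → Prop} :
    (∀ x, p (φ x)) ↔ ∀ x, p (periodize φ x) :=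
  ⟨fun h x => h _, fun h x => by obtain ⟨t, rfl⟩ := QuotientAddGroup.mk_surjective x; exact h t⟩

theorem dist_coe_le (x y : ℝ) : dist (x : UnitAddCircle) (y : UnitAddCircle) ≤ |x - y| := by
  rw [dist_eq_norm, ← AddCircle.coe_sub, UnitAddCircle.norm_eq]
  have := round_le (x - y) 0
  simpa using this

theorem exists_dist_coe_eq (x y : ℝ) :
    ∃ n : ℤ, dist (x : UnitAddCircle) (y : UnitAddCircle) = |x - (y + n)| := by
  refine ⟨round (x - y), ?_⟩
  rw [dist_eq_norm, ← AddCircle.coe_sub, UnitAddCircle.norm_eq]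
  congr 1; ring

/-- The log-Lipschitz condition bounds the logarithmic derivative; this makes the cone an
intersection of linear half-spaces, apart from strict positivity. -/
theorem mem_logLipCone_iff {a : ℝ} (ha : 0 ≤ a) {φ : UnitAddCircle → ℝ} :
    φ ∈ logLipCone a ↔ C1Cone a (periodize φ) ∧ ∀ x, 0 < periodize φ x := by
  constructor
  · rintro ⟨h1, h2, h3⟩
    have h2' : ∀ x, 0 < periodize φ x := fun x => h2 _
    refine ⟨⟨h1, fun x => (h2 _).le, fun x => ?_⟩, h2'⟩
    have hlip : LipschitzWith (Real.toNNReal a) (fun x => Real.log (periodize φ x)) := by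
      have key : ∀ x y, Real.log (periodize φ x) - Real.log (periodize φ y) ≤ a * |x - y| := by
        intro x y
        rw [← Real.log_div (h2' x).ne' (h2' y).ne', ← Real.log_exp (a * |x - y|)]
        refine Real.log_le_log (div_pos (h2' x) (h2' y)) ((h3 _ _).trans ?_)
        exact Real.exp_le_exp.2 (mul_le_mul_of_nonneg_left (dist_coe_le x y) ha)
      refine LipschitzWith.of_dist_le_mul fun x y => ?_
      rw [Real.coe_toNNReal _ ha, Real.dist_eq, Real.dist_eq, abs_le]
      have := key x y
      have h5 := key y x
      rw [abs_sub_comm] at h5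
      constructor <;> linarith
    have h4 := norm_deriv_le_of_lipschitz (x₀ := x) hlip
    rw [((hasDerivAt_of_contDiff_one h1 x).log (h2' x).ne').deriv, Real.norm_eq_abs, abs_div,
      abs_of_pos (h2' x), Real.coe_toNNReal _ ha, div_le_iff₀ (h2' x)] at h4
    exact h4
  · rintro ⟨h1, h2⟩
    refine ⟨h1.contDiff, forall_periodize.2 h2, fun x y => ?_⟩
    obtain ⟨s, rfl⟩ := QuotientAddGroup.mk_surjective x
    obtain ⟨t, rfl⟩ := QuotientAddGroup.mk_surjective y
    -- Pick the representative of the second point for which the distance on the line equals that on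
    -- the circle.
    obtain ⟨n, hn⟩ := exists_dist_coe_eq s t
    have h3 := h1.le_exp_mul s (t + n)
    rw [show periodize φ (t + n) = periodize φ t by
      simpa using (periodize_periodic φ).int_mul n t] at h3
    have h4 : periodize φ s / periodize φ t ≤ Real.exp (a * |s - (t + n)|) := by
      rwa [div_le_iff₀ (h2 t)]
    rw [← hn] at h4
    exact h4

theorem mem_regCone_iff {a α : ℝ} (ha : 0 ≤ a) {φ : UnitAddCircle → ℝ} :
    φ ∈ regCone a α ↔ C2Cone a α (periodize φ) ∧ ∀ x, 0 < periodize φ x := by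
  rw [regCone, Set.mem_inter_iff, mem_logLipCone_iff ha]
  have e : iteratedDeriv 2 (periodize φ) = deriv (deriv (periodize φ)) := by
    rw [iteratedDeriv_succ, iteratedDeriv_one]
  constructor
  · rintro ⟨⟨h1, h2⟩, h3, -, h4⟩
    refine ⟨⟨h3, h1.nonneg, h1.deriv_le, fun x => ?_⟩, h2⟩
    have := h4 x
    rwa [e, abs_div, abs_of_pos (h2 x), div_le_iff₀ (h2 x)] at this
  · rintro ⟨h1, h2⟩
    refine ⟨⟨h1.c1, h2⟩, h1.contDiff, forall_periodize.2 h2, fun x => ?_⟩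
    rw [e, abs_div, abs_of_pos (h2 x), div_le_iff₀ (h2 x)]
    exact h1.deriv2_le x

/-! ### The Hilbert metric in terms of the functionals -/

section Hilbert

variable {a : ℝ} {φ ψ : UnitAddCircle → ℝ}

theorem periodize_smul_sub (c : ℝ) : periodize (c • ψ - φ) =
    fun x => c * periodize ψ x - periodize φ x := rfl

theorem periodize_sub_smul (c : ℝ) : periodize (φ - c • ψ) =
    fun x => periodize φ x - c * periodize ψ x := rfl

/-- At `β = M` the difference `β ψ - φ` may have zeros and so miss the cone of positive functions.
Every `β > M` is admissible because it adds a positive multiple of `ψ`, and the bound follows by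
density; similarly for `β < m`. -/
theorem ConeBounds.hilbertDist_le (ha : 0 < a) (hφ : φ ∈ logLipCone a) (hψ : ψ ∈ logLipCone a)
    {m M : ℝ} (hm : 0 < m) (hmM : m ≤ M) (h : ConeBounds a (periodize φ) (periodize ψ) m M) :
    hilbertDist (logLipCone a) φ ψ ≤ ((Real.log M - Real.log m : ℝ) : EReal) := by
  obtain ⟨cφ, pφ⟩ := (mem_logLipCone_iff ha.le).1 hφ
  obtain ⟨cψ, pψ⟩ := (mem_logLipCone_iff ha.le).1 hψ
  have hM : 0 < M := hm.trans_le hmM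
  have h1 : coneM (logLipCone a) φ ψ ≤ ENNReal.ofReal M := by
    refine le_of_forall_gt_imp_ge_of_dense fun c hc => ?_
    rcases eq_or_ne c ⊤ with rfl | hct
    · exact le_top
    have hc1 : M < c.toReal := (ENNReal.ofReal_lt_iff_lt_toReal hM.le hct).1 hc
    refine sInf_le ⟨c.toReal, hM.trans hc1, ?_, (ENNReal.ofReal_toReal hct).symm⟩
    rw [ConeLE, mem_logLipCone_iff ha.le, periodize_smul_sub]
    refine ⟨C1Cone.of_coneFun_nonneg ha ((contDiff_const.mul cψ.contDiff).sub cφ.contDiff)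
      fun i => ?_, fun x => ?_⟩
    · rw [coneFun_mul_sub cφ.contDiff cψ.contDiff]
      have := cψ.coneFun_nonneg i
      nlinarith [(h i).2]
    · have := h.upper ha x
      nlinarith [pψ x]
  have h2 : ENNReal.ofReal m ≤ conem (logLipCone a) φ ψ := by
    refine le_of_forall_lt_imp_le_of_dense fun c hc => ?_
    have hct : c ≠ ⊤ := ne_top_of_lt hc
    have hc1 : c.toReal < m := (ENNReal.lt_ofReal_iff_toReal_lt hct).1 hc
    rcases eq_or_ne c 0 with rfl | hc0
    · exact zero_le
    refine le_sSup ⟨c.toReal, ENNReal.toReal_pos hc0 hct, ?_, (ENNReal.ofReal_toReal hct).symm⟩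
    rw [ConeLE, mem_logLipCone_iff ha.le, periodize_sub_smul]
    refine ⟨C1Cone.of_coneFun_nonneg ha (cφ.contDiff.sub (contDiff_const.mul cψ.contDiff))
      fun i => ?_, fun x => ?_⟩
    · rw [coneFun_sub_mul cφ.contDiff cψ.contDiff]
      have := cψ.coneFun_nonneg i
      nlinarith [(h i).1]
    · have := h.lower ha x
      nlinarith [pψ x]
  rw [hilbertDist, ← Real.log_div hM.ne' hm.ne', ← ENNReal.log_ofReal_of_pos (div_pos hM hm),
    ENNReal.ofReal_div_of_pos hm]
  exact ENNReal.log_monotone (ENNReal.div_le_div h1 h2)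

/-- The inequalities between functionals are closed conditions, so they persist at the infimum and
supremum themselves; the distance is thus attained by actual bounds. -/
theorem exists_coneBounds_of_hilbertDist_ne_top (ha : 0 < a) (hφ : φ ∈ logLipCone a)
    (hψ : ψ ∈ logLipCone a) (hd : hilbertDist (logLipCone a) φ ψ ≠ ⊤) :
    ∃ m M : ℝ, 0 < m ∧ m ≤ M ∧ ConeBounds a (periodize φ) (periodize ψ) m M ∧
      hilbertDist (logLipCone a) φ ψ = ((Real.log M - Real.log m : ℝ) : EReal) := by
  obtain ⟨cφ, pφ⟩ := (mem_logLipCone_iff ha.le).1 hφ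
  obtain ⟨cψ, pψ⟩ := (mem_logLipCone_iff ha.le).1 hψ
  set M := coneM (logLipCone a) φ ψ with hMdef
  set m := conem (logLipCone a) φ ψ with hmdef
  -- The ratio at one point separates admissible lower constants from admissible upper ones. It
  -- gives `m ≤ M`, `M ≠ 0` and `m ≠ ∞`, so only an infinite distance could make the other two
  -- extremes occur.
  set ρ := periodize φ 0 / periodize ψ 0 with hρ
  have ρ0 : 0 < ρ := div_pos (pφ 0) (pψ 0)
  have hMρ : ENNReal.ofReal ρ ≤ M := by
    refine le_sInf ?_
    rintro _ ⟨β, hβ, h, rfl⟩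
    rw [ConeLE, mem_logLipCone_iff ha.le, periodize_smul_sub] at h
    refine ENNReal.ofReal_le_ofReal ?_
    rw [hρ, div_le_iff₀ (pψ 0)]
    linarith [h.2 0]
  have hmρ : m ≤ ENNReal.ofReal ρ := by
    refine sSup_le ?_
    rintro _ ⟨β, hβ, h, rfl⟩
    rw [ConeLE, mem_logLipCone_iff ha.le, periodize_sub_smul] at h
    refine ENNReal.ofReal_le_ofReal ?_
    rw [hρ, le_div_iff₀ (pψ 0)]
    linarith [h.2 0]
  have hmtop : m ≠ ⊤ := ne_top_of_le_ne_top ENNReal.ofReal_ne_top hmρ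
  have hM0 : M ≠ 0 := (lt_of_lt_of_le (ENNReal.ofReal_pos.2 ρ0) hMρ).ne'
  have hm0 : m ≠ 0 := by
    intro h0
    apply hd
    rw [hilbertDist, ← hmdef, ← hMdef, h0, ENNReal.div_zero hM0, ENNReal.log_top]
  have hMtop : M ≠ ⊤ := by
    intro h0
    apply hd
    rw [hilbertDist, ← hmdef, ← hMdef, h0, ENNReal.top_div_of_ne_top hmtop, ENNReal.log_top]
  have hm1 : 0 < m.toReal := ENNReal.toReal_pos hm0 hmtop
  have hM1 : 0 < M.toReal := ENNReal.toReal_pos hM0 hMtop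
  have hmM : m ≤ M := hmρ.trans hMρ
  refine ⟨m.toReal, M.toReal, hm1, (ENNReal.toReal_le_toReal hmtop hMtop).2 hmM,
    fun i => ⟨?_, ?_⟩, ?_⟩
  · rcases (cψ.coneFun_nonneg i).eq_or_lt with h0 | h0
    · rw [← h0, mul_zero]; exact cφ.coneFun_nonneg i
    · rw [← le_div_iff₀ h0]
      have hnn : 0 ≤ coneFun a (periodize φ) i / coneFun a (periodize ψ) i :=
        div_nonneg (cφ.coneFun_nonneg i) h0.le
      refine ENNReal.toReal_le_of_le_ofReal hnn (sSup_le ?_)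
      rintro _ ⟨β, hβ, h, rfl⟩
      refine ENNReal.ofReal_le_ofReal ?_
      rw [ConeLE, mem_logLipCone_iff ha.le, periodize_sub_smul] at h
      have := h.1.coneFun_nonneg i
      rw [coneFun_sub_mul cφ.contDiff cψ.contDiff] at this
      rw [le_div_iff₀ h0]; linarith
  · have hfeas : ∀ β : ℝ, 0 < β → ConeLE (logLipCone a) φ (β • ψ) →
        coneFun a (periodize φ) i ≤ β * coneFun a (periodize ψ) i := by
      intro β hβ h
      rw [ConeLE, mem_logLipCone_iff ha.le, periodize_smul_sub] at h
      have := h.1.coneFun_nonneg i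
      rw [coneFun_mul_sub cφ.contDiff cψ.contDiff] at this
      linarith
    rcases (cψ.coneFun_nonneg i).eq_or_lt with h0 | h0
    -- Where the functional of `ψ` vanishes there is nothing to divide by, but any single admissible
    -- `β` forces that of `φ` to be nonpositive.
    · have hne : ({b | ∃ β : ℝ, 0 < β ∧ ConeLE (logLipCone a) φ (β • ψ) ∧
          b = ENNReal.ofReal β} : Set ℝ≥0∞).Nonempty := by
        rw [Set.nonempty_iff_ne_empty]
        intro he
        apply hMtop
        rw [hMdef, coneM, he, sInf_empty]
      obtain ⟨_, β, hβ, h, rfl⟩ := hne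
      have := hfeas β hβ h
      rw [← h0, mul_zero] at this ⊢
      exact this
    · rw [← div_le_iff₀ h0]
      refine (ENNReal.ofReal_le_iff_le_toReal hMtop).1 (le_sInf ?_)
      rintro _ ⟨β, hβ, h, rfl⟩
      refine ENNReal.ofReal_le_ofReal ?_
      rw [div_le_iff₀ h0]
      exact hfeas β hβ h
  · rw [← Real.log_div hM1.ne' hm1.ne', ← ENNReal.log_ofReal_of_pos (div_pos hM1 hm1),
      ENNReal.ofReal_div_of_pos hm1, ENNReal.ofReal_toReal hMtop, ENNReal.ofReal_toReal hmtop]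
    rfl

theorem hilbertDist_nonneg (ha : 0 < a) (hφ : φ ∈ logLipCone a) (hψ : ψ ∈ logLipCone a) :
    0 ≤ hilbertDist (logLipCone a) φ ψ := by
  by_cases hd : hilbertDist (logLipCone a) φ ψ = ⊤
  · rw [hd]; exact le_top
  · obtain ⟨m, M, hm, hmM, -, he⟩ := exists_coneBounds_of_hilbertDist_ne_top ha hφ hψ hd
    rw [he]
    exact_mod_cast sub_nonneg.2 (Real.log_le_log hm hmM)

end Hilbert

/-! ### Increasing diffeomorphisms of the line -/

theorem exists_homeomorph_of_le_deriv {n : ℕ∞} (hn : 1 ≤ n) {G : ℝ → ℝ} (hG : ContDiff ℝ n G)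
    {c : ℝ} (hc : 0 < c) (h : ∀ x, c ≤ deriv G x) :
    ∃ e : ℝ ≃ₜ ℝ, (∀ x, e x = G x) ∧ ContDiff ℝ n e.symm ∧
      ∀ x, HasDerivAt e.symm (deriv G (e.symm x))⁻¹ x := by
  have hn1 : (1 : WithTop ℕ∞) ≤ n := by exact_mod_cast hn
  have hG1 : ContDiff ℝ 1 G := hG.of_le hn1
  have hmono : StrictMono G := strictMono_of_deriv_pos fun x => hc.trans_le (h x)
  have hlin : Monotone (fun x => G x - c * x) := by
    have hd : ∀ x, HasDerivAt (fun x => G x - c * x) (deriv G x - c) x := fun x => by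
      simpa using (hasDerivAt_of_contDiff_one hG1 x).fun_sub ((hasDerivAt_id x).const_mul c)
    refine monotone_of_deriv_nonneg (fun x => (hd x).differentiableAt) fun x => ?_
    rw [(hd x).deriv]; linarith [h x]
  have htop : Tendsto G atTop atTop := by
    refine tendsto_atTop_mono' atTop ?_
      (tendsto_atTop_add_const_right atTop (G 0) (tendsto_id.const_mul_atTop hc))
    filter_upwards [eventually_ge_atTop 0] with x hx
    have := hlin hx
    simp only [mul_zero, sub_zero] at this
    simp only [id]; linarith
  have hbot : Tendsto G atBot atBot := by
    refine tendsto_atBot_mono' atBot ?_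
      (tendsto_atBot_add_const_right atBot (G 0) (tendsto_id.const_mul_atBot hc))
    filter_upwards [eventually_le_atBot 0] with x hx
    have := hlin hx
    simp only [mul_zero, sub_zero] at this
    simp only [id]; linarith
  have hsurj : Function.Surjective G := hG1.continuous.surjective htop hbot
  let e : ℝ ≃ₜ ℝ := (hmono.orderIsoOfSurjective G hsurj).toHomeomorph
  have he : ∀ x, e x = G x := fun x => rfl
  have hd : ∀ x, HasDerivAt e (deriv G x) x := fun x => hasDerivAt_of_contDiff_one hG1 x
  refine ⟨e, he, e.contDiff_symm_deriv (fun x => (hc.trans_le (h x)).ne') hd hG, fun x => ?_⟩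
  exact HasDerivAt.of_local_left_inverse e.symm.continuous.continuousAt (hd _)
    (hc.trans_le (h _)).ne' (Eventually.of_forall fun y => e.apply_symm_apply y)

/-! ### The transfer operator of a perturbation of the identity -/

/-- `h j` is the `j`-th derivative of the `1`-periodic `C^3` function `h 0`, and all of them are
bounded by `B`. -/
structure FieldBound (B : ℝ) (h : ℕ → ℝ → ℝ) : Prop where
  hd : ∀ j < 3, ∀ x, HasDerivAt (h j) (h (j + 1) x) x
  cont : Continuous (h 3)
  bound : ∀ j ≤ 3, ∀ x, |h j x| ≤ B
  per : ∀ j ≤ 3, Function.Periodic (h j) 1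

/-- The inverse of `x ↦ x + δ h(x)`. -/
noncomputable def dispInv (δ : ℝ) (h : ℕ → ℝ → ℝ) : ℝ → ℝ :=
  Function.invFun fun x => x + δ * h 0 x

/-- The derivative of `dispInv δ h`. -/
noncomputable def dispWeight (δ : ℝ) (h : ℕ → ℝ → ℝ) (x : ℝ) : ℝ :=
  (1 + δ * h 1 (dispInv δ h x))⁻¹

/-- The transfer operator of `x ↦ x + δ h(x)`. -/
noncomputable def dispOp (δ : ℝ) (h : ℕ → ℝ → ℝ) (u : ℝ → ℝ) (x : ℝ) : ℝ :=
  dispWeight δ h x * u (dispInv δ h x)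

namespace FieldBound

variable {B δ e : ℝ} {h : ℕ → ℝ → ℝ}

theorem contDiff_two (H : FieldBound B h) : ContDiff ℝ 2 (h 1) := by
  have e1 : deriv (h 1) = h 2 := funext fun x => (H.hd 1 (by norm_num) x).deriv
  have e2 : deriv (h 2) = h 3 := funext fun x => (H.hd 2 (by norm_num) x).deriv
  have c2 : ContDiff ℝ 1 (h 2) := by
    rw [contDiff_one_iff_deriv, e2]
    exact ⟨fun x => (H.hd 2 (by norm_num) x).differentiableAt, H.cont⟩
  refine (contDiff_succ_iff_deriv (n := 1)).2
    ⟨fun x => (H.hd 1 (by norm_num) x).differentiableAt, by simp, ?_⟩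
  rw [e1]; exact c2

theorem contDiff_three (H : FieldBound B h) : ContDiff ℝ 3 (h 0) := by
  have e0 : deriv (h 0) = h 1 := funext fun x => (H.hd 0 (by norm_num) x).deriv
  refine (contDiff_succ_iff_deriv (n := 2)).2
    ⟨fun x => (H.hd 0 (by norm_num) x).differentiableAt, by simp, ?_⟩
  rw [e0]; exact H.contDiff_two

theorem abs_mul_le (H : FieldBound B h) (he : |δ| * B ≤ e) {j : ℕ} (hj : j ≤ 3) (x : ℝ) :
    |δ * h j x| ≤ e := by
  rw [abs_mul]
  exact (mul_le_mul_of_nonneg_left (H.bound j hj x) (abs_nonneg _)).trans he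

theorem hasDerivAt_disp (H : FieldBound B h) (x : ℝ) :
    HasDerivAt (fun x => x + δ * h 0 x) (1 + δ * h 1 x) x :=
  (hasDerivAt_id x).add ((H.hd 0 (by norm_num) x).const_mul δ)

/-- `dispInv` is a total choice of inverse, meaningful for no particular `δ` a priori. Here it is
identified with the inverse of a diffeomorphism, whose derivative is at least `1 - e`. -/
theorem exists_homeomorph (H : FieldBound B h) (he : |δ| * B ≤ e) (he1 : e < 1) :
    ∃ g : ℝ ≃ₜ ℝ, (∀ x, g x = x + δ * h 0 x) ∧ (∀ x, g.symm x = dispInv δ h x) ∧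
      ContDiff ℝ 3 (dispInv δ h) ∧ ∀ x, HasDerivAt (dispInv δ h) (dispWeight δ h x) x := by
  obtain ⟨g, hg, hs, hd⟩ := exists_homeomorph_of_le_deriv (n := 3) (by norm_num)
    (G := fun x => x + δ * h 0 x) (contDiff_id.add (contDiff_const.mul H.contDiff_three))
    (c := 1 - e) (by linarith) fun x => by
      rw [(H.hasDerivAt_disp x).deriv]
      linarith [(abs_le.1 (H.abs_mul_le he (j := 1) (by norm_num) x)).1]
  have hinv : ∀ x, g.symm x = dispInv δ h x := by
    intro x
    have hinj : Function.Injective fun x => x + δ * h 0 x := fun p q hpq => by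
      apply g.injective; rw [hg, hg]; exact hpq
    have := Function.leftInverse_invFun hinj (g.symm x)
    rw [← this]
    simp only [dispInv]
    rw [← hg, g.apply_symm_apply]
  have hfun : (g.symm : ℝ → ℝ) = dispInv δ h := funext hinv
  refine ⟨g, hg, hinv, hfun ▸ hs, fun x => ?_⟩
  have := hd x
  rw [hfun, (H.hasDerivAt_disp _).deriv] at this
  exact this

theorem disp_dispInv (H : FieldBound B h) (he : |δ| * B ≤ e) (he1 : e < 1) (x : ℝ) :
    dispInv δ h x + δ * h 0 (dispInv δ h x) = x := by
  obtain ⟨g, hg, hs, -⟩ := H.exists_homeomorph he he1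
  rw [← hg, ← hs, g.apply_symm_apply]

theorem dispInv_add_one (H : FieldBound B h) (he : |δ| * B ≤ e) (he1 : e < 1) (x : ℝ) :
    dispInv δ h (x + 1) = dispInv δ h x + 1 := by
  have hx := H.disp_dispInv he he1 x
  obtain ⟨g, hg, hs, -⟩ := H.exists_homeomorph he he1
  rw [← hs (x + 1), Homeomorph.symm_apply_eq, hg, H.per 0 (by norm_num)]
  linarith

theorem dispWeight_periodic (H : FieldBound B h) (he : |δ| * B ≤ e) (he1 : e < 1) :
    Function.Periodic (dispWeight δ h) 1 := fun x => by
  rw [dispWeight, dispWeight, H.dispInv_add_one he he1, H.per 1 (by norm_num)]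

theorem dispOp_periodic (H : FieldBound B h) (he : |δ| * B ≤ e) (he1 : e < 1) {u : ℝ → ℝ}
    (hu : Function.Periodic u 1) : Function.Periodic (dispOp δ h u) 1 := fun x => by
  rw [dispOp, dispOp, H.dispWeight_periodic he he1, H.dispInv_add_one he he1, hu]

theorem dispWeight_pos (H : FieldBound B h) (he : |δ| * B ≤ e) (he1 : e < 1) (x : ℝ) :
    0 < dispWeight δ h x := by
  have := (abs_le.1 (H.abs_mul_le he (j := 1) (by norm_num) (dispInv δ h x))).1
  exact inv_pos.2 (by linarith)

theorem dispWeight_le (H : FieldBound B h) (he : |δ| * B ≤ e) (he1 : e < 1) (x : ℝ) :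
    dispWeight δ h x ≤ 1 / (1 - e) := by
  have := (abs_le.1 (H.abs_mul_le he (j := 1) (by norm_num) (dispInv δ h x))).1
  rw [dispWeight, ← one_div]
  exact one_div_le_one_div_of_le (by linarith) (by linarith)

theorem half_le_dispWeight (H : FieldBound B h) (he : |δ| * B ≤ e) (he1 : e < 1) (x : ℝ) :
    1 / 2 ≤ dispWeight δ h x := by
  have := abs_le.1 (H.abs_mul_le he (j := 1) (by norm_num) (dispInv δ h x))
  rw [dispWeight, ← one_div]
  exact one_div_le_one_div_of_le (by linarith) (by linarith)

theorem dispWeight_le_two (H : FieldBound B h) (he : |δ| * B ≤ e) (he1 : e ≤ 1 / 2) (x : ℝ) :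
    dispWeight δ h x ≤ 2 :=
  (H.dispWeight_le he (by linarith) x).trans
    (by rw [div_le_iff₀ (by linarith)]; linarith)

theorem hasDerivAt_dispWeight (H : FieldBound B h) (he : |δ| * B ≤ e) (he1 : e < 1) (x : ℝ) :
    HasDerivAt (dispWeight δ h) (-(δ * h 2 (dispInv δ h x)) * dispWeight δ h x ^ 3) x := by
  obtain ⟨g, hg, hs, -, hd⟩ := H.exists_homeomorph he he1
  have h1 : HasDerivAt (fun x => 1 + δ * h 1 (dispInv δ h x))
      (δ * (h 2 (dispInv δ h x) * dispWeight δ h x)) x :=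
    (((H.hd 1 (by norm_num) _).comp x (hd x)).const_mul δ).const_add 1
  have hpos := H.dispWeight_pos he he1 x
  have hne : 1 + δ * h 1 (dispInv δ h x) ≠ 0 := (inv_pos.1 hpos).ne'
  have h2 : HasDerivAt (dispWeight δ h) _ x := h1.fun_inv hne
  refine h2.congr_deriv ?_
  rw [show dispWeight δ h x = (1 + δ * h 1 (dispInv δ h x))⁻¹ from rfl]
  field_simp

/-- For `e ≤ 1 / 2` the weight is at most `2`. From `w' = -δ h₂ w³` one gets `|w'| ≤ 2 w ≤ 4`, and
`|w''| / w ≤ (1/2)·8 + 3·(1/4)·16 = 16`; the constant `16` covers all of these. -/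
theorem branch (H : FieldBound B h) (he : |δ| * B ≤ e) (he1 : e ≤ 1 / 2) :
    Branch (dispWeight δ h) (dispInv δ h) (1 / (1 - e)) 16 := by
  have he1' : e < 1 := by linarith
  obtain ⟨g, hg, hs, hc, hd⟩ := H.exists_homeomorph he he1'
  have dk : deriv (dispInv δ h) = dispWeight δ h := funext fun x => (hd x).deriv
  have dw : deriv (dispWeight δ h) =
      fun x => -(δ * h 2 (dispInv δ h x)) * dispWeight δ h x ^ 3 :=
    funext fun x => (H.hasDerivAt_dispWeight he he1' x).deriv
  have hpos := H.dispWeight_pos he he1'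
  have hle := H.dispWeight_le_two he he1
  have dwb : ∀ x, |deriv (dispWeight δ h) x| ≤ 2 * dispWeight δ h x := by
    intro x
    have w0 := hpos x
    have w2 := hle x
    rw [dw, abs_mul, abs_neg, abs_of_pos (pow_pos w0 3)]
    have h1 := H.abs_mul_le he (j := 2) (by norm_num) (dispInv δ h x)
    have h3 : dispWeight δ h x ^ 3 ≤ 4 * dispWeight δ h x := by
      nlinarith [mul_nonneg w0.le (mul_nonneg (sub_nonneg.2 w2) (by linarith :
        0 ≤ 2 + dispWeight δ h x))]
    calc _ ≤ 1 / 2 * (4 * dispWeight δ h x) :=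
          mul_le_mul (h1.trans he1) h3 (by positivity) (by norm_num)
      _ = _ := by ring
  refine ⟨?_, hc.of_le (by norm_num), hpos, fun x => ?_, fun x => ?_, fun x => ?_, fun x => ?_⟩
  · have : ContDiff ℝ 2 (dispInv δ h) := hc.of_le (by norm_num)
    exact ContDiff.inv (contDiff_const.add (contDiff_const.mul (H.contDiff_two.comp this)))
      fun x => (inv_pos.1 (hpos x)).ne'
  · rw [dk, abs_of_pos (hpos x)]; exact H.dispWeight_le he he1' x
  · rw [dk]; linarith [dwb x, hle x]
  · linarith [dwb x, hpos x]
  · have h3 : HasDerivAt (fun x => -(δ * h 2 (dispInv δ h x)) * dispWeight δ h x ^ 3)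
        (-(δ * (h 3 (dispInv δ h x) * dispWeight δ h x)) * dispWeight δ h x ^ 3 +
          -(δ * h 2 (dispInv δ h x)) * (3 * dispWeight δ h x ^ 2 *
            (-(δ * h 2 (dispInv δ h x)) * dispWeight δ h x ^ 3))) x := by
      have p1 := (((H.hd 2 (by norm_num) _).comp x (hd x)).const_mul δ).fun_neg
      have p2 := (H.hasDerivAt_dispWeight he he1' x).fun_pow 3
      have p3 := p1.fun_mul p2
      simpa using p3
    rw [dw, h3.deriv]
    have w0 := hpos x
    have w2 := hle x
    have b2 := (H.abs_mul_le he (j := 2) (by norm_num) (dispInv δ h x)).trans he1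
    have b3 := (H.abs_mul_le he (j := 3) (by norm_num) (dispInv δ h x)).trans he1
    set w := dispWeight δ h x
    set p := δ * h 2 (dispInv δ h x)
    have e1 : -(δ * (h 3 (dispInv δ h x) * w)) * w ^ 3 + -p * (3 * w ^ 2 * (-p * w ^ 3)) =
        w * (-(δ * h 3 (dispInv δ h x)) * w ^ 3 + 3 * p ^ 2 * w ^ 4) := by ring
    have w3 : w ^ 3 ≤ 8 := by
      have := pow_le_pow_left₀ w0.le w2 3; norm_num at this; exact this
    have w4 : w ^ 4 ≤ 16 := by
      have := pow_le_pow_left₀ w0.le w2 4; norm_num at this; exact this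
    rw [e1, abs_mul, abs_of_pos w0, mul_comm]
    refine mul_le_mul_of_nonneg_right ((abs_add_le _ _).trans ?_) w0.le
    have q1 : |-(δ * h 3 (dispInv δ h x)) * w ^ 3| ≤ 1 / 2 * 8 := by
      rw [abs_mul, abs_neg, abs_of_pos (pow_pos w0 3)]
      exact mul_le_mul b3 w3 (by positivity) (by norm_num)
    have p2 : p ^ 2 ≤ 1 / 4 := by
      rw [← sq_abs]; nlinarith [abs_nonneg p]
    have q2 : |3 * p ^ 2 * w ^ 4| ≤ 3 * (1 / 4) * 16 := by
      rw [abs_of_nonneg (by positivity)]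
      exact mul_le_mul (by linarith) w4 (by positivity) (by norm_num)
    linarith

theorem c2Cone (H : FieldBound B h) (he : |δ| * B ≤ e) (he1 : e ≤ 1 / 2)
    {a α : ℝ} {u : ℝ → ℝ} (hu : C2Cone a α u) :
    C2Cone (16 + 1 / (1 - e) * a)
      (16 + (2 * 16 * (1 / (1 - e)) + 16) * a + (1 / (1 - e)) ^ 2 * α) (dispOp δ h u) :=
  (H.branch he he1).c2Cone hu

theorem c1Cone (H : FieldBound B h) (he : |δ| * B ≤ e) (he1 : e ≤ 1 / 2)
    {a : ℝ} {u : ℝ → ℝ} (hu : C1Cone a u) : C1Cone (16 + 1 / (1 - e) * a) (dispOp δ h u) :=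
  (H.branch he he1).c1Cone hu

/-- Lipschitz dependence of the inverse and of its first two derivatives on the field. -/
theorem abs_dispInv_sub_le {h' : ℕ → ℝ → ℝ} (H : FieldBound B h) (H' : FieldBound B h')
    (he : |δ| * B ≤ 1 / 2) {τ : ℝ} (hτ : ∀ j ≤ 2, ∀ x, |h j x - h' j x| ≤ τ) (x : ℝ) :
    |dispInv δ h x - dispInv δ h' x| ≤ 2 * (|δ| * τ) ∧
    |dispWeight δ h x - dispWeight δ h' x| ≤ 8 * (|δ| * τ) ∧
    |deriv (dispWeight δ h) x - deriv (dispWeight δ h') x| ≤ 64 * (|δ| * τ) := by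
  have hlt : (1 / 2 : ℝ) < 1 := by norm_num
  set k := dispInv δ h x with hk
  set k' := dispInv δ h' x with hk'
  have lip : ∀ j ≤ 2, |δ * h j k - δ * h' j k'| ≤ |δ| * τ + 1 / 2 * |k - k'| := by
    intro j hj
    have hj3 : j < 3 := by omega
    have h1 : |h j k - h j k'| ≤ B * |k - k'| := by
      have := (convex_univ (𝕜 := ℝ) (E := ℝ)).norm_image_sub_le_of_norm_hasDerivWithin_le
        (f := h j) (f' := h (j + 1)) (C := B)
        (fun z _ => (H.hd j hj3 z).hasDerivWithinAt)
        (fun z _ => H.bound (j + 1) (by omega) z) (Set.mem_univ k') (Set.mem_univ k)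
      simpa [Real.norm_eq_abs] using this
    have h2 : δ * h j k - δ * h' j k' = δ * (h j k - h j k') + δ * (h j k' - h' j k') := by ring
    rw [h2]
    refine (abs_add_le _ _).trans ?_
    rw [abs_mul, abs_mul]
    have h3 := mul_le_mul_of_nonneg_left h1 (abs_nonneg δ)
    have h4 := mul_le_mul_of_nonneg_left (hτ j hj k') (abs_nonneg δ)
    have h5 := mul_le_mul_of_nonneg_right he (abs_nonneg (k - k'))
    nlinarith
  -- The difference of the two defining equations bounds `|k - k'|` by `|δ| τ` plus half of itself,
  -- which is absorbed on the left.
  have hk1 : |k - k'| ≤ 2 * (|δ| * τ) := by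
    have h1 := H.disp_dispInv he hlt x
    have h2 := H'.disp_dispInv he hlt x
    have h3 : k - k' = -(δ * h 0 k - δ * h' 0 k') := by linarith
    have h4 := lip 0 (by norm_num)
    have h5 : |k - k'| = |δ * h 0 k - δ * h' 0 k'| := by
      conv_lhs => rw [h3]
      exact abs_neg _
    linarith
  have lip' : ∀ j ≤ 2, |δ * h j k - δ * h' j k'| ≤ 2 * (|δ| * τ) := fun j hj => by
    linarith [lip j hj]
  have Δ0 : 0 ≤ |δ| * τ :=
    mul_nonneg (abs_nonneg _) ((abs_nonneg _).trans (hτ 0 (by norm_num) 0))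
  have w0 := H.dispWeight_pos he hlt x
  have w0' := H'.dispWeight_pos he hlt x
  have w2 := H.dispWeight_le_two he le_rfl x
  have w2' := H'.dispWeight_le_two he le_rfl x
  have hw : |dispWeight δ h x - dispWeight δ h' x| ≤ 8 * (|δ| * τ) := by
    have e1 : dispWeight δ h x - dispWeight δ h' x =
        dispWeight δ h x * dispWeight δ h' x * -(δ * h 1 k - δ * h' 1 k') := by
      have n1 := (inv_pos.1 w0).ne'
      have n2 := (inv_pos.1 w0').ne'
      simp only [dispWeight, ← hk, ← hk'] at n1 n2 ⊢
      field_simp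
      ring
    rw [e1, abs_mul, abs_neg, abs_of_pos (mul_pos w0 w0')]
    calc _ ≤ (2 * 2) * (2 * (|δ| * τ)) :=
          mul_le_mul (mul_le_mul w2 w2' w0'.le (by norm_num)) (lip' 1 (by norm_num))
            (abs_nonneg _) (by norm_num)
      _ = _ := by ring
  refine ⟨hk1, hw, ?_⟩
  rw [(H.hasDerivAt_dispWeight he hlt x).deriv, (H'.hasDerivAt_dispWeight he hlt x).deriv,
    ← hk, ← hk']
  set w := dispWeight δ h x
  set w' := dispWeight δ h' x
  have e2 : -(δ * h 2 k) * w ^ 3 - -(δ * h' 2 k') * w' ^ 3 =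
      -((δ * h 2 k - δ * h' 2 k') * w ^ 3 + δ * h' 2 k' * ((w - w') * (w ^ 2 + w * w' + w' ^ 2))) := by
    ring
  rw [e2, abs_neg]
  refine (abs_add_le _ _).trans ?_
  have q1 : |(δ * h 2 k - δ * h' 2 k') * w ^ 3| ≤ 2 * (|δ| * τ) * 8 := by
    rw [abs_mul, abs_of_pos (pow_pos w0 3)]
    refine mul_le_mul (lip' 2 le_rfl) ?_ (by positivity) (by positivity)
    have := pow_le_pow_left₀ w0.le w2 3
    norm_num at this; exact this
  have q2 : |δ * h' 2 k' * ((w - w') * (w ^ 2 + w * w' + w' ^ 2))| ≤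
      1 / 2 * (8 * (|δ| * τ) * 12) := by
    rw [abs_mul, abs_mul (w - w'), abs_of_pos (show 0 < w ^ 2 + w * w' + w' ^ 2 by positivity)]
    refine mul_le_mul (H'.abs_mul_le he (by norm_num) _)
      (mul_le_mul hw ?_ (by positivity) (by positivity)) (by positivity) (by norm_num)
    nlinarith
  linarith

/-- Dependence of the transfer operator on the field, in `C^1` and relative to its value. -/
theorem abs_dispOp_sub_le {h' : ℕ → ℝ → ℝ} (H : FieldBound B h) (H' : FieldBound B h')
    (he : |δ| * B ≤ 1 / 2) {τ : ℝ} (hτ : ∀ j ≤ 2, ∀ x, |h j x - h' j x| ≤ τ) {a α : ℝ}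
    (ha : 0 ≤ a) (hα : 0 ≤ α) {u : ℝ → ℝ} (hu : C2Cone a α u) (hp : Function.Periodic u 1)
    (x : ℝ) :
    |dispOp δ h u x - dispOp δ h' u x| ≤
      2 * Real.exp a * (64 + 40 * a + 8 * α) * (|δ| * τ) * dispOp δ h' u x ∧
    |deriv (dispOp δ h u) x - deriv (dispOp δ h' u) x| ≤
      2 * Real.exp a * (64 + 40 * a + 8 * α) * (|δ| * τ) * dispOp δ h' u x := by
  have hlt : (1 / 2 : ℝ) < 1 := by norm_num
  obtain ⟨hk, hw, hdw⟩ := H.abs_dispInv_sub_le H' he hτ x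
  have br := H.branch he le_rfl
  have br' := H'.branch he le_rfl
  have d1 := (br.hasDerivAt hu.c1.contDiff x).deriv
  have d2 := (br'.hasDerivAt hu.c1.contDiff x).deriv
  obtain ⟨-, -, -, -, dk⟩ := H.exists_homeomorph he hlt
  obtain ⟨-, -, -, -, dk'⟩ := H'.exists_homeomorph he hlt
  rw [(dk x).deriv] at d1
  rw [(dk' x).deriv] at d2
  have w0 := H.dispWeight_pos he hlt x
  have w0' := H'.dispWeight_pos he hlt x
  have w2 := H.dispWeight_le_two he le_rfl x
  have w2' := H'.dispWeight_le_two he le_rfl x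
  have whalf := H'.half_le_dispWeight he hlt x
  have hdw' : |deriv (dispWeight δ h') x| ≤ 4 := by
    rw [(H'.hasDerivAt_dispWeight he hlt x).deriv, abs_mul, abs_neg, abs_of_pos (pow_pos w0' 3)]
    have h8 : dispWeight δ h' x ^ 3 ≤ 8 := by
      have := pow_le_pow_left₀ w0'.le w2' 3; norm_num at this; exact this
    have := mul_le_mul (H'.abs_mul_le he (j := 2) (by norm_num) (dispInv δ h' x)) h8
      (by positivity) (by norm_num)
    linarith
  have Δ0 : 0 ≤ |δ| * τ :=
    mul_nonneg (abs_nonneg _) ((abs_nonneg _).trans (hτ 0 (by norm_num) 0))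
  change deriv (dispOp δ h u) x = _ at d1
  change deriv (dispOp δ h' u) x = _ at d2
  rw [d1, d2]
  simp only [dispOp]
  set w := dispWeight δ h x
  set w' := dispWeight δ h' x
  set k := dispInv δ h x
  set k' := dispInv δ h' x
  set dw := deriv (dispWeight δ h) x
  set dw' := deriv (dispWeight δ h') x
  set D := |δ| * τ
  -- A global bound for `u` expressed through its value at `k'`, the point occurring in the
  -- reference operator; it makes the final error relative to the output.
  set U := Real.exp a * u k' with hU
  have hEz : ∀ z, u z ≤ U := fun z => hu.c1.le_exp_mul_of_periodic ha hp z k'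
  have U0 : 0 ≤ U := (hu.nonneg 0).trans (hEz 0)
  have u0 : |u k| ≤ U := by rw [abs_of_nonneg (hu.nonneg k)]; exact hEz k
  have u1 : |deriv u k| ≤ a * U :=
    (hu.deriv_le k).trans (mul_le_mul_of_nonneg_left (hEz k) ha)
  have du0 : |u k - u k'| ≤ a * U * (2 * D) := by
    have := (convex_univ (𝕜 := ℝ) (E := ℝ)).norm_image_sub_le_of_norm_hasDerivWithin_le
      (f := u) (f' := deriv u) (C := a * U)
      (fun z _ => (hasDerivAt_of_contDiff_two hu.contDiff z).hasDerivWithinAt)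
      (fun z _ => (hu.deriv_le z).trans (mul_le_mul_of_nonneg_left (hEz z) ha))
      (Set.mem_univ k') (Set.mem_univ k)
    exact this.trans (mul_le_mul_of_nonneg_left hk (by positivity))
  -- The bound on the second derivative of `u` is indispensable here: `u'` is evaluated at two
  -- different points.
  have du1 : |deriv u k - deriv u k'| ≤ α * U * (2 * D) := by
    have := (convex_univ (𝕜 := ℝ) (E := ℝ)).norm_image_sub_le_of_norm_hasDerivWithin_le
      (f := deriv u) (f' := deriv (deriv u)) (C := α * U)
      (fun z _ => (hasDerivAt_deriv_of_contDiff_two hu.contDiff z).hasDerivWithinAt)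
      (fun z _ => (hu.deriv2_le z).trans (mul_le_mul_of_nonneg_left (hEz z) hα))
      (Set.mem_univ k') (Set.mem_univ k)
    exact this.trans (mul_le_mul_of_nonneg_left hk (by positivity))
  -- The weight `w'` is at least `1 / 2`, so `U` costs only the factor `2 exp a`. In the derivative
  -- estimate the four telescoped terms contribute `64`, `8 a`, `32 a` and `8 α`.
  have hfin : (64 + 40 * a + 8 * α) * D * U ≤
      2 * Real.exp a * (64 + 40 * a + 8 * α) * D * (w' * u k') := by
    have h1 : 0 ≤ (64 + 40 * a + 8 * α) * D * U := by positivity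
    have h2 : 2 * Real.exp a * (64 + 40 * a + 8 * α) * D * (w' * u k') =
      (2 * w') * ((64 + 40 * a + 8 * α) * D * U) := by rw [hU]; ring
    rw [h2]
    nlinarith
  have bound : ∀ {p q P Q : ℝ}, |p| ≤ P → |q| ≤ Q → |p * q| ≤ P * Q := fun hp hq => by
    rw [abs_mul]; exact mul_le_mul hp hq (abs_nonneg _) ((abs_nonneg _).trans hp)
  have aw' : |w'| ≤ 2 := by rw [abs_of_pos w0']; exact w2'
  have aU : 0 ≤ a * U := by positivity
  have αU : 0 ≤ α * U := by positivity
  have UD : 0 ≤ U * D := by positivity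
  have aUD : 0 ≤ a * U * D := by positivity
  have αUD : 0 ≤ α * U * D := by positivity
  constructor
  · refine le_trans ?_ hfin
    have e1 : w * u k - w' * u k' = (w - w') * u k + w' * (u k - u k') := by ring
    rw [e1]
    refine (abs_add_le _ _).trans ((add_le_add (bound hw u0) (bound aw' du0)).trans ?_)
    nlinarith
  · refine le_trans ?_ hfin
    have e1 : dw * u k + w * (deriv u k * w) - (dw' * u k' + w' * (deriv u k' * w')) =
        (dw - dw') * u k + dw' * (u k - u k') + (w - w') * (w + w') * deriv u k
          + w' * w' * (deriv u k - deriv u k') := by ring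
    have aw : |w + w'| ≤ 4 := by rw [abs_of_pos (by positivity)]; linarith
    rw [e1]
    refine (abs_add_le _ _).trans ((add_le_add ((abs_add_le _ _).trans (add_le_add
      ((abs_add_le _ _).trans (add_le_add (bound hdw u0) (bound hdw' du0)))
        (bound (bound hw aw) u1))) (bound (bound aw' aw') du1)).trans ?_)
    nlinarith

end FieldBound

/-! ### Push-forward of densities on the circle -/

theorem continuous_of_periodize {X : Type*} [TopologicalSpace X] {φ : UnitAddCircle → X}
    (h : Continuous fun x : ℝ => φ (x : UnitAddCircle)) : Continuous φ :=
  (QuotientAddGroup.isQuotientMap_mk (AddSubgroup.zmultiples (1 : ℝ))).continuous_iff.2 h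

theorem continuous_periodize {φ : UnitAddCircle → ℝ} (h : Continuous φ) :
    Continuous (periodize φ) :=
  h.comp (AddCircle.continuous_mk' 1)

theorem exists_periodize_eq {u : ℝ → ℝ} (hp : Function.Periodic u 1) :
    ∃ χ : UnitAddCircle → ℝ, periodize χ = u :=
  ⟨hp.lift, funext fun x => hp.lift_coe x⟩

theorem continuous_of_continuous_lift {T : UnitAddCircle → UnitAddCircle} {G : ℝ → ℝ}
    (hG : Continuous G) (hT : ∀ x : ℝ, T x = (G x : UnitAddCircle)) : Continuous T :=
  continuous_of_periodize (by simp only [hT]; exact (AddCircle.continuous_mk' 1).comp hG)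

theorem integral_densityMeasure {φ : UnitAddCircle → ℝ} (hc : Continuous φ) (h0 : ∀ x, 0 ≤ φ x)
    (g : UnitAddCircle → ℝ) : ∫ x, g x ∂(densityMeasure φ) = ∫ x, φ x * g x := by
  have hm : Measurable fun x => ENNReal.ofReal (φ x) :=
    ENNReal.measurable_ofReal.comp hc.measurable
  rw [densityMeasure, integral_withDensity_eq_integral_toReal_smul hm (by simp)]
  refine integral_congr_ae (Eventually.of_forall fun x => ?_)
  simp [ENNReal.toReal_ofReal (h0 x)]

theorem isFiniteMeasure_densityMeasure {φ : UnitAddCircle → ℝ} (hc : Continuous φ) :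
    IsFiniteMeasure (densityMeasure φ) := by
  obtain ⟨C, hC⟩ := isCompact_univ.exists_bound_of_continuousOn hc.continuousOn
  refine isFiniteMeasure_withDensity (ne_top_of_le_ne_top (b := ENNReal.ofReal C *
    (volume : Measure UnitAddCircle) Set.univ) ?_ ?_)
  · exact ENNReal.mul_ne_top ENNReal.ofReal_ne_top (measure_ne_top _ _)
  · calc _ ≤ ∫⁻ _ : UnitAddCircle, ENNReal.ofReal C := lintegral_mono fun x =>
          ENNReal.ofReal_le_ofReal ((le_abs_self _).trans (hC x (Set.mem_univ _)))
      _ = _ := lintegral_const _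

theorem isContDensity_map {T : UnitAddCircle → UnitAddCircle} (hT : Continuous T)
    {φ χ : UnitAddCircle → ℝ} (hφ : Continuous φ) (hφ0 : ∀ x, 0 ≤ φ x) (hχ : Continuous χ)
    (hχ0 : ∀ x, 0 ≤ χ x)
    (h : ∀ g : UnitAddCircle → ℝ, Continuous g → ∫ x, φ x * g (T x) = ∫ x, χ x * g x) :
    IsContDensity ((densityMeasure φ).map T) χ := by
  refine ⟨hχ, hχ0, ?_⟩
  have := isFiniteMeasure_densityMeasure hφ
  have := isFiniteMeasure_densityMeasure hχ
  refine ext_of_forall_integral_eq_of_IsFiniteMeasure fun g => ?_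
  rw [integral_map hT.measurable.aemeasurable g.continuous.aestronglyMeasurable,
    integral_densityMeasure hφ hφ0, integral_densityMeasure hχ hχ0]
  exact h g g.continuous

theorem integral_eq_intervalIntegral (φ : UnitAddCircle → ℝ) :
    ∫ x, φ x = ∫ x in (0 : ℝ)..1, periodize φ x := by
  have := UnitAddCircle.intervalIntegral_preimage 0 φ
  rw [zero_add] at this
  exact this.symm

/-- Change of variables on the circle for a covering map with increasing lift `e`. -/
theorem integral_mul_comp_eq {e : ℝ ≃ₜ ℝ} {w : ℝ → ℝ} (hd : ∀ x, HasDerivAt e.symm (w x) x)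
    (hw : Continuous w) {D : ℕ} (he : ∀ x, e (x + 1) = e x + D)
    {T : UnitAddCircle → UnitAddCircle} (hT : ∀ x : ℝ, T x = (e x : UnitAddCircle))
    {φ χ : UnitAddCircle → ℝ} (hφ : Continuous φ)
    (hχ : ∀ x, periodize χ x = ∑ i ∈ Finset.range D, w (x + i) * periodize φ (e.symm (x + i)))
    {g : UnitAddCircle → ℝ} (hg : Continuous g) :
    ∫ x, φ x * g (T x) = ∫ x, χ x * g x := by
  have hφc := continuous_periodize hφ
  have hgc := continuous_periodize hg
  let F : ℝ → ℝ := fun x => periodize φ x * periodize g (e x)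
  have hF : Continuous F := hφc.mul (hgc.comp e.continuous)
  -- Integrating over the fundamental domain that starts at `e.symm 0` makes the substitution end
  -- exactly on `[0, D]`; this is cut into `D` unit intervals and folded back by periodicity of `g`.
  have hend : e.symm D = e.symm 0 + 1 := by
    rw [Homeomorph.symm_apply_eq, he, e.apply_symm_apply, zero_add]
  have h1 : ∫ x, φ x * g (T x) = ∫ x in (e.symm 0)..(e.symm D), F x := by
    rw [hend, ← UnitAddCircle.intervalIntegral_preimage (e.symm 0)]
    refine intervalIntegral.integral_congr fun x _ => ?_
    simp only [F, periodize, hT]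
  have h2 := intervalIntegral.integral_comp_mul_deriv (a := 0) (b := (D : ℝ)) (f := e.symm)
    (f' := w) (g := F) (fun x _ => hd x) hw.continuousOn hF
  let J : ℝ → ℝ := fun x => w x * periodize φ (e.symm x)
  have hJ : Continuous J := hw.mul (hφc.comp e.symm.continuous)
  have h3 : ∀ x, (F ∘ e.symm) x * w x = J x * periodize g x := fun x => by
    simp only [Function.comp, F, J, e.apply_symm_apply]; ring
  have hJg : Continuous fun x => J x * periodize g x := hJ.mul hgc
  have h4 := intervalIntegral.sum_integral_adjacent_intervals (μ := volume)
    (f := fun x => J x * periodize g x) (a := fun n : ℕ => (n : ℝ)) (n := D)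
    fun k _ => hJg.intervalIntegrable _ _
  have h5 : ∀ k : ℕ, ∫ x in (k : ℝ)..((k + 1 : ℕ) : ℝ), J x * periodize g x =
      ∫ x in (0 : ℝ)..1, J (x + k) * periodize g x := fun k => by
    have := intervalIntegral.integral_comp_add_right (a := 0) (b := 1)
      (fun x => J x * periodize g x) (k : ℝ)
    rw [zero_add, show (1 : ℝ) + k = ((k + 1 : ℕ) : ℝ) by push_cast; ring] at this
    rw [← this]
    refine intervalIntegral.integral_congr fun x _ => ?_
    rw [show periodize g (x + k) = periodize g x by
      simpa using (periodize_periodic g).nat_mul k x]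
  have h6 : ∀ k : ℕ, Continuous fun x => J (x + k) * periodize g x := fun k =>
    (hJ.comp (continuous_id.add continuous_const)).mul hgc
  rw [h1, ← h2, intervalIntegral.integral_congr fun x _ => h3 x, ← Nat.cast_zero (R := ℝ), ← h4,
    Finset.sum_congr rfl fun k _ => h5 k, integral_eq_intervalIntegral,
    ← intervalIntegral.integral_finsetSum fun k _ => (h6 k).intervalIntegrable _ _]
  refine intervalIntegral.integral_congr fun x _ => ?_
  rw [show periodize (fun x => χ x * g x) x = periodize χ x * periodize g x from rfl, hχ,
    Finset.sum_mul]

/-- Translation by `1` permutes the branches cyclically: the term `i = 0` is replaced by `i = D`,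
which equals it. -/
theorem periodic_sum_range {p : ℝ → ℝ} {D : ℕ} (hp : Function.Periodic p D) :
    Function.Periodic (fun x => ∑ i ∈ Finset.range D, p (x + i)) 1 := fun x => by
  have h1 := Finset.sum_range_succ' (fun i : ℕ => p (x + i)) D
  rw [Finset.sum_range_succ] at h1
  have h2 : p (x + D) = p x := hp x
  simp only [Nat.cast_zero, add_zero, h2] at h1
  have h3 := add_right_cancel h1
  simp only
  rw [h3]
  exact Finset.sum_congr rfl fun i _ => by push_cast; ring_nf

/-! ### Kernels -/

/-- `K j` is the `j`-th derivative in the first variable of the doubly periodic kernel `K 0`, and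
all of them are continuous and bounded by `B` for `j ≤ 3`. -/
structure KernelBound (B : ℝ) (K : ℕ → ℝ → ℝ → ℝ) : Prop where
  cont : ∀ j ≤ 3, Continuous fun p : ℝ × ℝ => K j p.1 p.2
  hd : ∀ j < 3, ∀ x y, HasDerivAt (fun x => K j x y) (K (j + 1) x y) x
  bound : ∀ j ≤ 3, ∀ x y, |K j x y| ≤ B
  per : ∀ j ≤ 3, ∀ x y, K j (x + 1) y = K j x y

theorem exists_bound_of_doubly_periodic {K : ℝ × ℝ → ℝ} (hK : Continuous K)
    (h1 : ∀ x y, K (x + 1, y) = K (x, y)) (h2 : ∀ x y, K (x, y + 1) = K (x, y)) :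
    ∃ C : ℝ, ∀ x y, |K (x, y)| ≤ C := by
  obtain ⟨C, hC⟩ := (isCompact_Icc.prod isCompact_Icc : IsCompact
    (Set.Icc (0 : ℝ) 1 ×ˢ Set.Icc (0 : ℝ) 1)).exists_bound_of_continuousOn hK.continuousOn
  refine ⟨C, fun x y => ?_⟩
  have p1 : ∀ y, Function.Periodic (fun x => K (x, y)) 1 := fun y x => h1 x y
  have p2 : ∀ x, Function.Periodic (fun y => K (x, y)) 1 := fun x y => h2 x y
  have e1 : K (x, y) = K (Int.fract x, Int.fract y) := by
    have q1 := (p1 y).sub_int_mul_eq (x := x) ⌊x⌋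
    have q2 := (p2 (Int.fract x)).sub_int_mul_eq (x := y) ⌊y⌋
    simp only [mul_one] at q1 q2
    rw [← q1]
    exact q2.symm
  rw [e1]
  exact hC (Int.fract x, Int.fract y) ⟨⟨Int.fract_nonneg _, (Int.fract_lt_one _).le⟩,
    ⟨Int.fract_nonneg _, (Int.fract_lt_one _).le⟩⟩

/-- Iterated partial derivative in the first variable. -/
noncomputable def partialFst (K : ℝ × ℝ → ℝ) : ℕ → ℝ × ℝ → ℝ
  | 0 => K
  | j + 1 => fun p => fderiv ℝ (partialFst K j) p (1, 0)

theorem exists_kernelBound {H : UnitAddCircle × UnitAddCircle → ℝ} (hH : TorusContDiff 3 H) :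
    ∃ (B : ℝ) (K : ℕ → ℝ → ℝ → ℝ), 0 < B ∧ KernelBound B K ∧
      ∀ x y : ℝ, K 0 x y = H ((x : UnitAddCircle), (y : UnitAddCircle)) := by
  set K0 : ℝ × ℝ → ℝ := fun p => H ((p.1 : UnitAddCircle), (p.2 : UnitAddCircle)) with hK0
  have hc : ∀ j k : ℕ, j + k = 3 → ContDiff ℝ k (partialFst K0 j) := by
    intro j
    induction j with
    | zero => intro k hk; obtain rfl : k = 3 := by omega
              exact hH
    | succ j ih =>
      intro k hk
      have h1 := ih (k + 1) (by omega)
      exact (ContDiff.fderiv_right h1 (by norm_cast)).clm_apply contDiff_const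
  have hp : ∀ j (a : ℝ × ℝ), (∀ p, K0 (p + a) = K0 p) →
      ∀ p, partialFst K0 j (p + a) = partialFst K0 j p := by
    intro j a ha
    induction j with
    | zero => exact ha
    | succ j ih =>
      intro p
      have : (fun p => partialFst K0 j (p + a)) = partialFst K0 j := funext ih
      simp only [partialFst]
      rw [← fderiv_comp_add_right, this]
  have hp1 : ∀ j x y, partialFst K0 j (x + 1, y) = partialFst K0 j (x, y) := fun j x y => by
    have := hp j (1, 0) (fun p => by simp [hK0]) (x, y)
    simpa using this
  have hp2 : ∀ j x y, partialFst K0 j (x, y + 1) = partialFst K0 j (x, y) := fun j x y => by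
    have := hp j (0, 1) (fun p => by simp [hK0]) (x, y)
    simpa using this
  have hcont : ∀ j ≤ 3, Continuous (partialFst K0 j) := fun j hj =>
    (hc j (3 - j) (by omega)).continuous
  have hb : ∀ j, ∃ C : ℝ, j ≤ 3 → ∀ x y, |partialFst K0 j (x, y)| ≤ C := fun j => by
    by_cases hj : j ≤ 3
    · obtain ⟨C, hC⟩ := exists_bound_of_doubly_periodic (hcont j hj) (hp1 j) (hp2 j)
      exact ⟨C, fun _ => hC⟩
    · exact ⟨0, fun h => absurd h hj⟩
  choose C hC using hb
  -- The summand `1` keeps the bound strictly positive even for a vanishing kernel.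
  refine ⟨1 + ∑ j ∈ Finset.range 4, |C j|, fun j x y => partialFst K0 j (x, y), by positivity,
    ⟨hcont, fun j hj x y => ?_, fun j hj x y => ?_, fun j _ => hp1 j⟩, fun x y => rfl⟩
  · have h1 : DifferentiableAt ℝ (partialFst K0 j) (x, y) :=
      (hc j (3 - j) (by omega)).differentiable (by
        have : 3 - j ≠ 0 := by omega
        exact_mod_cast this) _
    have h2 : HasDerivAt (fun x : ℝ => (x, y)) ((1 : ℝ), (0 : ℝ)) x :=
      (hasDerivAt_id x).prodMk (hasDerivAt_const x y)
    exact h1.hasFDerivAt.comp_hasDerivAt x h2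
  · have h1 := Finset.single_le_sum (f := fun j => |C j|) (fun i _ => abs_nonneg _)
      (Finset.mem_range.2 (show j < 4 by omega))
    linarith [hC j hj x y, le_abs_self (C j)]

/-! ### The mean field -/

/-- The mean field `∫ K(x, y) u(y) dy / ∫ u` and its derivatives. -/
noncomputable def meanField (K : ℕ → ℝ → ℝ → ℝ) (u : ℝ → ℝ) (j : ℕ) (x : ℝ) : ℝ :=
  (∫ y in (0 : ℝ)..1, K j x y * u y) / ∫ y in (0 : ℝ)..1, u y

namespace KernelBound

variable {B : ℝ} {K : ℕ → ℝ → ℝ → ℝ}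

theorem continuous_mul (H : KernelBound B K) {u : ℝ → ℝ} (hu : Continuous u) {j : ℕ} (hj : j ≤ 3) :
    Continuous fun p : ℝ × ℝ => K j p.1 p.2 * u p.2 :=
  (H.cont j hj).mul (hu.comp continuous_snd)

theorem continuous_mul_right (H : KernelBound B K) {u : ℝ → ℝ} (hu : Continuous u) {j : ℕ}
    (hj : j ≤ 3) (x : ℝ) : Continuous fun y => K j x y * u y :=
  (H.continuous_mul hu hj).comp (continuous_const.prodMk continuous_id)

theorem abs_integral_le (H : KernelBound B K) {u : ℝ → ℝ} (hu : Continuous u)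
    (hu0 : ∀ x, 0 ≤ u x) {j : ℕ} (hj : j ≤ 3) (x : ℝ) :
    |∫ y in (0 : ℝ)..1, K j x y * u y| ≤ B * ∫ y in (0 : ℝ)..1, u y := by
  rw [← intervalIntegral.integral_const_mul]
  refine intervalIntegral.norm_integral_le_of_norm_le (f := fun y => K j x y * u y)
    zero_le_one (Eventually.of_forall fun y _ => ?_) ((hu.const_mul B).intervalIntegrable _ _)
  rw [Real.norm_eq_abs, abs_mul, abs_of_nonneg (hu0 y)]
  exact mul_le_mul_of_nonneg_right (H.bound j hj x y) (hu0 y)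

/-- Differentiation under the integral. Because the average is normalised, `B` does not depend on
the density, so all fields obey the same constants. -/
theorem fieldBound (H : KernelBound B K) {u : ℝ → ℝ} (hu : Continuous u)
    (hu0 : ∀ x, 0 ≤ u x) (hpos : 0 < ∫ y in (0 : ℝ)..1, u y) :
    FieldBound B (meanField K u) := by
  refine ⟨fun j hj x => ?_, ?_, fun j hj x => ?_, fun j hj x => ?_⟩
  · refine HasDerivAt.div_const ?_ _
    have hB : 0 ≤ B := (abs_nonneg _).trans (H.bound 0 (by norm_num) 0 0)
    refine (intervalIntegral.hasDerivAt_integral_of_dominated_loc_of_deriv_le (𝕜 := ℝ)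
      (F := fun x y => K j x y * u y) (F' := fun x y => K (j + 1) x y * u y)
      (bound := fun y => B * u y) (s := Set.univ) univ_mem ?_ ?_ ?_ ?_ ?_ ?_).2
    · exact Eventually.of_forall fun x =>
        (H.continuous_mul_right hu hj.le x).aestronglyMeasurable
    · exact (H.continuous_mul_right hu hj.le x).intervalIntegrable _ _
    · exact (H.continuous_mul_right hu hj x).aestronglyMeasurable
    · refine Eventually.of_forall fun y _ x _ => ?_
      rw [Real.norm_eq_abs, abs_mul, abs_of_nonneg (hu0 y)]
      exact mul_le_mul_of_nonneg_right (H.bound (j + 1) hj x y) (hu0 y)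
    · exact (hu.const_mul B).intervalIntegrable _ _
    · exact Eventually.of_forall fun y _ x _ => (H.hd j hj x y).mul_const _
  · exact (intervalIntegral.continuous_parametric_intervalIntegral_of_continuous'
      (f := fun x y => K 3 x y * u y) (H.continuous_mul hu le_rfl) 0 1).div_const _
  · rw [meanField, abs_div, abs_of_pos hpos, div_le_iff₀ hpos]
    exact H.abs_integral_le hu hu0 hj x
  · simp only [meanField, H.per j hj]

/-- The mean fields of close densities are close. -/
theorem abs_meanField_sub_le (H : KernelBound B K) {u v : ℝ → ℝ} (hu : Continuous u)
    (hv : Continuous v) (hv0 : ∀ x, 0 ≤ v x) (hpos : 0 < ∫ y in (0 : ℝ)..1, v y) {m M : ℝ}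
    (hm : 0 < m) (hmM : m ≤ M) (hl : ∀ x, m * v x ≤ u x) (hup : ∀ x, u x ≤ M * v x) :
    ∃ τ : ℝ, 0 ≤ τ ∧ τ ≤ 1 ∧ τ ≤ Real.log M - Real.log m ∧
      ∀ j ≤ 3, ∀ x, |meanField K u j x - meanField K v j x| ≤ 2 * B * τ := by
  have iu : IntervalIntegrable u volume 0 1 := hu.intervalIntegrable _ _
  have iv : IntervalIntegrable v volume 0 1 := hv.intervalIntegrable _ _
  set p := ∫ y in (0 : ℝ)..1, u y with hp
  set q := ∫ y in (0 : ℝ)..1, v y with hq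
  have h1 : m * q ≤ p := by
    rw [hp, hq, ← intervalIntegral.integral_const_mul]
    exact intervalIntegral.integral_mono_on zero_le_one (iv.const_mul m) iu fun x _ => hl x
  have h2 : p ≤ M * q := by
    rw [hp, hq, ← intervalIntegral.integral_const_mul]
    exact intervalIntegral.integral_mono_on zero_le_one iu (iv.const_mul M) fun x _ => hup x
  have p0 : 0 < p := lt_of_lt_of_le (by positivity) h1
  have hM : 0 < M := hm.trans_le hmM
  -- `τ` is the share of the mass of `u` not accounted for by `m v`. The normalised densities agree
  -- up to two pieces of mass `τ`, whence `2 B τ`; and `τ ≤ 1 - m / M ≤ log (M / m)`.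
  refine ⟨1 - m * q / p, ?_, ?_, ?_, fun j hj x => ?_⟩
  · rw [sub_nonneg, div_le_one p0]; exact h1
  · have : 0 ≤ m * q / p := by positivity
    linarith
  · have h3 : m / M ≤ m * q / p := by
      rw [div_le_div_iff₀ hM p0]; nlinarith
    have h4 := Real.one_sub_inv_le_log_of_pos (show 0 < M / m by positivity)
    rw [Real.log_div hM.ne' hm.ne', inv_div] at h4
    linarith
  · have hB : 0 ≤ B := (abs_nonneg _).trans (H.bound 0 (by norm_num) 0 0)
    have hw : Continuous fun y => u y - m * v y := hu.sub (hv.const_mul m)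
    have a1 := H.abs_integral_le hw (fun y => sub_nonneg.2 (hl y)) hj x
    have a2 := H.abs_integral_le hv hv0 hj x
    have ku : IntervalIntegrable (fun y => K j x y * u y) volume 0 1 :=
      (H.continuous_mul_right hu hj x).intervalIntegrable _ _
    have kv : IntervalIntegrable (fun y => K j x y * v y) volume 0 1 :=
      (H.continuous_mul_right hv hj x).intervalIntegrable _ _
    rw [intervalIntegral.integral_sub iu (iv.const_mul m), intervalIntegral.integral_const_mul,
      ← hp, ← hq] at a1
    have e1 : ∫ y in (0 : ℝ)..1, K j x y * (u y - m * v y) =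
        (∫ y in (0 : ℝ)..1, K j x y * u y) - m * ∫ y in (0 : ℝ)..1, K j x y * v y := by
      rw [← intervalIntegral.integral_const_mul, ← intervalIntegral.integral_sub ku
        (kv.const_mul m)]
      exact intervalIntegral.integral_congr fun y _ => by ring
    rw [e1] at a1
    simp only [meanField, ← hp, ← hq]
    rw [← hq] at a2
    set P := ∫ y in (0 : ℝ)..1, K j x y * u y
    set Q := ∫ y in (0 : ℝ)..1, K j x y * v y
    have e2 : P / p - Q / q = (P - m * Q) / p + -((1 - m * q / p) * (Q / q)) := by
      field_simp; ring
    rw [e2]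
    refine (abs_add_le _ _).trans ?_
    have t0 : 0 ≤ 1 - m * q / p := by rw [sub_nonneg, div_le_one p0]; exact h1
    have b1 : |(P - m * Q) / p| ≤ B * (1 - m * q / p) := by
      rw [abs_div, abs_of_pos p0, div_le_iff₀ p0]
      refine a1.trans (le_of_eq ?_)
      field_simp
    have b2 : |-((1 - m * q / p) * (Q / q))| ≤ (1 - m * q / p) * B := by
      rw [abs_neg, abs_mul, abs_of_nonneg t0, abs_div, abs_of_pos hpos]
      exact mul_le_mul_of_nonneg_left ((div_le_iff₀ hpos).2 a2) t0
    linarith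

theorem abs_meanField_sub_le_of_abs_sub_le (H : KernelBound B K) {u v : ℝ → ℝ} (hu : Continuous u)
    (hv : Continuous v) (hu1 : ∫ y in (0 : ℝ)..1, u y = 1) (hv1 : ∫ y in (0 : ℝ)..1, v y = 1)
    {ε : ℝ} (h : ∀ x, |u x - v x| ≤ ε) {j : ℕ} (hj : j ≤ 3) (x : ℝ) :
    |meanField K u j x - meanField K v j x| ≤ B * ε := by
  have hB : 0 ≤ B := (abs_nonneg _).trans (H.bound 0 (by norm_num) 0 0)
  simp only [meanField, hu1, hv1, div_one]
  rw [← intervalIntegral.integral_sub ((H.continuous_mul_right hu hj x).intervalIntegrable _ _)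
    ((H.continuous_mul_right hv hj x).intervalIntegrable _ _)]
  have := intervalIntegral.norm_integral_le_of_norm_le_const (a := 0) (b := 1)
    (f := fun y => K j x y * u y - K j x y * v y) (C := B * ε) fun y _ => by
      rw [← mul_sub, Real.norm_eq_abs, abs_mul]
      exact mul_le_mul (H.bound j hj x y) (h y) (abs_nonneg _) hB
  simpa using this

end KernelBound

/-! ### Lifts of expanding circle maps -/

theorem exists_int_eq_of_coe_eq_zero {d : ℝ → ℝ} (hd : Continuous d)
    (h : ∀ x, (d x : UnitAddCircle) = 0) : ∃ n : ℤ, ∀ x, d x = n := by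
  have h1 : ∀ x, ∃ n : ℤ, (n : ℝ) = d x := fun x => by
    obtain ⟨n, hn⟩ := (AddCircle.coe_eq_zero_iff (1 : ℝ)).1 (h x)
    exact ⟨n, by simpa using hn⟩
  obtain ⟨n, hn⟩ := h1 0
  refine ⟨n, fun x => ?_⟩
  rw [hn]
  have hc : (Set.range ((↑) : ℤ → ℝ)).Countable := Set.countable_range _
  exact hc.isTotallyDisconnected (Set.range d) (by rintro _ ⟨y, rfl⟩; exact h1 y)
    (isPreconnected_range hd) ⟨x, rfl⟩ ⟨0, rfl⟩

theorem exists_bound_of_periodic {p : ℝ → ℝ} {T : ℝ} (hp : Function.Periodic p T) (hT : T ≠ 0)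
    (hc : Continuous p) : ∃ C : ℝ, ∀ x, |p x| ≤ C := by
  obtain ⟨C, hC⟩ := (hp.compact_of_continuous hT hc).isBounded.exists_norm_le
  exact ⟨C, fun x => hC _ ⟨x, rfl⟩⟩

theorem hasDerivAt_comp_sgn {g : ℝ → ℝ} {g' : ℝ} (b : Bool) (t x : ℝ)
    (h : HasDerivAt g g' (sgn b * x + t)) :
    HasDerivAt (fun x => g (sgn b * x + t)) (sgn b * g') x := by
  have h1 : HasDerivAt (fun x : ℝ => sgn b * x + t) (sgn b) x := by
    simpa using ((hasDerivAt_id x).const_mul (sgn b)).add_const t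
  rw [mul_comm]
  exact h.comp x h1

/-- Isometries of the line preserve absolute values of derivatives. The sign accommodates
orientation-reversing `f`, the translation selects the branch. -/
theorem Branch.comp_sgn {w z : ℝ → ℝ} {θ c : ℝ} (h : Branch w z θ c) (b : Bool) (t : ℝ) :
    Branch (fun x => w (sgn b * x + t)) (fun x => z (sgn b * x + t)) θ c := by
  have ha : ContDiff ℝ 2 fun x : ℝ => sgn b * x + t :=
    (contDiff_const.mul contDiff_id).add contDiff_const
  have d1 : ∀ {g : ℝ → ℝ}, ContDiff ℝ 2 g → deriv (fun x => g (sgn b * x + t)) =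
      fun x => sgn b * deriv g (sgn b * x + t) := fun hg => funext fun x =>
    (hasDerivAt_comp_sgn b t x (hasDerivAt_of_contDiff_two hg _)).deriv
  have d2 : ∀ {g : ℝ → ℝ}, ContDiff ℝ 2 g → ∀ x,
      |deriv (deriv (fun x => g (sgn b * x + t))) x| = |deriv (deriv g) (sgn b * x + t)| :=
    fun hg x => by
      rw [d1 hg, ((hasDerivAt_comp_sgn b t x
        (hasDerivAt_deriv_of_contDiff_two hg _)).const_mul (sgn b)).deriv, abs_sgn_mul,
        abs_sgn_mul]
  refine ⟨h.cw.comp ha, h.cy.comp ha, fun x => h.pos _, fun x => ?_, fun x => ?_, fun x => ?_,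
    fun x => ?_⟩
  · rw [d1 h.cy, abs_sgn_mul]; exact h.dy _
  · rw [d2 h.cy]; exact h.ddy _
  · rw [d1 h.cw, abs_sgn_mul]; exact h.dw _
  · rw [d2 h.cw]; exact h.ddw _

/-- The operator `u ↦ ∑ i, w i * u ∘ z i`. -/
noncomputable def branchOp (D : ℕ) (w z : ℕ → ℝ → ℝ) (u : ℝ → ℝ) (x : ℝ) : ℝ :=
  ∑ i ∈ Finset.range D, w i x * u (z i x)

/-- `branchOp D w z` is the transfer operator of the circle map `f`. -/
structure IsTransfer (f : UnitAddCircle → UnitAddCircle) (D : ℕ) (w z : ℕ → ℝ → ℝ) : Prop where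
  pos : 0 < D
  cont : Continuous f
  per : ∀ u, Function.Periodic u 1 → Function.Periodic (branchOp D w z u) 1
  integral : ∀ φ χ : UnitAddCircle → ℝ, Continuous φ →
    periodize χ = branchOp D w z (periodize φ) → ∀ g : UnitAddCircle → ℝ, Continuous g →
      ∫ x, φ x * g (f x) = ∫ x, χ x * g x

/-- After composing with a reflection `ρ` if necessary, `f` has an increasing lift `e` with `e (x +
1) = e x + D`. The inverse branches are then `e.symm (± x + i)` for `i < D`, and their derivatives
are at most `1 / σ`. -/
theorem exists_isTransfer {f : UnitAddCircle → UnitAddCircle} (hf : CircleMapContDiff 3 f)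
    (hexp : UniformlyExpanding f) : ∃ (θ c : ℝ) (D : ℕ) (w z : ℕ → ℝ → ℝ), 0 ≤ θ ∧ θ < 1 ∧
      (∀ i, Branch (w i) (z i) θ c) ∧ IsTransfer f D w z := by
  obtain ⟨F, hF, hFf⟩ := hf
  obtain ⟨F1, hF1, hF1f, σ, hσ, hder⟩ := hexp
  have hF' : ContDiff ℝ 1 F := hF.of_le (by norm_num)
  -- Smoothness and expansion are given for possibly different lifts; these differ by an integer
  -- constant, so one lift has both properties.
  obtain ⟨n0, hn0⟩ := exists_int_eq_of_coe_eq_zero (d := fun x => F1 x - F x)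
    (hF1.continuous.sub hF.continuous) fun x => by
      rw [AddCircle.coe_sub, ← hFf, ← hF1f, sub_self]
  have hdF : ∀ x, σ < |deriv F x| := fun x => by
    have : F1 = fun x => F x + n0 := funext fun x => by linarith [hn0 x]
    have h1 := hder x
    rwa [this, deriv_add_const] at h1
  have hcd : Continuous (deriv F) := (contDiff_one_iff_deriv.1 hF').2
  -- A continuous derivative with modulus above `σ` has constant sign, by the intermediate value
  -- theorem.
  obtain ⟨b, hb⟩ : ∃ b : Bool, ∀ x, σ ≤ sgn b * deriv F x := by
    by_cases h0 : 0 < deriv F 0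
    · refine ⟨true, fun x => ?_⟩
      simp only [sgn, if_true, one_mul]
      have hx : 0 < deriv F x := by
        by_contra hneg
        obtain ⟨y, hy⟩ := mem_range_of_exists_le_of_exists_ge hcd ⟨x, not_lt.1 hneg⟩ ⟨0, h0.le⟩
        have := hdF y
        rw [hy, abs_zero] at this
        linarith
      have := hdF x
      rw [abs_of_pos hx] at this
      exact this.le
    · refine ⟨false, fun x => ?_⟩
      have hx : deriv F x ≤ 0 := by
        by_contra hneg
        obtain ⟨y, hy⟩ := mem_range_of_exists_le_of_exists_ge hcd ⟨0, not_lt.1 h0⟩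
          ⟨x, (not_le.1 hneg).le⟩
        have := hdF y
        rw [hy, abs_zero] at this
        linarith
      have := hdF x
      rw [abs_of_nonpos hx] at this
      simp only [sgn, Bool.false_eq_true, if_false]
      linarith
  have hss : sgn b * sgn b = 1 := by cases b <;> simp [sgn]
  let ρ : UnitAddCircle → UnitAddCircle := fun x => if b then x else -x
  have hρρ : ∀ x, ρ (ρ x) = x := fun x => by cases b <;> simp [ρ]
  have hρc : ∀ t : ℝ, ρ (t : UnitAddCircle) = ((sgn b * t : ℝ) : UnitAddCircle) := fun t => by
    cases b <;> simp [ρ, sgn]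
  have hρcont : Continuous ρ := by
    cases b
    · simpa [ρ] using continuous_neg
    · simpa [ρ] using continuous_id'
  have hρint : ∀ g : UnitAddCircle → ℝ, ∫ x, g (ρ x) = ∫ x, g x := fun g => by
    cases b
    · simpa [ρ] using integral_neg_eq_self g volume
    · simp [ρ]
  let G : ℝ → ℝ := fun x => sgn b * F x
  have hG : ContDiff ℝ 3 G := contDiff_const.mul hF
  have hdG : ∀ x, deriv G x = sgn b * deriv F x := fun x =>
    ((hasDerivAt_of_contDiff_one hF' x).const_mul _).deriv
  have hσ0 : 0 < σ := by linarith
  obtain ⟨e, heG, hes, hed⟩ := exists_homeomorph_of_le_deriv (n := 3) (by norm_num) hG hσ0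
    fun x => by rw [hdG]; exact hb x
  have hefT : ∀ x : ℝ, ρ (f x) = (e x : UnitAddCircle) := fun x => by rw [hFf, hρc, heG]
  obtain ⟨N, hN⟩ := exists_int_eq_of_coe_eq_zero (d := fun x => e (x + 1) - e x)
    ((e.continuous.comp (continuous_id.add continuous_const)).sub e.continuous) fun x => by
      rw [AddCircle.coe_sub, ← hefT, ← hefT]; simp
  have hmono : StrictMono G := strictMono_of_deriv_pos fun x => by
    rw [hdG]; exact hσ0.trans_le (hb x)
  have hNpos : 0 < N := by
    have h1 := hN 0
    simp only [heG] at h1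
    have h2 := hmono (show (0 : ℝ) < 0 + 1 by norm_num)
    have h3 : (0 : ℝ) < N := by linarith
    exact_mod_cast h3
  lift N to ℕ using hNpos.le with D
  have hD : 0 < D := by exact_mod_cast hNpos
  have he1 : ∀ x, e (x + 1) = e x + D := fun x => by
    have := hN x
    push_cast at this
    linarith
  have hsymm : ∀ x, e.symm (x + D) = e.symm x + 1 := fun x => by
    rw [Homeomorph.symm_apply_eq, he1, e.apply_symm_apply]
  set w : ℝ → ℝ := deriv e.symm with hw
  have hwval : ∀ x, w x = (deriv G (e.symm x))⁻¹ := fun x => (hed x).deriv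
  have hwd : ∀ x, HasDerivAt e.symm (w x) x := fun x => by rw [hwval]; exact hed x
  have hw2 : ContDiff ℝ 2 w := ((contDiff_succ_iff_deriv (n := 2)).1 hes).2.2
  have hwpos : ∀ x, 0 < w x := fun x => by
    rw [hwval, hdG]; exact inv_pos.2 (hσ0.trans_le (hb _))
  have hwle : ∀ x, w x ≤ 1 / σ := fun x => by
    rw [hwval, hdG, ← one_div]; exact one_div_le_one_div_of_le hσ0 (hb _)
  have derper : ∀ {p : ℝ → ℝ}, Function.Periodic p D → Function.Periodic (deriv p) D :=
    fun {p} hp x => by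
      have h1 : (fun x => p (x + D)) = p := funext hp
      rw [← deriv_comp_add_const, h1]
  have hwper : Function.Periodic w D := fun x => by
    have h1 : (fun x => e.symm (x + D)) = fun x => e.symm x + 1 := funext hsymm
    have h2 := deriv_comp_add_const (e.symm : ℝ → ℝ) (D : ℝ) x
    rw [h1, deriv_add_const] at h2
    exact h2.symm
  have hD0 : (D : ℝ) ≠ 0 := by exact_mod_cast hD.ne'
  have c1 : Continuous (deriv w) := (contDiff_deriv_of_two hw2).continuous
  have c2 : Continuous (deriv (deriv w)) := (contDiff_one_iff_deriv.1 (contDiff_deriv_of_two hw2)).2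
  have wc : Continuous w := hw2.continuous
  -- The weight has period `D`, so its derivatives and their quotients by the positive weight are
  -- bounded by compactness.
  obtain ⟨C1, hC1⟩ := exists_bound_of_periodic (derper hwper) hD0 c1
  obtain ⟨C2, hC2⟩ := exists_bound_of_periodic ((derper hwper).div hwper) hD0
    (c1.div wc fun x => (hwpos x).ne')
  obtain ⟨C3, hC3⟩ := exists_bound_of_periodic ((derper (derper hwper)).div hwper) hD0
    (c2.div wc fun x => (hwpos x).ne')
  have hbr : Branch w e.symm (1 / σ) (max C1 (max C2 C3)) := by
    refine ⟨hw2, hes.of_le (by norm_num), hwpos, fun x => ?_, fun x => ?_, fun x => ?_, fun x => ?_⟩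
    · rw [← hw, abs_of_pos (hwpos x)]; exact hwle x
    · exact (hC1 x).trans (le_max_left _ _)
    · have := hC2 x
      rw [Pi.div_apply, abs_div, abs_of_pos (hwpos x), div_le_iff₀ (hwpos x)] at this
      exact this.trans (mul_le_mul_of_nonneg_right
        ((le_max_left _ _).trans (le_max_right _ _)) (hwpos x).le)
    · have := hC3 x
      rw [Pi.div_apply, abs_div, abs_of_pos (hwpos x), div_le_iff₀ (hwpos x)] at this
      exact this.trans (mul_le_mul_of_nonneg_right
        ((le_max_right _ _).trans (le_max_right _ _)) (hwpos x).le)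
  have hsum : ∀ u : ℝ → ℝ, Function.Periodic u 1 →
      Function.Periodic (fun x => ∑ i ∈ Finset.range D, w (x + i) * u (e.symm (x + i))) 1 :=
    fun u hu => periodic_sum_range (p := fun x => w x * u (e.symm x)) fun x => by
      simp only [hwper x, hsymm, hu (e.symm x)]
  refine ⟨1 / σ, max C1 (max C2 C3), D, fun i x => w (sgn b * x + i),
    fun i x => e.symm (sgn b * x + i), by positivity, by rwa [div_lt_one hσ0],
    fun i => hbr.comp_sgn b i, hD, continuous_of_continuous_lift hF.continuous hFf, fun u hu x => ?_,
    fun φ χ hφ hχ g hg => ?_⟩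
  · have := hsum u hu
    simp only [branchOp]
    cases b
    · have h1 := this (-x - 1)
      simp only [sgn, Bool.false_eq_true, if_false, neg_mul, one_mul, neg_add] at h1 ⊢
      rw [sub_add_cancel] at h1
      exact h1.symm
    · simpa [sgn] using this x
  -- Testing `ρ ∘ f` against `g ∘ ρ` undoes the reflection, and Lebesgue measure is invariant under
  -- `ρ`.
  · have h1 := integral_mul_comp_eq (T := fun x => ρ (f x)) (χ := fun x => χ (ρ x))
      (g := fun x => g (ρ x)) hwd wc he1 hefT hφ (fun x => ?_) (hg.comp hρcont)
    · simp only [hρρ] at h1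
      rw [h1]
      exact hρint fun x => χ x * g x
    · have h2 := congrFun hχ (sgn b * x)
      simp only [branchOp, ← mul_assoc, hss, one_mul] at h2
      rw [← h2]
      simp only [periodize, hρc]

/-! ### Linear operators improving the cones -/

/-- A linear operator on functions on the line which preserves periodicity, positivity and mass,
is pointwise continuous, and maps the cones strictly inside themselves. -/
structure IsMarkov (a a' α α' : ℝ) (A : (ℝ → ℝ) → ℝ → ℝ) : Prop where
  a'_nonneg : 0 ≤ a'
  a'_lt : a' < a
  α'_nonneg : 0 ≤ α'
  α'_lt : α' < α
  sub_mul : ∀ u v (p : ℝ), A (fun x => u x - p * v x) = fun x => A u x - p * A v x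
  mul_sub : ∀ u v (p : ℝ), A (fun x => p * v x - u x) = fun x => p * A v x - A u x
  per : ∀ u, Function.Periodic u 1 → Function.Periodic (A u) 1
  pos : ∀ u, (∀ x, 0 < u x) → ∀ x, 0 < A u x
  c1 : ∀ u, C1Cone a u → C1Cone a' (A u)
  c2 : ∀ u, C2Cone a α u → C2Cone a' α' (A u)
  mass : ∀ u, Continuous u → Function.Periodic u 1 → (∀ x, 0 ≤ u x) →
    ∫ y in (0 : ℝ)..1, A u y = ∫ y in (0 : ℝ)..1, u y
  tendsto : ∀ (u : ℕ → ℝ → ℝ) (U : ℝ → ℝ), (∀ x, Tendsto (fun n => u n x) atTop (𝓝 (U x))) →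
    ∀ x, Tendsto (fun n => A (u n) x) atTop (𝓝 (A U x))

/-- The contraction factor of an operator mapping the cone with parameter `a` into that with
parameter `a'`. -/
noncomputable def contractionRate (a a' : ℝ) : ℝ := 1 - 1 / coneRatio a a' ^ 4

theorem contractionRate_nonneg {a a' : ℝ} (h0 : 0 ≤ a') (h : a' < a) :
    0 ≤ contractionRate a a' := by
  have : 1 ≤ coneRatio a a' ^ 4 := one_le_pow₀ (one_le_coneRatio h0 h)
  rw [contractionRate, sub_nonneg, div_le_one (by positivity)]; exact this

theorem contractionRate_lt_one {a a' : ℝ} (h0 : 0 ≤ a') (h : a' < a) :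
    contractionRate a a' < 1 := by
  have : 1 ≤ coneRatio a a' ^ 4 := one_le_pow₀ (one_le_coneRatio h0 h)
  have : 0 < 1 / coneRatio a a' ^ 4 := by positivity
  rw [contractionRate]; linarith

/-- `u - m v` and `M v - u` lie in the large cone, so their images lie in the small one, where all
functionals are comparable. By linearity this is the hypothesis of `exists_contracted_bounds`. -/
theorem IsMarkov.contraction {a a' α α' : ℝ} {A : (ℝ → ℝ) → ℝ → ℝ} (hA : IsMarkov a a' α α' A)
    {u v : ℝ → ℝ} (hu : C1Cone a u) (hv : C1Cone a v) (pu : Function.Periodic u 1)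
    (pv : Function.Periodic v 1) {m M : ℝ} (hm : 0 < m) (hmM : m ≤ M) (h : ConeBounds a u v m M) :
    ∃ m' M' : ℝ, 0 < m' ∧ m' ≤ M' ∧ ConeBounds a (A u) (A v) m' M' ∧
      Real.log M' - Real.log m' ≤ contractionRate a a' * (Real.log M - Real.log m) := by
  have ha : 0 < a := hA.a'_nonneg.trans_lt hA.a'_lt
  have c1 := hA.c1 _ (h.c1Cone_lower ha hu.contDiff hv.contDiff)
  have c2 := hA.c1 _ (h.c1Cone_upper ha hu.contDiff hv.contDiff)
  have p1 : Function.Periodic (fun x => u x - m * v x) 1 := fun x => by simp only [pu x, pv x]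
  have p2 : Function.Periodic (fun x => M * v x - u x) 1 := fun x => by simp only [pu x, pv x]
  have k1 := c1.coneFun_le_mul hA.a'_nonneg hA.a'_lt (hA.per _ p1)
  have k2 := c2.coneFun_le_mul hA.a'_nonneg hA.a'_lt (hA.per _ p2)
  have n1 := (c1.mono hA.a'_lt.le).coneFun_nonneg
  have n2 := (c2.mono hA.a'_lt.le).coneFun_nonneg
  have cu := (hA.c1 _ hu).contDiff
  have cv := (hA.c1 _ hv).contDiff
  simp only [hA.sub_mul, coneFun_sub_mul cu cv] at k1 n1
  simp only [hA.mul_sub, coneFun_mul_sub cu cv] at k2 n2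
  obtain ⟨m', M', q1, q2, -, q4, q5⟩ := exists_contracted_bounds hm hmM
    (one_le_coneRatio hA.a'_nonneg hA.a'_lt) (fun i => sub_nonneg.1 (n1 i))
    (fun i => sub_nonneg.1 (n2 i)) k1 k2
  exact ⟨m', M', hm.trans_le q1, q2, q5, q4⟩

/-! ### The `C^2` cone through linear functionals -/

/-- The functionals `a u(x) ± u'(x)` and `α u(x) ± u''(x)`. -/
noncomputable def coneFun₂ (a α : ℝ) (u : ℝ → ℝ) : (Bool × ℝ) ⊕ (Bool × ℝ) → ℝ
  | Sum.inl i => a * u i.2 + sgn i.1 * deriv u i.2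
  | Sum.inr i => α * u i.2 + sgn i.1 * deriv (deriv u) i.2

theorem coneFun₂_sub_mul {a α c : ℝ} {u v : ℝ → ℝ} (hu : ContDiff ℝ 2 u) (hv : ContDiff ℝ 2 v)
    (i : (Bool × ℝ) ⊕ (Bool × ℝ)) :
    coneFun₂ a α (fun x => u x - c * v x) i = coneFun₂ a α u i - c * coneFun₂ a α v i := by
  have d1 : deriv (fun x => u x - c * v x) = fun x => deriv u x - c * deriv v x := funext fun x =>
    ((hasDerivAt_of_contDiff_two hu x).fun_sub
      ((hasDerivAt_of_contDiff_two hv x).const_mul c)).deriv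
  have d2 : ∀ x, deriv (fun x => deriv u x - c * deriv v x) x =
      deriv (deriv u) x - c * deriv (deriv v) x := fun x =>
    ((hasDerivAt_deriv_of_contDiff_two hu x).fun_sub
      ((hasDerivAt_deriv_of_contDiff_two hv x).const_mul c)).deriv
  rcases i with i | i
  · simp only [coneFun₂, d1]; ring
  · simp only [coneFun₂, d1, d2]; ring

theorem coneFun₂_mul_sub {a α c : ℝ} {u v : ℝ → ℝ} (hu : ContDiff ℝ 2 u) (hv : ContDiff ℝ 2 v)
    (i : (Bool × ℝ) ⊕ (Bool × ℝ)) :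
    coneFun₂ a α (fun x => c * v x - u x) i = c * coneFun₂ a α v i - coneFun₂ a α u i := by
  have d1 : deriv (fun x => c * v x - u x) = fun x => c * deriv v x - deriv u x := funext fun x =>
    (((hasDerivAt_of_contDiff_two hv x).const_mul c).fun_sub
      (hasDerivAt_of_contDiff_two hu x)).deriv
  have d2 : ∀ x, deriv (fun x => c * deriv v x - deriv u x) x =
      c * deriv (deriv v) x - deriv (deriv u) x := fun x =>
    (((hasDerivAt_deriv_of_contDiff_two hv x).const_mul c).fun_sub
      (hasDerivAt_deriv_of_contDiff_two hu x)).deriv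
  rcases i with i | i
  · simp only [coneFun₂, d1]; ring
  · simp only [coneFun₂, d1, d2]; ring

theorem C2Cone.of_coneFun₂_nonneg {a α : ℝ} (ha : 0 < a) {u : ℝ → ℝ} (hu : ContDiff ℝ 2 u)
    (h : ∀ i, 0 ≤ coneFun₂ a α u i) : C2Cone a α u := by
  have h1 := C1Cone.of_coneFun_nonneg ha (hu.of_le (by norm_num)) fun i => h (Sum.inl i)
  refine ⟨hu, h1.nonneg, h1.deriv_le, fun x => ?_⟩
  have h2 := h (Sum.inr (true, x))
  have h3 := h (Sum.inr (false, x))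
  simp only [coneFun₂, sgn] at h2 h3
  norm_num at h2 h3
  rw [abs_le]; constructor <;> linarith

theorem C2Cone.coneFun₂_bounds {a a' α α' : ℝ} {u : ℝ → ℝ} (h : C2Cone a' α' u)
    (i : (Bool × ℝ) ⊕ (Bool × ℝ)) :
    ∃ x, ((a - a') ⊓ (α - α')) * u x ≤ coneFun₂ a α u i ∧
      coneFun₂ a α u i ≤ ((a + a') ⊔ (α + α')) * u x := by
  rcases i with i | i
  · refine ⟨i.2, ?_, ?_⟩
    · refine (mul_le_mul_of_nonneg_right inf_le_left (h.nonneg _)).trans ?_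
      have := neg_abs_le_sgn_mul i.1 (deriv u i.2)
      have := h.deriv_le i.2
      simp only [coneFun₂]; linarith
    · refine le_trans ?_ (mul_le_mul_of_nonneg_right le_sup_left (h.nonneg _))
      have := sgn_mul_le i.1 (deriv u i.2)
      have := h.deriv_le i.2
      simp only [coneFun₂]; linarith
  · refine ⟨i.2, ?_, ?_⟩
    · refine (mul_le_mul_of_nonneg_right inf_le_right (h.nonneg _)).trans ?_
      have := neg_abs_le_sgn_mul i.1 (deriv (deriv u) i.2)
      have := h.deriv2_le i.2
      simp only [coneFun₂]; linarith
    · refine le_trans ?_ (mul_le_mul_of_nonneg_right le_sup_right (h.nonneg _))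
      have := sgn_mul_le i.1 (deriv (deriv u) i.2)
      have := h.deriv2_le i.2
      simp only [coneFun₂]; linarith

/-- The combined cone also has finite diameter, by the same Harnack argument. Contraction there
controls `u''`, which yields convergence of iterates in `C^2`. -/
theorem exists_coneFun₂_ratio {a a' α α' : ℝ} (ha' : 0 ≤ a') (haa : a' < a)
    (hαα : α' < α) : ∃ κ : ℝ, 1 ≤ κ ∧ ∀ u, C2Cone a' α' u → Function.Periodic u 1 →
      ∀ i j, coneFun₂ a α u i ≤ κ * coneFun₂ a α u j := by
  set g := (a - a') ⊓ (α - α') with hg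
  set G := (a + a') ⊔ (α + α') with hG
  have g0 : 0 < g := lt_inf_iff.2 ⟨by linarith, by linarith⟩
  have gG : g ≤ G := inf_le_left.trans (le_trans (by linarith) le_sup_left)
  have G0 : 0 < G := g0.trans_le gG
  refine ⟨G / g * Real.exp a', one_le_mul_of_one_le_of_one_le
    ((one_le_div g0).2 gG) (Real.one_le_exp ha'), fun u hu hp i j => ?_⟩
  obtain ⟨x, -, hx⟩ := hu.coneFun₂_bounds (a := a) (α := α) i
  obtain ⟨y, hy, -⟩ := hu.coneFun₂_bounds (a := a) (α := α) j
  calc coneFun₂ a α u i ≤ G * u x := hx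
    _ ≤ G * (Real.exp a' * u y) :=
        mul_le_mul_of_nonneg_left (hu.c1.le_exp_mul_of_periodic ha' hp x y) G0.le
    _ = G / g * Real.exp a' * (g * u y) := by field_simp
    _ ≤ _ := mul_le_mul_of_nonneg_left hy (by positivity)

/-! ### Densities of unit mass -/

theorem C1Cone.le_exp_of_mass {a : ℝ} (ha : 0 ≤ a) {u : ℝ → ℝ} (hu : C1Cone a u)
    (hp : Function.Periodic u 1) (h1 : ∫ y in (0 : ℝ)..1, u y = 1) (x : ℝ) :
    u x ≤ Real.exp a ∧ 1 ≤ Real.exp a * u x := by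
  have hc := hu.contDiff.continuous
  have i1 : IntervalIntegrable (fun _ : ℝ => u x) volume 0 1 := intervalIntegrable_const
  have i2 : IntervalIntegrable (fun y => Real.exp a * u y) volume 0 1 :=
    (hc.const_mul _).intervalIntegrable _ _
  have i3 : IntervalIntegrable (fun _ : ℝ => Real.exp a * u x) volume 0 1 :=
    intervalIntegrable_const
  have i4 : IntervalIntegrable u volume 0 1 := hc.intervalIntegrable _ _
  constructor
  · have := intervalIntegral.integral_mono_on zero_le_one i1 i2 fun y _ =>
      hu.le_exp_mul_of_periodic ha hp x y
    simpa [h1] using this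
  · have := intervalIntegral.integral_mono_on zero_le_one i4 i3
      fun y _ => hu.le_exp_mul_of_periodic ha hp y x
    simpa [h1] using this

/-- Equal masses pin the projective bounds around `1`, so projective closeness becomes closeness in
norm. -/
theorem le_one_of_mass {u v : ℝ → ℝ} (hu : Continuous u) (hv : Continuous v)
    (h1 : ∫ y in (0 : ℝ)..1, u y = 1) (h2 : ∫ y in (0 : ℝ)..1, v y = 1) {m M : ℝ}
    (hl : ∀ x, m * v x ≤ u x) (hup : ∀ x, u x ≤ M * v x) : m ≤ 1 ∧ 1 ≤ M := by
  have iu : IntervalIntegrable u volume 0 1 := hu.intervalIntegrable _ _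
  have iv : IntervalIntegrable v volume 0 1 := hv.intervalIntegrable _ _
  constructor
  · have := intervalIntegral.integral_mono_on zero_le_one (iv.const_mul m) iu fun y _ => hl y
    simpa [h1, h2] using this
  · have := intervalIntegral.integral_mono_on zero_le_one iu (iv.const_mul M) fun y _ => hup y
    simpa [h1, h2] using this

theorem sub_le_of_log_le {m M d d₀ : ℝ} (hm : 0 < m) (hm1 : m ≤ 1) (hmM : m ≤ M)
    (h : Real.log M - Real.log m ≤ d) (hd : d ≤ d₀) : M - m ≤ d * Real.exp d₀ := by
  have hM : 0 < M := hm.trans_le hmM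
  have d0 : 0 ≤ d := (sub_nonneg.2 (Real.log_le_log hm hmM)).trans h
  have h1 : M ≤ m * Real.exp d := by
    rw [← Real.log_le_log_iff hM (by positivity), Real.log_mul hm.ne' (Real.exp_pos d).ne',
      Real.log_exp]
    linarith
  have h2 : Real.exp d - 1 ≤ d * Real.exp d := by
    have h3 := Real.add_one_le_exp (-d)
    have h4 := mul_le_mul_of_nonneg_right h3 (Real.exp_pos d).le
    rw [← Real.exp_add, neg_add_cancel, Real.exp_zero] at h4
    linarith
  have h5 : d * Real.exp d ≤ d * Real.exp d₀ :=
    mul_le_mul_of_nonneg_left (Real.exp_le_exp.2 hd) d0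
  have h6 : 0 ≤ Real.exp d - 1 := sub_nonneg.2 (Real.one_le_exp d0)
  nlinarith

theorem exists_tendstoUniformly {f : ℕ → ℝ → ℝ} {C r : ℝ} (hr0 : 0 ≤ r) (hr1 : r < 1)
    (h : ∀ n x, |f (n + 1) x - f n x| ≤ C * r ^ n) :
    ∃ F : ℝ → ℝ, TendstoUniformly f F atTop := by
  have hd : ∀ x n, dist (f n x) (f (n + 1) x) ≤ C * r ^ n := fun x n => by
    rw [dist_comm, Real.dist_eq]; exact h n x
  have hF : ∀ x, ∃ y, Tendsto (fun n => f n x) atTop (𝓝 y) := fun x =>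
    cauchySeq_tendsto_of_complete (cauchySeq_of_le_geometric r C hr1 (hd x))
  choose F hF using hF
  refine ⟨F, Metric.tendstoUniformly_iff.2 fun ε hε => ?_⟩
  have h0 : Tendsto (fun n : ℕ => C * r ^ n / (1 - r)) atTop (𝓝 0) := by
    simpa using ((tendsto_pow_atTop_nhds_zero_of_lt_one hr0 hr1).const_mul C).div_const (1 - r)
  filter_upwards [h0.eventually (gt_mem_nhds hε)] with n hn x
  rw [dist_comm]
  exact (dist_le_of_le_geometric_of_tendsto r C hr1 (hd x) (hF x) n).trans_lt hn

/-! ### The invariant density of a linear operator -/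

theorem IsMarkov.iterate_mem {a a' α α' : ℝ} {A : (ℝ → ℝ) → ℝ → ℝ} (hA : IsMarkov a a' α α' A)
    (n : ℕ) : C2Cone a' α' (A^[n] fun _ => 1) ∧ Function.Periodic (A^[n] fun _ => 1) 1 ∧
      (∀ x, 0 < (A^[n] fun _ => 1) x) ∧ ∫ y in (0 : ℝ)..1, (A^[n] fun _ => 1) y = 1 := by
  induction n with
  | zero =>
    refine ⟨⟨contDiff_const, fun _ => zero_le_one, fun x => ?_, fun x => ?_⟩, fun _ => rfl,
      fun _ => zero_lt_one, by simp⟩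
    · simpa using hA.a'_nonneg
    · simpa using hA.α'_nonneg
  | succ n ih =>
    obtain ⟨h1, h2, h3, h4⟩ := ih
    rw [Function.iterate_succ_apply']
    refine ⟨hA.c2 _ (h1.mono hA.a'_lt.le hA.α'_lt.le), hA.per _ h2, hA.pos _ h3, ?_⟩
    rw [hA.mass _ h1.contDiff.continuous h2 h1.nonneg, h4]

/-- Consecutive iterates start at finite projective distance `L`, which Birkhoff contraction shrinks
by `r` at each step. Unit mass converts `log M - log m` into a bound on `M - m`. -/
theorem IsMarkov.exists_geometric {a a' α α' : ℝ} {A : (ℝ → ℝ) → ℝ → ℝ}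
    (hA : IsMarkov a a' α α' A) : ∃ C r : ℝ, 0 ≤ r ∧ r < 1 ∧ ∀ n i,
      |coneFun₂ a α (A^[n + 1] fun _ => 1) i - coneFun₂ a α (A^[n] fun _ => 1) i| ≤
        C * r ^ n := by
  have ha : 0 < a := hA.a'_nonneg.trans_lt hA.a'_lt
  obtain ⟨κ, hκ1, hκ⟩ := exists_coneFun₂_ratio hA.a'_nonneg hA.a'_lt hA.α'_lt
  have hκ4 : 1 ≤ κ ^ 4 := one_le_pow₀ hκ1
  have hκ0 : 0 < κ ^ 4 := by linarith
  set r := 1 - 1 / κ ^ 4 with hr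
  have hr0 : 0 ≤ r := by rw [hr, sub_nonneg, div_le_one hκ0]; exact hκ4
  have hr1 : r < 1 := by
    have : 0 < 1 / κ ^ 4 := by positivity
    linarith
  set u : ℕ → ℝ → ℝ := fun n => A^[n] fun _ => 1 with hu
  have hmem : ∀ n, C2Cone a' α' (u n) ∧ Function.Periodic (u n) 1 ∧
      (∀ x, 0 < u n x) ∧ ∫ y in (0 : ℝ)..1, u n y = 1 := hA.iterate_mem
  have hsucc : ∀ n, u (n + 1) = A (u n) := fun n => Function.iterate_succ_apply' A n _
  have hpos : ∀ n i, 0 < coneFun₂ a α (u n) i := fun n i => by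
    obtain ⟨x, hx, -⟩ := (hmem n).1.coneFun₂_bounds (a := a) (α := α) i
    refine lt_of_lt_of_le (mul_pos (lt_inf_iff.2 ⟨?_, ?_⟩) ((hmem n).2.2.1 x)) hx
    · linarith [hA.a'_lt]
    · linarith [hA.α'_lt]
  set L := 4 * Real.log κ with hL
  have hL0 : 0 ≤ L := by have := Real.log_nonneg hκ1; linarith
  have step : ∀ n, ∃ m M : ℝ, 0 < m ∧ m ≤ M ∧ (∀ i, m * coneFun₂ a α (u n) i ≤
      coneFun₂ a α (u (n + 1)) i ∧ coneFun₂ a α (u (n + 1)) i ≤ M * coneFun₂ a α (u n) i) ∧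
      Real.log M - Real.log m ≤ r ^ n * L := by
    intro n
    induction n with
    | zero =>
      obtain ⟨m, M, h1, h2, h3, h4⟩ := exists_bounds_of_comparable hκ1 (hpos 1) (hpos 0)
        (hκ _ (hmem 1).1 (hmem 1).2.1) (hκ _ (hmem 0).1 (hmem 0).2.1)
      exact ⟨m, M, h1, h2, h3, by simpa using h4.le⟩
    | succ n ih =>
      obtain ⟨m, M, hm, hmM, hb, hlog⟩ := ih
      have c0 := (hmem n).1.contDiff
      have c1 := (hmem (n + 1)).1.contDiff
      have c2 := (hmem (n + 2)).1.contDiff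
      have q1 : C2Cone a α fun x => u (n + 1) x - m * u n x :=
        C2Cone.of_coneFun₂_nonneg ha (c1.sub (contDiff_const.mul c0)) fun i => by
          rw [coneFun₂_sub_mul c1 c0]; exact sub_nonneg.2 (hb i).1
      have q2 : C2Cone a α fun x => M * u n x - u (n + 1) x :=
        C2Cone.of_coneFun₂_nonneg ha ((contDiff_const.mul c0).sub c1) fun i => by
          rw [coneFun₂_mul_sub c1 c0]; exact sub_nonneg.2 (hb i).2
      have p1 : Function.Periodic (fun x => u (n + 1) x - m * u n x) 1 := fun x => by
        simp only [(hmem n).2.1 x, (hmem (n + 1)).2.1 x]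
      have p2 : Function.Periodic (fun x => M * u n x - u (n + 1) x) 1 := fun x => by
        simp only [(hmem n).2.1 x, (hmem (n + 1)).2.1 x]
      have b1 := hA.c2 _ q1
      have b2 := hA.c2 _ q2
      have k1 := hκ _ b1 (hA.per _ p1)
      have k2 := hκ _ b2 (hA.per _ p2)
      have n1 : ∀ i, 0 ≤ coneFun₂ a α (A fun x => u (n + 1) x - m * u n x) i := fun i => by
        obtain ⟨x, hx, -⟩ := b1.coneFun₂_bounds (a := a) (α := α) i
        refine le_trans (mul_nonneg (le_inf ?_ ?_) (b1.nonneg x)) hx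
        · linarith [hA.a'_lt]
        · linarith [hA.α'_lt]
      have n2 : ∀ i, 0 ≤ coneFun₂ a α (A fun x => M * u n x - u (n + 1) x) i := fun i => by
        obtain ⟨x, hx, -⟩ := b2.coneFun₂_bounds (a := a) (α := α) i
        refine le_trans (mul_nonneg (le_inf ?_ ?_) (b2.nonneg x)) hx
        · linarith [hA.a'_lt]
        · linarith [hA.α'_lt]
      simp only [hA.sub_mul, ← hsucc, coneFun₂_sub_mul c2 c1] at k1 n1
      simp only [hA.mul_sub, ← hsucc, coneFun₂_mul_sub c2 c1] at k2 n2
      obtain ⟨m', M', w1, w2, -, w4, w5⟩ := exists_contracted_bounds hm hmM hκ1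
        (fun i => sub_nonneg.1 (n1 i)) (fun i => sub_nonneg.1 (n2 i)) k1 k2
      refine ⟨m', M', hm.trans_le w1, w2, w5, w4.trans ?_⟩
      rw [show r ^ (n + 1) * L = r * (r ^ n * L) by ring]
      exact mul_le_mul_of_nonneg_left hlog hr0
  set G := (a + a') ⊔ (α + α') with hG
  have G0 : 0 ≤ G := le_trans (by linarith [hA.a'_nonneg]) le_sup_left
  refine ⟨L * Real.exp L * (G * Real.exp a'), r, hr0, hr1, fun n i => ?_⟩
  obtain ⟨m, M, hm, hmM, hb, hlog⟩ := step n
  have hcb : ConeBounds a (u (n + 1)) (u n) m M := fun i => hb (Sum.inl i)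
  obtain ⟨m1, M1⟩ := le_one_of_mass (hmem (n + 1)).1.contDiff.continuous
    (hmem n).1.contDiff.continuous (hmem (n + 1)).2.2.2 (hmem n).2.2.2 (hcb.lower ha)
    (hcb.upper ha)
  have hrn : r ^ n * L ≤ L := mul_le_of_le_one_left hL0 (pow_le_one₀ hr0 hr1.le)
  have hMm := sub_le_of_log_le hm m1 hmM hlog hrn
  obtain ⟨x, -, hx⟩ := (hmem n).1.coneFun₂_bounds (a := a) (α := α) i
  have hx1 : coneFun₂ a α (u n) i ≤ G * Real.exp a' := hx.trans (mul_le_mul_of_nonneg_left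
    ((hmem n).1.c1.le_exp_of_mass hA.a'_nonneg (hmem n).2.1 (hmem n).2.2.2 x).1 G0)
  have hp := hpos n i
  have hbi := hb i
  calc |coneFun₂ a α (u (n + 1)) i - coneFun₂ a α (u n) i| ≤ (M - m) * coneFun₂ a α (u n) i := by
        rw [abs_le]; constructor <;> nlinarith
    _ ≤ (r ^ n * L * Real.exp L) * (G * Real.exp a') :=
        mul_le_mul hMm hx1 hp.le (by positivity)
    _ = _ := by ring

theorem IsMarkov.exists_invariant {a a' α α' : ℝ} {A : (ℝ → ℝ) → ℝ → ℝ}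
    (hA : IsMarkov a a' α α' A) : ∃ U : ℝ → ℝ, C2Cone a' α' U ∧ Function.Periodic U 1 ∧
      (∀ x, 0 < U x) ∧ ∫ y in (0 : ℝ)..1, U y = 1 ∧ A U = U := by
  have ha : 0 < a := hA.a'_nonneg.trans_lt hA.a'_lt
  obtain ⟨C, r, hr0, hr1, hC⟩ := hA.exists_geometric
  obtain ⟨u, hmem, hsucc, hC⟩ : ∃ u : ℕ → ℝ → ℝ, (∀ n, C2Cone a' α' (u n) ∧
      Function.Periodic (u n) 1 ∧ (∀ x, 0 < u n x) ∧ ∫ y in (0 : ℝ)..1, u n y = 1) ∧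
      (∀ n, u (n + 1) = A (u n)) ∧
      ∀ n i, |coneFun₂ a α (u (n + 1)) i - coneFun₂ a α (u n) i| ≤ C * r ^ n :=
    ⟨fun n => A^[n] fun _ => 1, hA.iterate_mem, fun n => Function.iterate_succ_apply' A n _, hC⟩
  have d0 : ∀ n x, |u (n + 1) x - u n x| ≤ C / a * r ^ n := fun n x => by
    have h1 := abs_le.1 (hC n (Sum.inl (true, x)))
    have h2 := abs_le.1 (hC n (Sum.inl (false, x)))
    simp only [coneFun₂, sgn] at h1 h2
    norm_num at h1 h2
    have h3 : a * |u (n + 1) x - u n x| ≤ C * r ^ n := by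
      rw [show a * |u (n + 1) x - u n x| = |a * (u (n + 1) x - u n x)| by
        rw [abs_mul, abs_of_pos ha], abs_le]
      constructor <;> linarith
    rw [div_mul_eq_mul_div, le_div_iff₀ ha]
    linarith
  have d1 : ∀ n x, |deriv (u (n + 1)) x - deriv (u n) x| ≤ C * r ^ n := fun n x => by
    have h1 := abs_le.1 (hC n (Sum.inl (true, x)))
    have h2 := abs_le.1 (hC n (Sum.inl (false, x)))
    simp only [coneFun₂, sgn] at h1 h2
    norm_num at h1 h2
    rw [abs_le]
    constructor <;> linarith
  have d2 : ∀ n x, |deriv (deriv (u (n + 1))) x - deriv (deriv (u n)) x| ≤ C * r ^ n :=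
    fun n x => by
    have h1 := abs_le.1 (hC n (Sum.inr (true, x)))
    have h2 := abs_le.1 (hC n (Sum.inr (false, x)))
    simp only [coneFun₂, sgn] at h1 h2
    norm_num at h1 h2
    rw [abs_le]
    constructor <;> linarith
  obtain ⟨U, hU⟩ := exists_tendstoUniformly (f := u) hr0 hr1 d0
  obtain ⟨V, hV⟩ := exists_tendstoUniformly (f := fun n => deriv (u n)) hr0 hr1 d1
  obtain ⟨W, hW⟩ := exists_tendstoUniformly (f := fun n => deriv (deriv (u n))) hr0 hr1 d2
  have tU : ∀ x, Tendsto (fun n => u n x) atTop (𝓝 (U x)) := fun x => hU.tendsto_at x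
  have tV : ∀ x, Tendsto (fun n => deriv (u n) x) atTop (𝓝 (V x)) := fun x => hV.tendsto_at x
  have tW : ∀ x, Tendsto (fun n => deriv (deriv (u n)) x) atTop (𝓝 (W x)) :=
    fun x => hW.tendsto_at x
  have hUV : ∀ x, HasDerivAt U (V x) x := fun x => hasDerivAt_of_tendstoUniformly hV
    (Eventually.of_forall fun n x => hasDerivAt_of_contDiff_two (hmem n).1.contDiff x) tU x
  have hVW : ∀ x, HasDerivAt V (W x) x := fun x => hasDerivAt_of_tendstoUniformly hW
    (Eventually.of_forall fun n x => hasDerivAt_deriv_of_contDiff_two (hmem n).1.contDiff x) tV x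
  have hWc : Continuous W := hW.continuous (Frequently.of_forall fun n =>
    (contDiff_one_iff_deriv.1 (contDiff_deriv_of_two (hmem n).1.contDiff)).2)
  have eV : deriv U = V := funext fun x => (hUV x).deriv
  have eW : deriv V = W := funext fun x => (hVW x).deriv
  have hVc : ContDiff ℝ 1 V := by
    rw [contDiff_one_iff_deriv, eW]
    exact ⟨fun x => (hVW x).differentiableAt, hWc⟩
  have hUc : ContDiff ℝ 2 U := (contDiff_succ_iff_deriv (n := 1)).2
    ⟨fun x => (hUV x).differentiableAt, by simp, by rw [eV]; exact hVc⟩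
  refine ⟨U, ⟨hUc, fun x => ge_of_tendsto' (tU x) fun n => (hmem n).1.nonneg x, fun x => ?_,
    fun x => ?_⟩, fun x => ?_, fun x => ?_, ?_, funext fun x => ?_⟩
  · rw [eV]
    exact le_of_tendsto_of_tendsto' (tV x).abs ((tU x).const_mul a')
      fun n => (hmem n).1.deriv_le x
  · rw [eV, eW]
    exact le_of_tendsto_of_tendsto' (tW x).abs ((tU x).const_mul α')
      fun n => (hmem n).1.deriv2_le x
  · refine tendsto_nhds_unique (tU (x + 1)) ((tU x).congr fun n => ?_)
    exact ((hmem n).2.1 x).symm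
  -- Unit mass and Harnack bound all iterates below by `exp (-a')`, so strict positivity survives
  -- the limit.
  · have h1 : 1 ≤ Real.exp a' * U x := ge_of_tendsto' ((tU x).const_mul (Real.exp a'))
      fun n => ((hmem n).1.c1.le_exp_of_mass hA.a'_nonneg (hmem n).2.1 (hmem n).2.2.2 x).2
    by_contra hneg
    have := mul_nonpos_of_nonneg_of_nonpos (Real.exp_pos a').le (not_lt.1 hneg)
    linarith
  · have h1 : Tendsto (fun n => ∫ y in (0 : ℝ)..1, u n y) atTop
        (𝓝 (∫ y in (0 : ℝ)..1, U y)) := by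
      refine intervalIntegral.tendsto_integral_filter_of_dominated_convergence
        (fun _ => Real.exp a') (Eventually.of_forall fun n =>
          (hmem n).1.contDiff.continuous.aestronglyMeasurable)
        (Eventually.of_forall fun n => Eventually.of_forall fun x _ => ?_)
        intervalIntegrable_const (Eventually.of_forall fun x _ => tU x)
      rw [Real.norm_eq_abs, abs_of_pos ((hmem n).2.2.1 x)]
      exact ((hmem n).1.c1.le_exp_of_mass hA.a'_nonneg (hmem n).2.1 (hmem n).2.2.2 x).1
    refine tendsto_nhds_unique h1 (tendsto_const_nhds.congr fun n => ?_)
    exact (hmem n).2.2.2.symm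
  · refine tendsto_nhds_unique (hA.tendsto u U tU x) ?_
    have := (tendsto_add_atTop_iff_nat (f := fun n => u n x) 1).2 (tU x)
    refine this.congr fun n => ?_
    rw [hsucc]

/-! ### The frozen transfer operator -/

/-- The data through which `f` and `H` enter: inverse branches of `f` with bounds, and the kernel
`H` with its derivatives. -/
structure Model (f : UnitAddCircle → UnitAddCircle) (H : UnitAddCircle × UnitAddCircle → ℝ)
    (θ c : ℝ) (D : ℕ) (w z : ℕ → ℝ → ℝ) (B : ℝ) (K : ℕ → ℝ → ℝ → ℝ) : Prop where
  θ_nonneg : 0 ≤ θ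
  θ_lt : θ < 1
  branch : ∀ i, Branch (w i) (z i) θ c
  transfer : IsTransfer f D w z
  B_pos : 0 < B
  kernel : KernelBound B K
  kernel_eq : ∀ x y : ℝ, K 0 x y = H ((x : UnitAddCircle), (y : UnitAddCircle))

theorem exists_model {f : UnitAddCircle → UnitAddCircle} (hf : CircleMapContDiff 3 f)
    (hexp : UniformlyExpanding f) {H : UnitAddCircle × UnitAddCircle → ℝ}
    (hH : TorusContDiff 3 H) : ∃ θ c D w z B K, Model f H θ c D w z B K := by
  obtain ⟨θ, c, D, w, z, h0, h1, hbr, htr⟩ := exists_isTransfer hf hexp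
  obtain ⟨B, K, hB, hK, hKH⟩ := exists_kernelBound hH
  exact ⟨θ, c, D, w, z, B, K, h0, h1, hbr, htr, hB, hK, hKH⟩

/-- The transfer operator of `f` composed with the displacement `x ↦ x + δ h(x)`. -/
noncomputable def stepOp (D : ℕ) (w z : ℕ → ℝ → ℝ) (δ : ℝ) (h : ℕ → ℝ → ℝ) (u : ℝ → ℝ) : ℝ → ℝ :=
  branchOp D w z (dispOp δ h u)

theorem branchOp_c1Cone {D : ℕ} {w z : ℕ → ℝ → ℝ} {θ c : ℝ} (h : ∀ i, Branch (w i) (z i) θ c)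
    {a : ℝ} {u : ℝ → ℝ} (hu : C1Cone a u) : C1Cone (c + θ * a) (branchOp D w z u) :=
  C1Cone.sum _ fun i _ => (h i).c1Cone hu

theorem branchOp_c2Cone {D : ℕ} {w z : ℕ → ℝ → ℝ} {θ c : ℝ} (h : ∀ i, Branch (w i) (z i) θ c)
    {a α : ℝ} {u : ℝ → ℝ} (hu : C2Cone a α u) :
    C2Cone (c + θ * a) (c + (2 * c * θ + c) * a + θ ^ 2 * α) (branchOp D w z u) :=
  C2Cone.sum _ fun i _ => (h i).c2Cone hu

theorem branchOp_pos {D : ℕ} (hD : 0 < D) {w z : ℕ → ℝ → ℝ} {θ c : ℝ}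
    (h : ∀ i, Branch (w i) (z i) θ c) {u : ℝ → ℝ} (hu : ∀ x, 0 < u x) (x : ℝ) :
    0 < branchOp D w z u x :=
  Finset.sum_pos (fun i _ => mul_pos ((h i).pos x) (hu _)) ⟨0, Finset.mem_range.2 hD⟩

theorem continuous_branchOp {D : ℕ} {w z : ℕ → ℝ → ℝ} {θ c : ℝ}
    (h : ∀ i, Branch (w i) (z i) θ c) {u : ℝ → ℝ} (hu : Continuous u) :
    Continuous (branchOp D w z u) :=
  continuous_finsetSum _ fun i _ => (h i).cw.continuous.mul (hu.comp (h i).cy.continuous)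

/-- Relative `C^1`-closeness is preserved by a transfer operator. -/
theorem abs_branchOp_sub_le {D : ℕ} {w z : ℕ → ℝ → ℝ} {θ c : ℝ}
    (h : ∀ i, Branch (w i) (z i) θ c) {u v : ℝ → ℝ} (hu : ContDiff ℝ 1 u) (hv : ContDiff ℝ 1 v)
    {q : ℝ} (h0 : ∀ x, |u x - v x| ≤ q * v x) (h1 : ∀ x, |deriv u x - deriv v x| ≤ q * v x)
    (x : ℝ) :
    |branchOp D w z u x - branchOp D w z v x| ≤ q * branchOp D w z v x ∧
    |deriv (branchOp D w z u) x - deriv (branchOp D w z v) x| ≤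
      (c + θ) * (q * branchOp D w z v x) := by
  have hd : ∀ {u : ℝ → ℝ}, ContDiff ℝ 1 u → deriv (branchOp D w z u) x = ∑ i ∈ Finset.range D,
      (deriv (w i) x * u (z i x) + w i x * (deriv u (z i x) * deriv (z i) x)) := fun hu =>
    (HasDerivAt.fun_sum fun i _ => (h i).hasDerivAt hu x).deriv
  rw [hd hu, hd hv]
  simp only [branchOp]
  rw [← Finset.sum_sub_distrib, ← Finset.sum_sub_distrib, Finset.mul_sum, Finset.mul_sum]
  refine ⟨(Finset.abs_sum_le_sum_abs _ _).trans (Finset.sum_le_sum fun i _ => ?_),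
    (Finset.abs_sum_le_sum_abs _ _).trans (Finset.sum_le_sum fun i _ => ?_)⟩
  · rw [← mul_sub, abs_mul, abs_of_pos ((h i).pos x)]
    refine (mul_le_mul_of_nonneg_left (h0 _) ((h i).pos x).le).trans (le_of_eq (by ring))
  · have w0 := ((h i).pos x).le
    have q0 : 0 ≤ q * v (z i x) := (abs_nonneg _).trans (h0 _)
    have e : deriv (w i) x * u (z i x) + w i x * (deriv u (z i x) * deriv (z i) x) -
        (deriv (w i) x * v (z i x) + w i x * (deriv v (z i x) * deriv (z i) x)) =
        deriv (w i) x * (u (z i x) - v (z i x)) +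
          w i x * ((deriv u (z i x) - deriv v (z i x)) * deriv (z i) x) := by ring
    rw [e]
    refine (abs_add_le _ _).trans ?_
    rw [abs_mul, abs_mul, abs_mul, abs_of_nonneg w0]
    have e1 := mul_le_mul ((h i).dw x) (h0 (z i x)) (abs_nonneg _)
      (mul_nonneg (h i).c_nonneg w0)
    have e2 := mul_le_mul_of_nonneg_left
      (mul_le_mul (h1 (z i x)) ((h i).dy x) (abs_nonneg _) q0) w0
    refine (add_le_add e1 e2).trans (le_of_eq ?_)
    ring

/-- Bound for the derivative of the inverse of the displacement. -/
noncomputable def dispRate (θ : ℝ) : ℝ := 1 / (1 - (1 - θ) / 2)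

/-- The cone parameter after one step of the operator. -/
noncomputable def nextA (θ c a : ℝ) : ℝ := c + θ * (16 + dispRate θ * a)

/-- The second cone parameter after one step of the operator. -/
noncomputable def nextα (θ c a α : ℝ) : ℝ :=
  c + (2 * c * θ + c) * (16 + dispRate θ * a) +
    θ ^ 2 * (16 + (2 * 16 * dispRate θ + 16) * a + dispRate θ ^ 2 * α)

/-- Since `θ * dispRate θ = 2 θ / (1 + θ) < 1`, both recursions are affine with slope below `1`.
That for `a` does not involve `α`, so `a` is fixed first; each parameter is chosen to drop by
exactly `1`. -/
theorem exists_cone_parameters {θ c : ℝ} (h0 : 0 ≤ θ) (h1 : θ < 1) (hc : 0 ≤ c) :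
    ∃ a α : ℝ, 0 < a ∧ 0 < α ∧ 0 ≤ nextA θ c a ∧ nextA θ c a < a ∧ 0 ≤ nextα θ c a α ∧
      nextα θ c a α < α := by
  set l := dispRate θ with hl
  have l0 : 0 < l := by rw [hl, dispRate]; exact one_div_pos.2 (by linarith)
  have hl1 : θ * l < 1 := by
    rw [hl, dispRate, mul_one_div, div_lt_one (by linarith)]; linarith
  have hl2 : θ ^ 2 * l ^ 2 < 1 := by
    rw [← mul_pow]; exact pow_lt_one₀ (by positivity) hl1 (by norm_num)
  have s1 : 0 < 1 - θ * l := by linarith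
  have s2 : 0 < 1 - θ ^ 2 * l ^ 2 := by linarith
  set a := (c + θ * 16 + 1) / (1 - θ * l) with ha
  have a0 : 0 < a := by positivity
  have ha1 : a * (1 - θ * l) = c + θ * 16 + 1 := div_mul_cancel₀ _ s1.ne'
  set C := c + (2 * c * θ + c) * (16 + l * a) + θ ^ 2 * (16 + (2 * 16 * l + 16) * a) with hC
  have C0 : 0 ≤ C := by positivity
  set α := (C + 1) / (1 - θ ^ 2 * l ^ 2) with hα
  have α0 : 0 < α := by positivity
  have hα1 : α * (1 - θ ^ 2 * l ^ 2) = C + 1 := div_mul_cancel₀ _ s2.ne'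
  refine ⟨a, α, a0, α0, ?_, ?_, ?_, ?_⟩
  · rw [nextA, ← hl]; positivity
  · rw [nextA, ← hl]; linarith
  · rw [nextα, ← hl]; positivity
  · have : nextα θ c a α = C + θ ^ 2 * l ^ 2 * α := by rw [nextα, ← hl, hC]; ring
    rw [this]; linarith

theorem integral_mul_comp_disp {B δ e : ℝ} {h : ℕ → ℝ → ℝ} (hh : FieldBound B h)
    (he : |δ| * B ≤ e) (he1 : e < 1) {T : UnitAddCircle → UnitAddCircle}
    (hT : ∀ x : ℝ, T x = ((x + δ * h 0 x : ℝ) : UnitAddCircle)) {φ ψ : UnitAddCircle → ℝ}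
    (hφ : Continuous φ) (hψ : periodize ψ = dispOp δ h (periodize φ)) {g : UnitAddCircle → ℝ}
    (hg : Continuous g) : ∫ x, φ x * g (T x) = ∫ x, ψ x * g x := by
  obtain ⟨E, hE, hs, hc, hd⟩ := hh.exists_homeomorph he he1
  have hfun : (E.symm : ℝ → ℝ) = dispInv δ h := funext hs
  refine integral_mul_comp_eq (e := E) (w := dispWeight δ h) (D := 1)
    (fun x => by rw [hfun]; exact hd x) ?_ (fun x => ?_) (fun x => by rw [hE]; exact hT x) hφ
    (fun x => ?_) hg
  · exact continuous_iff_continuousAt.2 fun x => (hh.hasDerivAt_dispWeight he he1 x).continuousAt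
  · rw [hE, hE, hh.per 0 (by norm_num)]; push_cast; ring
  · rw [hψ]; simp [dispOp, hs]

theorem exists_circle_disp {B : ℝ} (δ : ℝ) {h : ℕ → ℝ → ℝ} (hh : FieldBound B h) :
    ∃ T : UnitAddCircle → UnitAddCircle, Continuous T ∧
      ∀ x : ℝ, T x = ((x + δ * h 0 x : ℝ) : UnitAddCircle) := by
  obtain ⟨χ, hχ⟩ := exists_periodize_eq (hh.per 0 (by norm_num))
  have hT : ∀ x : ℝ, (fun y : UnitAddCircle => y + ((δ * χ y : ℝ) : UnitAddCircle)) x =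
      ((x + δ * h 0 x : ℝ) : UnitAddCircle) := fun x => by
    rw [← hχ, AddCircle.coe_add]; rfl
  exact ⟨fun y => y + ((δ * χ y : ℝ) : UnitAddCircle), continuous_of_continuous_lift
    (continuous_id.add (hh.contDiff_three.continuous.const_mul δ)) hT, hT⟩

namespace Model

variable {f : UnitAddCircle → UnitAddCircle} {H : UnitAddCircle × UnitAddCircle → ℝ}
  {θ c : ℝ} {D : ℕ} {w z : ℕ → ℝ → ℝ} {B : ℝ} {K : ℕ → ℝ → ℝ → ℝ}
  {δ : ℝ} {h : ℕ → ℝ → ℝ}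

theorem dispOp_pos (X : Model f H θ c D w z B K) (hδ : |δ| * B ≤ (1 - θ) / 2)
    (hh : FieldBound B h) {u : ℝ → ℝ} (hu : ∀ x, 0 < u x) (x : ℝ) : 0 < dispOp δ h u x :=
  mul_pos (hh.dispWeight_pos hδ (by linarith [X.θ_nonneg]) x) (hu _)

theorem continuous_dispOp (X : Model f H θ c D w z B K) (hδ : |δ| * B ≤ (1 - θ) / 2)
    (hh : FieldBound B h) {u : ℝ → ℝ} (hu : Continuous u) : Continuous (dispOp δ h u) := by
  have br := hh.branch hδ (by linarith [X.θ_nonneg])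
  exact br.cw.continuous.mul (hu.comp br.cy.continuous)

theorem integral_stepOp (X : Model f H θ c D w z B K) (hδ : |δ| * B ≤ (1 - θ) / 2)
    (hh : FieldBound B h) {u : ℝ → ℝ} (hu : Continuous u) (hp : Function.Periodic u 1) :
    ∫ y in (0 : ℝ)..1, stepOp D w z δ h u y = ∫ y in (0 : ℝ)..1, u y := by
  have hlt : (1 - θ) / 2 < 1 := by linarith [X.θ_nonneg]
  obtain ⟨T, hTc, hT⟩ := exists_circle_disp δ hh
  obtain ⟨φ, hφ⟩ := exists_periodize_eq hp
  have p1 := hh.dispOp_periodic hδ hlt hp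
  obtain ⟨ψ, hψ⟩ := exists_periodize_eq p1
  obtain ⟨χ, hχ⟩ := exists_periodize_eq (X.transfer.per _ p1)
  have hφc : Continuous φ := continuous_of_periodize (by
    change Continuous (periodize φ); rwa [hφ])
  have hψc : Continuous ψ := continuous_of_periodize (by
    change Continuous (periodize ψ); rw [hψ]; exact X.continuous_dispOp hδ hh hu)
  have h1 := integral_mul_comp_disp hh hδ hlt hT hφc (ψ := ψ) (by rw [hφ]; exact hψ)
    (g := fun _ => 1) continuous_const
  have h2 := X.transfer.integral ψ χ hψc (by rw [hψ]; exact hχ) (fun _ => 1) continuous_const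
  simp only [mul_one] at h1 h2
  rw [integral_eq_intervalIntegral, integral_eq_intervalIntegral] at h1 h2
  rw [hφ] at h1
  rw [hχ] at h2
  exact (h1.trans h2).symm

theorem isMarkov (X : Model f H θ c D w z B K) (hδ : |δ| * B ≤ (1 - θ) / 2)
    (hh : FieldBound B h) {a α : ℝ} (ha0 : 0 ≤ nextA θ c a) (ha : nextA θ c a < a)
    (hα0 : 0 ≤ nextα θ c a α) (hα : nextα θ c a α < α) :
    IsMarkov a (nextA θ c a) α (nextα θ c a α) (stepOp D w z δ h) := by
  have hle : (1 - θ) / 2 ≤ 1 / 2 := by linarith [X.θ_nonneg]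
  refine ⟨ha0, ha, hα0, hα, fun u v p => ?_, fun u v p => ?_, fun u hp => ?_, fun u hu => ?_,
    fun u hu => ?_, fun u hu => ?_, fun u hu hp _ => X.integral_stepOp hδ hh hu hp,
    fun u U hU x => ?_⟩
  · funext x
    simp only [stepOp, branchOp, dispOp, Finset.mul_sum, ← Finset.sum_sub_distrib]
    exact Finset.sum_congr rfl fun i _ => by ring
  · funext x
    simp only [stepOp, branchOp, dispOp, Finset.mul_sum, ← Finset.sum_sub_distrib]
    exact Finset.sum_congr rfl fun i _ => by ring
  · exact X.transfer.per _ (hh.dispOp_periodic hδ (by linarith) hp)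
  · exact branchOp_pos X.transfer.pos X.branch (X.dispOp_pos hδ hh hu)
  · exact branchOp_c1Cone X.branch (hh.c1Cone hδ hle hu)
  · exact branchOp_c2Cone X.branch (hh.c2Cone hδ hle hu)
  · simp only [stepOp, branchOp, dispOp]
    exact tendsto_finsetSum _ fun i _ => ((hU _).const_mul _).const_mul _

/-- The self-consistent operator on densities is the frozen operator for its own mean field. -/
theorem periodize_densitySTO (X : Model f H θ c D w z B K) (hδ : |δ| * B ≤ (1 - θ) / 2) {φ : UnitAddCircle → ℝ}
    (hφ : Continuous φ) (hφ0 : ∀ x, 0 < periodize φ x) :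
    FieldBound B (meanField K (periodize φ)) ∧ periodize (densitySTO f H δ φ) =
      stepOp D w z δ (meanField K (periodize φ)) (periodize φ) := by
  have hlt : (1 - θ) / 2 < 1 := by linarith [X.θ_nonneg]
  have hφc := continuous_periodize hφ
  have hφp := periodize_periodic φ
  have hint : 0 < ∫ y in (0 : ℝ)..1, periodize φ y :=
    intervalIntegral.intervalIntegral_pos_of_pos (hφc.intervalIntegrable _ _) hφ0 zero_lt_one
  have hh : FieldBound B (meanField K (periodize φ)) :=
    X.kernel.fieldBound hφc (fun x => (hφ0 x).le) hint
  refine ⟨hh, ?_⟩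
  have φ0 : ∀ x, 0 ≤ φ x := fun x => (forall_periodize (p := fun t => 0 < t)).2 hφ0 x |>.le
  set h := meanField K (periodize φ) with hhdef
  have p1 := hh.dispOp_periodic hδ hlt hφp
  obtain ⟨ψ, hψ⟩ := exists_periodize_eq p1
  obtain ⟨χ, hχ⟩ := exists_periodize_eq (X.transfer.per _ p1)
  have hψc : Continuous ψ := continuous_of_periodize (by
    change Continuous (periodize ψ); rw [hψ]; exact X.continuous_dispOp hδ hh hφc)
  have hχc : Continuous χ := continuous_of_periodize (by
    change Continuous (periodize χ); rw [hχ]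
    exact continuous_branchOp X.branch (X.continuous_dispOp hδ hh hφc))
  have ψpos := X.dispOp_pos hδ hh hφ0
  have ψ0 : ∀ x, 0 ≤ ψ x := forall_periodize.2 fun x => by rw [hψ]; exact (ψpos x).le
  have χ0 : ∀ x, 0 ≤ χ x := forall_periodize.2 fun x => by
    rw [hχ]; exact (branchOp_pos X.transfer.pos X.branch ψpos x).le
  have hreal : (densityMeasure φ).real Set.univ = ∫ y in (0 : ℝ)..1, periodize φ y := by
    have := integral_densityMeasure hφ φ0 fun _ => 1
    rw [integral_const, smul_eq_mul, mul_one] at this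
    rw [this, integral_eq_intervalIntegral]
    simp only [mul_one]
  have hT : ∀ x : ℝ, couplingMap H δ (densityMeasure φ) x =
      ((x + δ * h 0 x : ℝ) : UnitAddCircle) := fun x => by
    rw [couplingMap, average_eq, integral_densityMeasure hφ φ0, hreal, AddCircle.coe_add, hhdef,
      meanField, integral_eq_intervalIntegral, smul_eq_mul, div_eq_inv_mul]
    congr 4
    refine intervalIntegral.integral_congr fun y _ => ?_
    simp only [X.kernel_eq, periodize]; ring
  have hTc := continuous_of_continuous_lift
    (continuous_id.add (hh.contDiff_three.continuous.const_mul δ)) hT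
  have d1 : IsContDensity (couplingSTO H δ (densityMeasure φ)) ψ :=
    isContDensity_map hTc hφ φ0 hψc ψ0 fun g hg => integral_mul_comp_disp hh hδ hlt hT hφ hψ hg
  have d2 : IsContDensity (measureSTO f H δ (densityMeasure φ)) χ := by
    rw [measureSTO, d1.2.2]
    exact isContDensity_map X.transfer.cont hψc ψ0 hχc χ0 fun g hg =>
      X.transfer.integral ψ χ hψc (by rw [hψ]; exact hχ) g hg
  rw [densitySTO, d2.contDensity_eq, hχ]
  rfl

end Model

/-! ### Dependence of frozen operators on the field -/

/-- Constant for the dependence of the frozen operator on the field. -/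
noncomputable def fieldConst (θ c a α : ℝ) : ℝ :=
  (a + (c + θ)) / (a - nextA θ c a) * (2 * Real.exp a * (64 + 40 * a + 8 * α))

theorem log_add_sub_log_sub_le {η : ℝ} (h0 : 0 ≤ η) (h1 : η ≤ 1 / 2) :
    Real.log (1 + η) - Real.log (1 - η) ≤ 3 * η := by
  have e1 := Real.log_le_sub_one_of_pos (show 0 < 1 + η by linarith)
  have e2 := Real.one_sub_inv_le_log_of_pos (show 0 < 1 - η by linarith)
  have e3 : (1 - η)⁻¹ ≤ 1 + 2 * η := by
    rw [inv_le_iff_one_le_mul₀ (by linarith)]; nlinarith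
  linarith

/-- The `C^1` error is a small multiple of the output value. The output lies in the smaller cone,
where each functional is at least `a - nextA θ c a` times that value, so the error is small relative
to the functional. -/
theorem Model.coneBounds_stepOp {f : UnitAddCircle → UnitAddCircle}
    {H : UnitAddCircle × UnitAddCircle → ℝ} {θ c : ℝ} {D : ℕ} {w z : ℕ → ℝ → ℝ} {B : ℝ}
    {K : ℕ → ℝ → ℝ → ℝ} (X : Model f H θ c D w z B K) {δ : ℝ} (hδ : |δ| * B ≤ (1 - θ) / 2)
    {h h' : ℕ → ℝ → ℝ} (hh : FieldBound B h) (hh' : FieldBound B h') {a α : ℝ} (ha : 0 < a)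
    (hα : 0 ≤ α) (ha' : nextA θ c a < a) {u : ℝ → ℝ} (hu : C2Cone a α u)
    (hp : Function.Periodic u 1) {τ : ℝ} (hτ : ∀ j ≤ 2, ∀ x, |h j x - h' j x| ≤ τ) :
    ConeBounds a (stepOp D w z δ h u) (stepOp D w z δ h' u)
      (1 - fieldConst θ c a α * (|δ| * τ)) (1 + fieldConst θ c a α * (|δ| * τ)) := by
  have hle : (1 - θ) / 2 ≤ 1 / 2 := by linarith [X.θ_nonneg]
  have τ0 : 0 ≤ |δ| * τ :=
    mul_nonneg (abs_nonneg _) ((abs_nonneg _).trans (hτ 0 (by norm_num) 0))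
  have key := fun x => hh.abs_dispOp_sub_le hh' (hδ.trans hle) hτ ha.le hα hu hp x
  set q := 2 * Real.exp a * (64 + 40 * a + 8 * α) * (|δ| * τ) with hq
  have q0 : 0 ≤ q := by positivity
  have hb := fun x => abs_branchOp_sub_le (D := D) X.branch (hh.c1Cone hδ hle hu.c1).contDiff
    (hh'.c1Cone hδ hle hu.c1).contDiff (fun x => (key x).1) (fun x => (key x).2) x
  have hc' : C1Cone (nextA θ c a) (stepOp D w z δ h' u) :=
    branchOp_c1Cone X.branch (hh'.c1Cone hδ hle hu.c1)
  have c0 := (X.branch 0).c_nonneg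
  refine coneBounds_of_coneFun_sub_le fun i => (abs_coneFun_sub_le ha.le _ _ i).trans ?_
  have h1 : (a - nextA θ c a) * stepOp D w z δ h' u i.2 ≤ coneFun a (stepOp D w z δ h' u) i := by
    have := neg_abs_le_sgn_mul i.1 (deriv (stepOp D w z δ h' u) i.2)
    have := hc'.deriv_le i.2
    simp only [coneFun]; linarith
  have hg : 0 < a - nextA θ c a := by linarith
  obtain ⟨b1, b2⟩ := hb i.2
  calc _ ≤ a * (q * stepOp D w z δ h' u i.2) + (c + θ) * (q * stepOp D w z δ h' u i.2) :=
        add_le_add (mul_le_mul_of_nonneg_left b1 ha.le) b2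
    _ = fieldConst θ c a α * (|δ| * τ) * ((a - nextA θ c a) * stepOp D w z δ h' u i.2) := by
        rw [fieldConst, hq]; field_simp
    _ ≤ _ := mul_le_mul_of_nonneg_left h1 (mul_nonneg (mul_nonneg (div_nonneg
        (by linarith [X.θ_nonneg]) hg.le) (by positivity)) τ0)

/-- Contraction of the frozen operators up to the distance of the fields. -/
theorem Model.contraction {f : UnitAddCircle → UnitAddCircle}
    {H : UnitAddCircle × UnitAddCircle → ℝ} {θ c : ℝ} {D : ℕ} {w z : ℕ → ℝ → ℝ} {B : ℝ}
    {K : ℕ → ℝ → ℝ → ℝ} (X : Model f H θ c D w z B K) {δ : ℝ} (hδ : |δ| * B ≤ (1 - θ) / 2)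
    {h h' : ℕ → ℝ → ℝ} (hh : FieldBound B h) (hh' : FieldBound B h') {a α : ℝ} (ha : 0 < a)
    (hα : 0 ≤ α) (ha0 : 0 ≤ nextA θ c a) (ha' : nextA θ c a < a) (hα0 : 0 ≤ nextα θ c a α)
    (hα' : nextα θ c a α < α) {u v : ℝ → ℝ} (hu : C1Cone a u) (hv : C2Cone a α v)
    (pu : Function.Periodic u 1) (pv : Function.Periodic v 1) {τ : ℝ}
    (hτ : ∀ j ≤ 2, ∀ x, |h j x - h' j x| ≤ τ) (hsmall : fieldConst θ c a α * (|δ| * τ) ≤ 1 / 2)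
    {m M : ℝ} (hm : 0 < m) (hmM : m ≤ M) (hb : ConeBounds a u v m M) :
    ∃ m' M' : ℝ, 0 < m' ∧ m' ≤ M' ∧
      ConeBounds a (stepOp D w z δ h u) (stepOp D w z δ h' v) m' M' ∧
      Real.log M' - Real.log m' ≤ contractionRate a (nextA θ c a) * (Real.log M - Real.log m) +
        3 * (fieldConst θ c a α * (|δ| * τ)) := by
  -- Pass through the image of `v` under the field `h`: Birkhoff contraction for the common field,
  -- then a change of field on the single density `v`.
  obtain ⟨m₁, M₁, h1, h2, h3, h4⟩ := (X.isMarkov hδ hh ha0 ha' hα0 hα').contraction hu hv.c1 pu pv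
    hm hmM hb
  have h5 := X.coneBounds_stepOp hδ hh hh' ha hα ha' hv pv hτ
  have τ0 : 0 ≤ |δ| * τ :=
    mul_nonneg (abs_nonneg _) ((abs_nonneg _).trans (hτ 0 (by norm_num) 0))
  have η0 : 0 ≤ fieldConst θ c a α * (|δ| * τ) := by
    have := (X.branch 0).c_nonneg
    exact mul_nonneg (mul_nonneg (div_nonneg (by linarith [X.θ_nonneg]) (by linarith))
      (by positivity)) τ0
  set η := fieldConst θ c a α * (|δ| * τ)
  have hM1 : 0 < M₁ := h1.trans_le h2
  have n1 : 0 < 1 - η := by linarith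
  have n2 : 0 < 1 + η := by linarith
  refine ⟨m₁ * (1 - η), M₁ * (1 + η), mul_pos h1 n1, ?_, h3.trans h5 h1.le hM1.le, ?_⟩
  · exact mul_le_mul h2 (by linarith) n1.le hM1.le
  · rw [Real.log_mul h1.ne' n1.ne', Real.log_mul hM1.ne' n2.ne']
    linarith [log_add_sub_log_sub_le η0 hsmall]

/-- Optimal bounds allow an inequality `d ≤ r d + η` between invariant densities to be solved for
`d`. -/
theorem exists_optimal_coneBounds {a b : ℝ} (hb : 0 ≤ b) (hab : b < a) {u v : ℝ → ℝ}
    (hu : C1Cone b u) (hv : C1Cone b v) (hpu : Function.Periodic u 1)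
    (hpv : Function.Periodic v 1) (hu0 : ∀ x, 0 < u x) (hv0 : ∀ x, 0 < v x) :
    ∃ m M : ℝ, 0 < m ∧ m ≤ M ∧ ConeBounds a u v m M ∧
      ∀ m' M', 0 < m' → m' ≤ M' → ConeBounds a u v m' M' →
        Real.log M - Real.log m ≤ Real.log M' - Real.log m' := by
  have ha : 0 < a := hb.trans_lt hab
  obtain ⟨φ, rfl⟩ := exists_periodize_eq hpu
  obtain ⟨ψ, rfl⟩ := exists_periodize_eq hpv
  have hφ : φ ∈ logLipCone a := (mem_logLipCone_iff ha.le).2 ⟨hu.mono hab.le, hu0⟩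
  have hψ : ψ ∈ logLipCone a := (mem_logLipCone_iff ha.le).2 ⟨hv.mono hab.le, hv0⟩
  obtain ⟨m₀, M₀, h1, h2, h3, -⟩ := exists_coneBounds hb hab hu hv hpu hpv hu0 hv0
  have hfin : hilbertDist (logLipCone a) φ ψ ≠ ⊤ :=
    ne_top_of_le_ne_top (EReal.coe_ne_top _) (h3.hilbertDist_le ha hφ hψ h1 h2)
  obtain ⟨m, M, k1, k2, k3, k4⟩ := exists_coneBounds_of_hilbertDist_ne_top ha hφ hψ hfin
  refine ⟨m, M, k1, k2, k3, fun m' M' q1 q2 q3 => ?_⟩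
  have := q3.hilbertDist_le ha hφ hψ q1 q2
  rw [k4] at this
  exact_mod_cast this

/-! ### The self-consistent fixed point and the nonlinear contraction -/

namespace Model

variable {f : UnitAddCircle → UnitAddCircle} {H : UnitAddCircle × UnitAddCircle → ℝ}
  {θ c : ℝ} {D : ℕ} {w z : ℕ → ℝ → ℝ} {B : ℝ} {K : ℕ → ℝ → ℝ → ℝ} {δ a α : ℝ}

/-- Invariant densities of frozen operators depend in a Lipschitz way on the field. -/
theorem abs_invariant_sub_le (X : Model f H θ c D w z B K) (hδ : |δ| * B ≤ (1 - θ) / 2)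
    {h h' : ℕ → ℝ → ℝ} (hh : FieldBound B h) (hh' : FieldBound B h') (ha : 0 < a) (hα : 0 ≤ α)
    (ha0 : 0 ≤ nextA θ c a) (ha' : nextA θ c a < a) (hα0 : 0 ≤ nextα θ c a α)
    (hα' : nextα θ c a α < α) {u v : ℝ → ℝ} (hu : C2Cone (nextA θ c a) (nextα θ c a α) u)
    (hv : C2Cone (nextA θ c a) (nextα θ c a α) v) (pu : Function.Periodic u 1)
    (pv : Function.Periodic v 1) (hu0 : ∀ x, 0 < u x) (hv0 : ∀ x, 0 < v x)
    (hu1 : ∫ y in (0 : ℝ)..1, u y = 1) (hv1 : ∫ y in (0 : ℝ)..1, v y = 1)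
    (fu : stepOp D w z δ h u = u) (fv : stepOp D w z δ h' v = v) {τ : ℝ}
    (hτ : ∀ j ≤ 2, ∀ x, |h j x - h' j x| ≤ τ) (hsmall : fieldConst θ c a α * (|δ| * τ) ≤ 1 / 2)
    (x : ℝ) : |u x - v x| ≤ 3 * (fieldConst θ c a α * (|δ| * τ)) /
      (1 - contractionRate a (nextA θ c a)) *
      Real.exp (3 / 2 / (1 - contractionRate a (nextA θ c a))) * Real.exp (nextA θ c a) := by
  obtain ⟨m, M, hm, hmM, hb, hopt⟩ := exists_optimal_coneBounds ha0 ha' hu.c1 hv.c1 pu pv hu0 hv0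
  obtain ⟨m', M', h1, h2, h3, h4⟩ := X.contraction hδ hh hh' ha hα ha0 ha' hα0 hα'
    (hu.c1.mono ha'.le) (hv.mono ha'.le hα'.le) pu pv hτ hsmall hm hmM hb
  rw [fu, fv] at h3
  have h5 := hopt m' M' h1 h2 h3
  have hr1 : 0 < 1 - contractionRate a (nextA θ c a) :=
    sub_pos.2 (contractionRate_lt_one ha0 ha')
  set r := contractionRate a (nextA θ c a)
  set η := fieldConst θ c a α * (|δ| * τ)
  have hd : Real.log M - Real.log m ≤ 3 * η / (1 - r) := by
    rw [le_div_iff₀ hr1]; linarith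
  have hd2 : 3 * η / (1 - r) ≤ 3 / 2 / (1 - r) :=
    div_le_div_of_nonneg_right (by linarith) hr1.le
  have hl := hb.lower ha
  have hup := hb.upper ha
  obtain ⟨m1, M1⟩ := le_one_of_mass hu.contDiff.continuous hv.contDiff.continuous hu1 hv1 hl hup
  have hMm := sub_le_of_log_le hm m1 hmM hd hd2
  have hvE := (hv.c1.le_exp_of_mass ha0 pv hv1 x).1
  have hvx := hv0 x
  calc |u x - v x| ≤ (M - m) * v x := by
        rw [abs_le]; constructor <;> nlinarith [hl x, hup x]
    _ ≤ _ := mul_le_mul hMm hvE hvx.le (le_trans (sub_nonneg.2 hmM) hMm)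

/-- Banach's theorem for the map sending a density to the invariant density of its frozen operator;
`hs2` makes its Lipschitz constant at most `1 / 2`. -/
theorem exists_fixed (X : Model f H θ c D w z B K) (hδ : |δ| * B ≤ (1 - θ) / 2)
    (ha : 0 < a) (hα : 0 ≤ α) (ha0 : 0 ≤ nextA θ c a) (ha' : nextA θ c a < a)
    (hα0 : 0 ≤ nextα θ c a α) (hα' : nextα θ c a α < α)
    (hs1 : fieldConst θ c a α * (|δ| * (B * Real.exp a)) ≤ 1 / 2)
    (hs2 : 3 * (fieldConst θ c a α * (|δ| * B)) / (1 - contractionRate a (nextA θ c a)) *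
      Real.exp (3 / 2 / (1 - contractionRate a (nextA θ c a))) * Real.exp (nextA θ c a) ≤ 1 / 2) :
    ∃ φ : UnitAddCircle → ℝ, C2Cone (nextA θ c a) (nextα θ c a α) (periodize φ) ∧
      (∀ x, 0 < periodize φ x) ∧ ∫ x, φ x = 1 ∧ densitySTO f H δ φ = φ := by
  -- Zeros are allowed so that `S` is closed; a field needs only nonnegativity and unit mass. The
  -- upper bound `exp a` holds for all invariant densities and limits the distance of two fields, as
  -- `hs1` requires.
  let S : Set C(UnitAddCircle, ℝ) :=
    {v | (∀ x, v x ∈ Set.Icc 0 (Real.exp a)) ∧ ∫ y in (0 : ℝ)..1, periodize v y = 1}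
  have hS : IsClosed S := by
    refine IsClosed.inter (s₁ := {v : C(UnitAddCircle, ℝ) | ∀ x, v x ∈ Set.Icc 0 (Real.exp a)})
      (s₂ := {v | ∫ y in (0 : ℝ)..1, periodize v y = 1}) ?_ ?_
    · rw [Set.ofPred_forall]
      exact isClosed_iInter fun x => isClosed_Icc.preimage (continuous_eval_const x)
    · refine isClosed_singleton.preimage
        (f := fun v : C(UnitAddCircle, ℝ) => ∫ y in (0 : ℝ)..1, periodize v y) ?_
      refine intervalIntegral.continuous_parametric_intervalIntegral_of_continuous'
        (f := fun (v : C(UnitAddCircle, ℝ)) y => periodize v y) ?_ 0 1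
      exact continuous_eval.comp
        (continuous_fst.prodMk ((AddCircle.continuous_mk' 1).comp continuous_snd))
  have hfield : ∀ v ∈ S, FieldBound B (meanField K (periodize v)) := fun v hv =>
    X.kernel.fieldBound (continuous_periodize v.continuous) (fun x => (hv.1 _).1)
      (by rw [hv.2]; exact one_pos)
  have hinv : ∀ v : S, ∃ g : S, C2Cone (nextA θ c a) (nextα θ c a α) (periodize g) ∧
      (∀ x, 0 < periodize g x) ∧
      stepOp D w z δ (meanField K (periodize v)) (periodize g) = periodize g := by
    intro v
    obtain ⟨U, h1, h2, h3, h4, h5⟩ :=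
      (X.isMarkov hδ (hfield v v.2) ha0 ha' hα0 hα').exists_invariant
    obtain ⟨φ, hφ⟩ := exists_periodize_eq h2
    have hφc : Continuous φ := continuous_of_periodize (by
      change Continuous (periodize φ); rw [hφ]; exact h1.contDiff.continuous)
    refine ⟨⟨⟨φ, hφc⟩, forall_periodize.2 fun x => ?_, ?_⟩, ?_, ?_, ?_⟩
    · rw [ContinuousMap.coe_mk, hφ]
      exact ⟨(h3 x).le, (h1.c1.le_exp_of_mass ha0 h2 h4 x).1.trans (Real.exp_le_exp.2 ha'.le)⟩
    · rw [ContinuousMap.coe_mk, hφ]; exact h4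
    · simp only [ContinuousMap.coe_mk, hφ]; exact h1
    · simp only [ContinuousMap.coe_mk, hφ]; exact h3
    · simp only [ContinuousMap.coe_mk, hφ]; exact h5
  choose G hG using hinv
  have hlip : ContractingWith (1 / 2 : NNReal) G := by
    refine ⟨by rw [← NNReal.coe_lt_coe]; norm_num, LipschitzWith.of_dist_le_mul fun v v' => ?_⟩
    have hε : ∀ x, |periodize v x - periodize v' x| ≤ dist v v' := fun x =>
      ContinuousMap.dist_apply_le_dist (f := (v : C(UnitAddCircle, ℝ))) (g := v') _
    have hεE : dist v v' ≤ Real.exp a := by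
      refine (ContinuousMap.dist_le (Real.exp_pos a).le).2 fun x => ?_
      have h1 := v.2.1 x
      have h2 := v'.2.1 x
      rw [Real.dist_eq, abs_le]
      constructor <;> linarith [h1.1, h1.2, h2.1, h2.2]
    have hτ : ∀ j ≤ 2, ∀ x, |meanField K (periodize v) j x - meanField K (periodize v') j x| ≤
        B * dist v v' := fun j hj x =>
      X.kernel.abs_meanField_sub_le_of_abs_sub_le (continuous_periodize v.1.continuous)
        (continuous_periodize v'.1.continuous) v.2.2 v'.2.2 hε (by omega) x
    have c0 := (X.branch 0).c_nonneg
    have Q0 : 0 ≤ fieldConst θ c a α :=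
      mul_nonneg (div_nonneg (by linarith [X.θ_nonneg]) (by linarith)) (by positivity)
    have hsmall : fieldConst θ c a α * (|δ| * (B * dist v v')) ≤ 1 / 2 := by
      refine le_trans ?_ hs1
      gcongr
      exact X.B_pos.le
    obtain ⟨g1, g2, g3⟩ := hG v
    obtain ⟨g1', g2', g3'⟩ := hG v'
    have key := X.abs_invariant_sub_le hδ (hfield v v.2) (hfield v' v'.2) ha hα ha0 ha' hα0 hα'
      g1 g1' (periodize_periodic _) (periodize_periodic _) g2 g2' (G v).2.2 (G v').2.2 g3 g3' hτ
      hsmall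
    refine (ContinuousMap.dist_le (by positivity)).2
      (forall_periodize (φ := fun x => dist ((G v : C(UnitAddCircle, ℝ)) x)
        ((G v' : C(UnitAddCircle, ℝ)) x)) (p := fun t => t ≤ _) |>.2 fun x => ?_)
    refine (key x).trans ?_
    have h3 := mul_le_mul_of_nonneg_right hs2 (dist_nonneg (x := v) (y := v'))
    calc _ = 3 * (fieldConst θ c a α * (|δ| * B)) / (1 - contractionRate a (nextA θ c a)) *
        Real.exp (3 / 2 / (1 - contractionRate a (nextA θ c a))) * Real.exp (nextA θ c a) *
          dist v v' := by ring
      _ ≤ 1 / 2 * dist v v' := h3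
      _ = _ := by simp
  have : CompleteSpace S := hS.completeSpace_coe
  have : Nonempty S := ⟨⟨⟨fun _ => 1, continuous_const⟩,
    fun _ => ⟨zero_le_one, Real.one_le_exp ha.le⟩, by simp [periodize]⟩⟩
  obtain ⟨v, hv⟩ : ∃ v, G v = v := ⟨_, hlip.fixedPoint_isFixedPt⟩
  obtain ⟨g1, g2, g3⟩ := hG v
  rw [hv] at g1 g2 g3
  obtain ⟨-, hst⟩ := X.periodize_densitySTO hδ v.1.continuous g2
  rw [g3] at hst
  refine ⟨v, g1, g2, by rw [integral_eq_intervalIntegral]; exact v.2.2, funext fun x => ?_⟩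
  obtain ⟨t, rfl⟩ := QuotientAddGroup.mk_surjective x
  exact congrFun hst t

theorem densitySTO_mem (X : Model f H θ c D w z B K) (hδ : |δ| * B ≤ (1 - θ) / 2) (ha : 0 < a)
    {φ : UnitAddCircle → ℝ} (hφ : φ ∈ regCone a α) :
    C2Cone (nextA θ c a) (nextα θ c a α) (periodize (densitySTO f H δ φ)) ∧
      ∀ x, 0 < periodize (densitySTO f H δ φ) x := by
  obtain ⟨h1, h2⟩ := (mem_regCone_iff ha.le).1 hφ
  have hc : Continuous φ := continuous_of_periodize h1.contDiff.continuous
  obtain ⟨hh, he⟩ := X.periodize_densitySTO hδ hc h2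
  rw [he]
  have hle : (1 - θ) / 2 ≤ 1 / 2 := by linarith [X.θ_nonneg]
  exact ⟨branchOp_c2Cone X.branch (hh.c2Cone hδ hle h1),
    branchOp_pos X.transfer.pos X.branch (X.dispOp_pos hδ hh h2)⟩

/-- The fields differ by `2 B τ` with `τ` at most the distance `d`, so the cost of changing the
field is again proportional to `d`. By `hs2` it uses up at most half of the gap `1 - r`. -/
theorem hilbertDist_densitySTO_le (X : Model f H θ c D w z B K) (hδ : |δ| * B ≤ (1 - θ) / 2)
    (ha : 0 < a) (hα : 0 ≤ α) (ha0 : 0 ≤ nextA θ c a) (ha' : nextA θ c a < a)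
    (hα0 : 0 ≤ nextα θ c a α) (hα' : nextα θ c a α < α)
    (hs1 : fieldConst θ c a α * (|δ| * (2 * B)) ≤ 1 / 2)
    (hs2 : 3 * (fieldConst θ c a α * (|δ| * (2 * B))) ≤
      (1 - contractionRate a (nextA θ c a)) / 2)
    {φ ψ : UnitAddCircle → ℝ} (hφ : φ ∈ regCone a α) (hψ : ψ ∈ regCone a α) :
    hilbertDist (logLipCone a) (densitySTO f H δ φ) (densitySTO f H δ ψ) ≤
      (((1 + contractionRate a (nextA θ c a)) / 2 : ℝ) : EReal) *
        hilbertDist (logLipCone a) φ ψ := by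
  have hr0 := contractionRate_nonneg ha0 ha'
  have mem : ∀ {χ}, χ ∈ regCone a α → densitySTO f H δ χ ∈ logLipCone a := fun hχ => by
    obtain ⟨h1, h2⟩ := X.densitySTO_mem hδ ha hχ
    exact (mem_logLipCone_iff ha.le).2 ⟨h1.c1.mono ha'.le, h2⟩
  have hTφ := mem hφ
  have hTψ := mem hψ
  set r := contractionRate a (nextA θ c a)
  by_cases hd : hilbertDist (logLipCone a) φ ψ = ⊤
  · rw [hd, EReal.coe_mul_top_of_pos (by linarith)]; exact le_top
  obtain ⟨m, M, hm, hmM, hb, hdist⟩ := exists_coneBounds_of_hilbertDist_ne_top ha hφ.1 hψ.1 hd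
  obtain ⟨cφ, pφ⟩ := (mem_regCone_iff ha.le).1 hφ
  obtain ⟨cψ, pψ⟩ := (mem_regCone_iff ha.le).1 hψ
  obtain ⟨hh, he⟩ := X.periodize_densitySTO hδ (continuous_of_periodize cφ.contDiff.continuous) pφ
  obtain ⟨hh', he'⟩ := X.periodize_densitySTO hδ
    (continuous_of_periodize cψ.contDiff.continuous) pψ
  have hint : 0 < ∫ y in (0 : ℝ)..1, periodize ψ y :=
    intervalIntegral.intervalIntegral_pos_of_pos
      (cψ.contDiff.continuous.intervalIntegrable _ _) pψ zero_lt_one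
  obtain ⟨τ, τ0, τ1, τd, hτ⟩ := X.kernel.abs_meanField_sub_le cφ.contDiff.continuous
    cψ.contDiff.continuous cψ.nonneg hint hm hmM (hb.lower ha) (hb.upper ha)
  set q := fieldConst θ c a α * (|δ| * (2 * B)) with hq
  have hqτ : fieldConst θ c a α * (|δ| * (2 * B * τ)) = q * τ := by rw [hq]; ring
  have q0 : 0 ≤ q := by
    have c0 := (X.branch 0).c_nonneg
    have := X.B_pos
    exact mul_nonneg (mul_nonneg (div_nonneg (by linarith [X.θ_nonneg]) (by linarith))
      (by positivity)) (by positivity)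
  obtain ⟨m', M', h1, h2, h3, h4⟩ := X.contraction hδ hh hh' ha hα ha0 ha' hα0 hα' cφ.c1 cψ
    (periodize_periodic φ) (periodize_periodic ψ) (fun j hj => hτ j (by omega))
    (by rw [hqτ]; nlinarith) hm hmM hb
  rw [← he, ← he'] at h3
  rw [hqτ] at h4
  refine (h3.hilbertDist_le ha hTφ hTψ h1 h2).trans ?_
  rw [hdist, ← EReal.coe_mul, EReal.coe_le_coe_iff]
  nlinarith

end Model

/-! ### Choice of the coupling strength and the main theorem -/

theorem exists_small {Z : List ℝ} (hZ : ∀ x ∈ Z, 0 ≤ x) :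
    ∃ ε : ℝ, 0 < ε ∧ ∀ x ∈ Z, ∀ δ : ℝ, |δ| ≤ ε → |δ| * x ≤ 1 := by
  have hs : 0 ≤ Z.sum := List.sum_nonneg hZ
  refine ⟨1 / (1 + Z.sum), by positivity, fun x hx δ hδ => ?_⟩
  have h1 : x ≤ Z.sum := List.single_le_sum hZ x hx
  calc |δ| * x ≤ 1 / (1 + Z.sum) * (1 + Z.sum) :=
        mul_le_mul hδ (by linarith) (hZ x hx) (by positivity)
    _ = 1 := by field_simp

end SelfConsistent

open SelfConsistent

theorem theorem4p1 (f : UnitAddCircle → UnitAddCircle)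
    (hf : CircleMapContDiff 3 f) (hexp : UniformlyExpanding f)
    (H : UnitAddCircle × UnitAddCircle → ℝ) (hH : TorusContDiff 3 H) :
    ∃ δ₀ : ℝ, 0 < δ₀ ∧ ∀ δ : ℝ, |δ| ≤ δ₀ →
      ∃ a α : ℝ, 0 < a ∧ 0 < α ∧
        (∀ φ ∈ regCone a α, densitySTO f H δ φ ∈ regCone a α) ∧
        (∃ r : ℝ, 0 < r ∧ r < 1 ∧ ∀ φ ∈ regCone a α, ∀ ψ ∈ regCone a α,
          hilbertDist (logLipCone a) (densitySTO f H δ φ) (densitySTO f H δ ψ) ≤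
            (r : EReal) * hilbertDist (logLipCone a) φ ψ) ∧
        ∃ φ₀ ∈ regCone a α, (∫ x, φ₀ x) = 1 ∧ densitySTO f H δ φ₀ = φ₀ ∧
          ∀ φ ∈ regCone a α,
            Tendsto (fun n : ℕ => hilbertDist (logLipCone a) ((densitySTO f H δ)^[n] φ) φ₀)
              atTop (𝓝 0) := by
  obtain ⟨θ, c, D, w, z, B, K, X⟩ := exists_model hf hexp hH
  have c0 := (X.branch 0).c_nonneg
  have θ0 := X.θ_nonneg
  have θ1 : 0 < 1 - θ := sub_pos.2 X.θ_lt
  have B0 := X.B_pos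
  obtain ⟨a, α, ha, hα, ha0, ha', hα0, hα'⟩ := exists_cone_parameters X.θ_nonneg X.θ_lt c0
  have hr0 := contractionRate_nonneg ha0 ha'
  have hr1 : 0 < 1 - contractionRate a (nextA θ c a) :=
    sub_pos.2 (contractionRate_lt_one ha0 ha')
  have Q0 : 0 ≤ fieldConst θ c a α :=
    mul_nonneg (div_nonneg (by linarith) (by linarith)) (by positivity)
  set r := contractionRate a (nextA θ c a) with hr
  set Q := fieldConst θ c a α with hQ
  set E := Real.exp (3 / 2 / (1 - r)) * Real.exp (nextA θ c a) with hE
  -- In order: displacement rate; small perturbation and half of the spectral gap in the nonlinear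
  -- contraction; small perturbation and Lipschitz constant `1 / 2` in the fixed-point argument. `a`
  -- and `α` are already fixed, independently of `δ`.
  obtain ⟨ε, ε0, hε⟩ := exists_small (Z := [B * 2 / (1 - θ), 4 * Q * B, 12 * Q * B / (1 - r),
    2 * Q * B * Real.exp a, 6 * Q * B * E / (1 - r)]) (by
      simp only [List.mem_cons, List.not_mem_nil, or_false]
      rintro x (rfl | rfl | rfl | rfl | rfl) <;> positivity)
  refine ⟨ε, ε0, fun δ hδε => ?_⟩
  have e1 := hε (B * 2 / (1 - θ)) (by simp) δ hδε
  have e2 := hε (4 * Q * B) (by simp) δ hδε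
  have e3 := hε (12 * Q * B / (1 - r)) (by simp) δ hδε
  have e4 := hε (2 * Q * B * Real.exp a) (by simp) δ hδε
  have e5 := hε (6 * Q * B * E / (1 - r)) (by simp) δ hδε
  rw [← mul_div_assoc, div_le_one θ1] at e1
  rw [← mul_div_assoc, div_le_one hr1] at e3
  have hδ : |δ| * B ≤ (1 - θ) / 2 := by linarith
  have hcontr : ∀ φ ∈ regCone a α, ∀ ψ ∈ regCone a α,
      hilbertDist (logLipCone a) (densitySTO f H δ φ) (densitySTO f H δ ψ) ≤
        (((1 + r) / 2 : ℝ) : EReal) * hilbertDist (logLipCone a) φ ψ := fun φ hφ ψ hψ =>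
    X.hilbertDist_densitySTO_le hδ ha hα.le ha0 ha' hα0 hα' (by rw [← hQ]; linarith)
      (by rw [← hQ, ← hr]; linarith) hφ hψ
  have hmaps : ∀ φ ∈ regCone a α, densitySTO f H δ φ ∈ regCone a α := fun φ hφ => by
    obtain ⟨h1, h2⟩ := X.densitySTO_mem hδ ha hφ
    exact (mem_regCone_iff ha.le).2 ⟨h1.mono ha'.le hα'.le, h2⟩
  obtain ⟨φ₀, h1, h2, h3, h4⟩ := X.exists_fixed (δ := δ) hδ ha hα.le ha0 ha' hα0 hα'
    (by rw [← hQ]; linarith) (by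
      rw [← hQ, ← hr, mul_assoc _ (Real.exp _), ← hE]
      have : 3 * (Q * (|δ| * B)) / (1 - r) * E = |δ| * (6 * Q * B * E / (1 - r)) / 2 := by ring
      rw [this]; linarith)
  have hφ₀ : φ₀ ∈ regCone a α := (mem_regCone_iff ha.le).2 ⟨h1.mono ha'.le hα'.le, h2⟩
  refine ⟨a, α, ha, hα, hmaps, ⟨(1 + r) / 2, by linarith, by linarith, hcontr⟩, φ₀, hφ₀, h3, h4,
    fun φ hφ => ?_⟩
  set T := densitySTO f H δ with hT
  have hmem : ∀ n : ℕ, T^[n] φ ∈ regCone a α := fun n => by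
    induction n with
    | zero => exact hφ
    | succ n ih => rw [Function.iterate_succ_apply']; exact hmaps _ ih
  -- The distance from `φ` to `φ₀` may be infinite. After one step both densities lie in the smaller
  -- cone, so the geometric estimate starts at the first iterate.
  obtain ⟨d1, d2⟩ := X.densitySTO_mem hδ ha hφ
  obtain ⟨m, M, q1, q2, q3, -⟩ := exists_coneBounds ha0 ha' d1.c1 h1.c1 (periodize_periodic _)
    (periodize_periodic _) d2 h2
  have hbound : ∀ n : ℕ, hilbertDist (logLipCone a) (T^[n + 1] φ) φ₀ ≤
      ((((1 + r) / 2) ^ n * (Real.log M - Real.log m) : ℝ) : EReal) := fun n => by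
    induction n with
    | zero => simpa using q3.hilbertDist_le ha (hmem 1).1 hφ₀.1 q1 q2
    | succ n ih =>
      have h5 := hcontr _ (hmem (n + 1)) _ hφ₀
      rw [h4, ← Function.iterate_succ_apply' T] at h5
      refine h5.trans ((mul_le_mul_of_nonneg_left ih ?_).trans (le_of_eq ?_))
      · exact_mod_cast (by linarith : (0 : ℝ) ≤ (1 + r) / 2)
      · rw [← EReal.coe_mul]; congr 1; ring
  refine (tendsto_add_atTop_iff_nat 1).1 ?_
  have hlim : Tendsto (fun n : ℕ => (((1 + r) / 2) ^ n * (Real.log M - Real.log m) : ℝ)) atTop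
      (𝓝 0) := by
    simpa using (tendsto_pow_atTop_nhds_zero_of_lt_one (r := (1 + r) / 2) (by linarith)
      (by linarith)).mul_const (Real.log M - Real.log m)
  exact tendsto_of_tendsto_of_tendsto_of_le_of_le tendsto_const_nhds
    ((continuous_coe_real_ereal.tendsto 0).comp hlim)
    (fun n => hilbertDist_nonneg ha (hmem (n + 1)).1 hφ₀.1) hbound
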